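/- Let $\xi_1,\xi_2,\dots$ be i.i.d. random variables with values in $\mathbb Z^2$ that are symmetric, have mean $0$, covariance matrix equal to the identity and finite moment of order $2+\delta$ for some $\delta>0$, and that are strongly aperiodic (for every $z\in\mathbb Z^2$ the set $\{z+s:\ P(\xi_1=s)>0\}$ generates the group $\mathbb Z^2$). Let $X_n=\xi_1+\dots+\xi_n$, $X_0=0$, let $p(n,x,y)=P(x+X_n=y)$, $e_1=(1,0)$, and $$G(x)=\sum_{j=1}^\infty\,[p(j,0,x)-p(j,0,e_1)],\qquad G_n(x)=G(x)-G(\sqrt n\,e_1),\qquad x\in\mathbb Z^2,$$ where, if $\sqrt n$ is not an integer, $\sqrt n\,e_1$ stands for $re_1$ with $r$ either of the two integers next to $\sqrt n$. Put $B_1(n)=n$ and, for $k\ge2$ and $x=(x_2,\dots,x_k)\in(\mathbb Z^2)^{k-1}$, $$B_k(n,x)=\sum_{0\le i_1<\dots<i_k\le n}\ \prod_{j=2}^k 1_{\{X_{i_j}=X_{i_{j-1}}+x_j\}},\qquad \widetilde B_k(n,x)=\sum_{A\subseteq\{2,\dots,k\}}(-1)^{|A|}\Big(\prod_{i\in A}G_n(x_i)\Big)B_{k-|A|}(n,x_{A^c}),$$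 where $x_{A^c}$ is $x$ with the entries whose index lies in $A$ deleted. For $x\in(\mathbb Z^2)^{k-1}/\sqrt n$ put $\widetilde\beta_k(n,x)=\frac1n\widetilde B_k(n,x\sqrt n)$. Then the series defining $G(x)$ converges absolutely for every $x\in\mathbb Z^2$, and for every $k\ge2$ and every integer $p>1$ there is a finite constant $c=c(p)>0$, depending only on $p$, on $k$ and on the random walk, such that for all $n\ge2$, all $x,x'\in(\mathbb Z^2)^{k-1}/\sqrt n$ with $|x|,|x'|\le1$ (Euclidean norm in $(\mathbb R^2)^{k-1}$), and, if $\sqrt n$ is not an integer, either choice of $r$, the variable $|\widetilde\beta_k(n,x)-\widetilde\beta_k(n,x')|^p$ is integrable and $$E\,|\widetilde\beta_k(n,x)-\widetilde\beta_k(n,x')|^p\le c(p)\,(\log n)^{p(k-1)}\,n^k\,|x-x'|^{8^{-k}p}.$$ Moreover, for $k=2$, $$E\,|\widetilde\beta_2(n,x)-\widetilde\beta_2(n,x')|^p\le c(p)\,(\log n)^{p}\,n\,|x-x'|^{p/3}.$$ -/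

import Mathlib

open MeasureTheory ProbabilityTheory

noncomputable section

namespace RWIntersection

/-- The planar integer lattice `ℤ²`. -/
abbrev Lattice : Type := Fin 2 → ℤ

/-- The lattice point `r e₁ = (r, 0)`. -/
def axisPoint (r : ℤ) : Lattice := ![r, 0]

/-- A lattice point, seen in the Euclidean plane. -/
def toPlane (z : Lattice) : EuclideanSpace ℝ (Fin 2) := WithLp.toLp 2 fun a => (z a : ℝ)

/-- The point `y / √n` of `(ℤ²)^m / √n ⊆ (ℝ²)^m`, the latter with its Euclidean norm. -/
def scaledPoint {m : ℕ} (n : ℕ) (y : Fin m → Lattice) :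
    PiLp 2 (fun _ : Fin m => EuclideanSpace ℝ (Fin 2)) :=
  WithLp.toLp 2 fun j => (Real.sqrt n)⁻¹ • toPlane (y j)

variable {Ω : Type*} [MeasurableSpace Ω]

/-- Strong aperiodicity (Spitzer) of a `ℤ²`-valued step `η`: for each `z` the translate by `z` of
the set of possible values of `η` generates the group `ℤ²`. -/
def StronglyAperiodic (P : Measure Ω) (η : Ω → Lattice) : Prop :=
  ∀ z : Lattice, AddSubgroup.closure {y : Lattice | ∃ s, P {ω | η ω = s} ≠ 0 ∧ y = z + s} = ⊤

/-- The random walk `X_n`, the sum of the first `n` steps (`ξ i` is step number `i + 1`);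
`X_0 = 0`. -/
def walk (ξ : ℕ → Ω → Lattice) (n : ℕ) (ω : Ω) : Lattice := ∑ i ∈ Finset.range n, ξ i ω

/-- The transition probability `p(n, z, y)` of the walk. -/
def transProb (P : Measure Ω) (ξ : ℕ → Ω → Lattice) (n : ℕ) (z y : Lattice) : ℝ :=
  P.real {ω | z + walk ξ n ω = y}

/-- The term of index `j + 1` of the series `G(y) = ∑_{j ≥ 1} [p(j, 0, y) - p(j, 0, e₁)]`. -/
def potentialTerm (P : Measure Ω) (ξ : ℕ → Ω → Lattice) (y : Lattice) (j : ℕ) : ℝ :=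
  transProb P ξ (j + 1) 0 y - transProb P ξ (j + 1) 0 (axisPoint 1)

/-- The potential kernel `G(y) = ∑_{j ≥ 1} [p(j, 0, y) - p(j, 0, e₁)]`. -/
def potential (P : Measure Ω) (ξ : ℕ → Ω → Lattice) (y : Lattice) : ℝ :=
  ∑' j : ℕ, potentialTerm P ξ y j

/-- `G(y) - G(r e₁)`; this is `G_n(y)` when the integer `r` is the rounded `√n`. -/
def potentialDiff (P : Measure Ω) (ξ : ℕ → Ω → Lattice) (r : ℤ) (y : Lattice) : ℝ :=
  potential P ξ y - potential P ξ (axisPoint r)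

/-- The intersection count `B_{m+1}(n, y)` for `y = (y_2, …, y_{m+1})`, where `y_{j+2}` is written
`y j`: it is `n` for `m = 0`, and otherwise the number of `0 ≤ i_1 < ⋯ < i_{m+1} ≤ n` with
`X_{i_j} = X_{i_{j-1}} + y_j` for `2 ≤ j ≤ m + 1`. -/
def intersectionCount {m : ℕ} (ξ : ℕ → Ω → Lattice) (n : ℕ) (y : Fin m → Lattice) (ω : Ω) : ℝ :=
  open scoped Classical in
  if m = 0 then (n : ℝ)
  else ∑ i : Fin (m + 1) → Fin (n + 1) with StrictMono i,
    ∏ j : Fin m,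
      if walk ξ (i j.succ) ω = walk ξ (i j.castSucc) ω + y j then (1 : ℝ) else 0

/-- The vector `y_{Aᶜ}`: the entries of `y` with index in `A` are deleted, the others keep their
order. -/
def deleteEntries {m : ℕ} (A : Finset (Fin m)) (y : Fin m → Lattice) : Fin Aᶜ.card → Lattice :=
  fun l => y (Aᶜ.orderEmbOfFin rfl l)

/-- The renormalized count
`B̃_{m+1}(n, y) = ∑_A (-1)^{|A|} (∏_{i ∈ A} G_n(y_i)) B_{m+1-|A|}(n, y_{Aᶜ})`,
with `√n` rounded to `r` in `G_n`. -/
def renormCount {m : ℕ} (P : Measure Ω) (ξ : ℕ → Ω → Lattice) (r : ℤ) (n : ℕ)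
    (y : Fin m → Lattice) (ω : Ω) : ℝ :=
  ∑ A : Finset (Fin m), (-1 : ℝ) ^ A.card * (∏ i ∈ A, potentialDiff P ξ r (y i)) *
    intersectionCount ξ n (deleteEntries A y) ω

/-- The renormalized intersection local time at the point `x = y / √n` of `(ℤ²)^m / √n`:
`β̃_{m+1}(n, x) = B̃_{m+1}(n, √n x) / n = B̃_{m+1}(n, y) / n`. -/
def renormLocalTime {m : ℕ} (P : Measure Ω) (ξ : ℕ → Ω → Lattice) (r : ℤ) (n : ℕ)
    (y : Fin m → Lattice) (ω : Ω) : ℝ :=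
  1 / (n : ℝ) * renormCount P ξ r n y ω

end RWIntersection

end

/-! With the shifts listed from the last to the first, let `L_l(j)` be the renormalized weight of
the chains with shifts `l` that end at time `j`. It satisfies `L_{z::l}(j) = ∑_{i<j} L_l(i) 1{X_j -
X_i = z} - G_n(z) L_l(j)`. Expanding the products shows that the sum of these weights over `j ≤ n`
is the renormalized count up to a deterministic product (`renormCount_eq`), so it suffices to
compare such sums for two lists of shifts.

The indicator is smoothed by a discrete Tanaka formula (`tanaka`, `chainS_cons`). For a time scale
`T` put `u = ∑_{0≤l<T} p_l` and `v = ∑_{1≤l≤T} p_l`. Then `u - v = 1_{0} - p_T`, while `v` is the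
mean of `u` after one step. Hence the indicator may be replaced by `p_T(X_j - X_i - z)` at the price
of a martingale and of a boundary term in `v`. The renormalization enters only through `v(z) -
G_n(z)`, which is at most logarithmic and, up to a constant, is a tail of the series of `G`; its
increments are therefore at most `C |z - z'| / √T`.

Path sums obey `∑ |f(X_i)| ≤ (maximal number of visits) ‖f‖₁`. With the `ℓ¹` estimates `‖p_T(·+s) -
p_T‖₁ ≲ |s| log n / √T` and `‖u(·+s) - u‖₁ ≲ |s| log n √T`, and up to powers of `lam`, which is the
maximal number of visits plus a logarithm, the martingale has size `√(nT)`, the boundary term `T`,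
and a change of the last shift alters the smoothed part by `n |z - z'| / √T`. The `ℓ¹` estimates
come from Gaussian decay of the characteristic function (`exists_charFn_le`) and a weighted `ℓ²`
bound (`exists_kern_diff_l1`).

If shifts change by about `u √n`, then `T = n u` shows that changing the last shift costs `n √u`
(`momO_chainS_head`); this alone settles `k = 2`. For the other shifts (`momO_chainS_tail`), partial
sums of the inner weights are close by induction, but the weights themselves need not be. The
positions are therefore frozen along blocks of length `b`, so that only block sums of the weights
matter. Balancing `T`, `b` and the inner error divides the exponent by `8` at each level
(`momO_chainDiff`).

All moments are tracked only up to a factor `n` (`MomO`). Powers of logarithms and maxima over times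
cost powers of `n`, and these losses are brought back to one factor `n` by raising the exponent,
through `x ≤ n + x² / n`. The bound reached is `K n |x - x'|^{αp}` with `α = 8^{-k}`, or `1/2` for
`k = 2`, which implies the stated ones. -/

set_option linter.unusedSectionVars false

/-! ### Functions of finitely many steps, independence and the Markov property -/

namespace RWIntersection

variable {Ω : Type*} [MeasurableSpace Ω]

/-- The standing assumptions on the steps of the walk. -/
structure IsPlanarStep (P : Measure Ω) (ξ : ℕ → Ω → Lattice) : Prop where
  meas : ∀ i, Measurable (ξ i)
  indep : iIndepFun ξ P
  ident : ∀ i, IdentDistrib (ξ i) (ξ 0) P P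
  symm : IdentDistrib (ξ 0) (fun ω => -ξ 0 ω) P P
  cov : ∀ a b : Fin 2, ∫ ω, (ξ 0 ω a : ℝ) * (ξ 0 ω b : ℝ) ∂P = if a = b then 1 else 0
  aper : StronglyAperiodic P (ξ 0)

/-- `F` depends on the steps with index in `A` only. -/
def DepOn {β : Type*} (ξ : ℕ → Ω → Lattice) (A : Finset ℕ) (F : Ω → β) : Prop :=
  ∀ ω ω', (∀ i ∈ A, ξ i ω = ξ i ω') → F ω = F ω'

lemma DepOn.mono {β : Type*} {ξ : ℕ → Ω → Lattice} {A B : Finset ℕ} {F : Ω → β}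
    (h : DepOn ξ A F) (hAB : A ⊆ B) : DepOn ξ B F :=
  fun ω ω' h' => h ω ω' fun i hi => h' i (hAB hi)

lemma DepOn.comp {β γ : Type*} {ξ : ℕ → Ω → Lattice} {A : Finset ℕ} {F : Ω → β}
    (h : DepOn ξ A F) (g : β → γ) : DepOn ξ A (fun ω => g (F ω)) :=
  fun ω ω' h' => congrArg g (h ω ω' h')

lemma DepOn.sum {ι : Type*} {ξ : ℕ → Ω → Lattice} {A : Finset ℕ} (s : Finset ι)
    {F : ι → Ω → ℝ} (h : ∀ i ∈ s, DepOn ξ A (F i)) : DepOn ξ A (fun ω => ∑ i ∈ s, F i ω) :=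
  fun ω ω' e => Finset.sum_congr rfl fun i hi => h i hi ω ω' e

/-- `A → Lattice` is countable, so the factor is automatically measurable. Measurability of every
path functional below and independence over disjoint sets of steps both come from this
factorization. -/
lemma DepOn.exists_factor {β : Type*} [Nonempty β] {ξ : ℕ → Ω → Lattice} {A : Finset ℕ}
    {F : Ω → β} (h : DepOn ξ A F) :
    ∃ F' : (A → Lattice) → β, ∀ ω, F ω = F' (fun i => ξ i ω) := by
  have h1 : Function.FactorsThrough F (fun ω (i : A) => ξ i ω) := by
    intro ω ω' e
    exact h ω ω' fun i hi => congrFun e ⟨i, hi⟩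
  obtain ⟨e, he⟩ := (Function.factorsThrough_iff F).1 h1
  exact ⟨e, fun ω => congrFun he ω⟩

lemma walk_succ (ξ : ℕ → Ω → Lattice) (n : ℕ) (ω : Ω) :
    walk ξ (n + 1) ω = walk ξ n ω + ξ n ω := Finset.sum_range_succ _ _

@[simp] lemma walk_zero (ξ : ℕ → Ω → Lattice) (ω : Ω) : walk ξ 0 ω = 0 := rfl

lemma depOn_walk_sub (ξ : ℕ → Ω → Lattice) (k j : ℕ) (h : k ≤ j) :
    DepOn ξ (Finset.Ico k j) (fun ω => walk ξ j ω - walk ξ k ω) := by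
  intro ω ω' e
  simp only [walk, ← Finset.sum_Ico_eq_sub _ h]
  exact Finset.sum_congr rfl e

lemma depOn_walk (ξ : ℕ → Ω → Lattice) (j : ℕ) :
    DepOn ξ (Finset.range j) (fun ω => walk ξ j ω) := by
  intro ω ω' e
  exact Finset.sum_congr rfl e

lemma depOn_walk_of_le (ξ : ℕ → Ω → Lattice) {i j : ℕ} (h : i ≤ j) :
    DepOn ξ (Finset.range j) (fun ω => walk ξ i ω) :=
  (depOn_walk ξ i).mono (Finset.range_subset_range.2 h)

lemma depOn_const {β : Type*} (ξ : ℕ → Ω → Lattice) (A : Finset ℕ) (c : β) :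
    DepOn ξ A (fun _ : Ω => c) := fun _ _ _ => rfl

namespace IsPlanarStep

variable {P : Measure Ω} {ξ : ℕ → Ω → Lattice}

lemma measurable_depOn (hS : IsPlanarStep P ξ) {β : Type*} [MeasurableSpace β] [Nonempty β]
    {A : Finset ℕ} {F : Ω → β} (h : DepOn ξ A F) : Measurable F := by
  obtain ⟨F', hF'⟩ := h.exists_factor
  have : F = F' ∘ (fun ω (i : A) => ξ i ω) := funext hF'
  rw [this]
  exact (measurable_of_countable F').comp (measurable_pi_lambda _ fun i => hS.meas i)

lemma measurable_walk (hS : IsPlanarStep P ξ) (n : ℕ) : Measurable (walk ξ n) :=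
  hS.measurable_depOn (depOn_walk ξ n)

variable [IsProbabilityMeasure P]

lemma integrable_of_bdd {F : Ω → ℝ} (hF : Measurable F) {K : ℝ} (hK : ∀ ω, |F ω| ≤ K) :
    Integrable F P :=
  Integrable.of_bound hF.aestronglyMeasurable K (Filter.Eventually.of_forall hK)

lemma integral_mul_depOn (hS : IsPlanarStep P ξ) {A B : Finset ℕ} (hAB : Disjoint A B)
    {F H : Ω → ℝ} (hF : DepOn ξ A F) (hH : DepOn ξ B H) :
    ∫ ω, F ω * H ω ∂P = (∫ ω, F ω ∂P) * ∫ ω, H ω ∂P := by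
  obtain ⟨F', hF'⟩ := hF.exists_factor
  obtain ⟨H', hH'⟩ := hH.exists_factor
  have h1 := hS.indep.indepFun_finset A B hAB hS.meas
  have h2 := h1.comp (measurable_of_countable F') (measurable_of_countable H')
  have e1 : F = F' ∘ (fun ω (i : A) => ξ i ω) := funext hF'
  have e2 : H = H' ∘ (fun ω (i : B) => ξ i ω) := funext hH'
  rw [← e1, ← e2] at h2
  exact h2.integral_fun_mul_eq_mul_integral (hS.measurable_depOn hF).aestronglyMeasurable
    (hS.measurable_depOn hH).aestronglyMeasurable

/-- Integrating out a step that is independent of the past. -/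
lemma integral_step (hS : IsPlanarStep P ξ) {j : ℕ} {F : Ω → Lattice → ℝ}
    (hF : DepOn ξ (Finset.range j) F) {K : ℝ} (hK : ∀ ω s, |F ω s| ≤ K) :
    ∫ ω, F ω (ξ j ω) ∂P = ∫ ω, ∫ ω', F ω (ξ 0 ω') ∂P ∂P := by
  obtain ⟨F', hF'⟩ := hF.exists_factor
  set π : Ω → (Finset.range j → Lattice) := fun ω i => ξ i ω with hπ
  have hπm : Measurable π := measurable_pi_lambda _ fun i => hS.meas i
  have hi : IndepFun π (ξ j) P := by
    have h1 := hS.indep.indepFun_finset (Finset.range j) {j} (by simp) hS.meas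
    exact h1.comp (φ := id) (ψ := fun x : (({j} : Finset ℕ) → Lattice) => x ⟨j, by simp⟩)
      measurable_id (measurable_of_countable _)
  have hmap := (indepFun_iff_map_prod_eq_prod_map_map hπm.aemeasurable
    (hS.meas j).aemeasurable).1 hi
  rw [(hS.ident j).map_eq] at hmap
  set G : (Finset.range j → Lattice) × Lattice → ℝ := fun x => F' x.1 x.2 with hG
  have hGm : Measurable G := measurable_of_countable _
  have hprobπ : IsProbabilityMeasure (P.map π) := Measure.isProbabilityMeasure_map hπm.aemeasurable
  have hprob0 : IsProbabilityMeasure (P.map (ξ 0)) :=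
    Measure.isProbabilityMeasure_map (hS.meas 0).aemeasurable
  have hval : ∀ ω s, F ω s = F' (π ω) s := fun ω s => by rw [hF' ω]
  calc ∫ ω, F ω (ξ j ω) ∂P = ∫ ω, G (π ω, ξ j ω) ∂P := by simp only [hval, hG]
    _ = ∫ x, G x ∂(P.map (fun ω => (π ω, ξ j ω))) :=
        (integral_map (hπm.prodMk (hS.meas j)).aemeasurable hGm.aestronglyMeasurable).symm
    _ = ∫ x, G x ∂((P.map π).prod (P.map (ξ 0))) := by rw [hmap]
    _ = ∫ x, ∫ s, G (x, s) ∂(P.map (ξ 0)) ∂(P.map π) := by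
        refine integral_prod _ ?_
        rw [← hmap]
        refine (integrable_map_measure hGm.aestronglyMeasurable
          (hπm.prodMk (hS.meas j)).aemeasurable).2 ?_
        refine integrable_of_bdd (K := K) (hGm.comp (hπm.prodMk (hS.meas j))) fun ω => ?_
        simp only [Function.comp, hG, ← hval]
        exact hK _ _
    _ = ∫ x, ∫ ω', G (x, ξ 0 ω') ∂P ∂(P.map π) := by
        refine integral_congr_ae (Filter.Eventually.of_forall fun x => ?_)
        exact integral_map (hS.meas 0).aemeasurable
          (measurable_of_countable (fun s => G (x, s))).aestronglyMeasurable
    _ = ∫ ω, ∫ ω', G (π ω, ξ 0 ω') ∂P ∂P := by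
        refine integral_map hπm.aemeasurable ?_
        exact (measurable_of_countable
          (fun x => ∫ ω', G (x, ξ 0 ω') ∂P)).aestronglyMeasurable
    _ = _ := by simp only [hval, hG]

lemma integral_walk_add (hS : IsPlanarStep P ξ) (n m : ℕ) :
    ∀ (f : Lattice → ℝ) (K : ℝ), (∀ x, |f x| ≤ K) →
    ∫ ω, f (walk ξ (n + m) ω) ∂P = ∫ ω, ∫ ω', f (walk ξ n ω + walk ξ m ω') ∂P ∂P := by
  induction m with
  | zero => intro f K hK; simp
  | succ m ih =>
    intro f K hK
    -- The last step is averaged out; the induction runs over all bounded functions so that it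
    -- applies to this average of `f`.
    set h : Lattice → ℝ := fun x => ∫ ω', f (x + ξ 0 ω') ∂P with hh
    have hb : ∀ x, |h x| ≤ K := by
      intro x
      have := norm_integral_le_of_norm_le_const (μ := P) (f := fun ω' => f (x + ξ 0 ω')) (C := K)
        (Filter.Eventually.of_forall fun ω' => hK _)
      simpa using this
    have key : ∀ (l : ℕ) (x : Lattice), ∫ ω, f (x + walk ξ (l + 1) ω) ∂P
        = ∫ ω, h (x + walk ξ l ω) ∂P := by
      intro l x
      have := hS.integral_step (j := l) (F := fun ω s => f (x + walk ξ l ω + s)) (K := K)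
        ((depOn_walk ξ l).comp fun w s => f (x + w + s)) (fun _ _ => hK _)
      simp only [walk_succ, ← add_assoc]
      exact this
    have k0 := key (n + m) 0
    simp only [zero_add] at k0
    rw [show n + (m + 1) = n + m + 1 by ring, k0, ih h K hb]
    refine integral_congr_ae (Filter.Eventually.of_forall fun ω => ?_)
    exact (key m (walk ξ n ω)).symm

lemma integral_walk_sub (hS : IsPlanarStep P ξ) (k m : ℕ) :
    ∀ (f : Lattice → ℝ) (K : ℝ), (∀ x, |f x| ≤ K) →
    ∫ ω, f (walk ξ (k + m) ω - walk ξ k ω) ∂P = ∫ ω, f (walk ξ m ω) ∂P := by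
  induction m with
  | zero => intro f K hK; simp
  | succ m ih =>
    intro f K hK
    set h : Lattice → ℝ := fun x => ∫ ω', f (x + ξ 0 ω') ∂P with hh
    have hb : ∀ x, |h x| ≤ K := by
      intro x
      have := norm_integral_le_of_norm_le_const (μ := P) (f := fun ω' => f (x + ξ 0 ω')) (C := K)
        (Filter.Eventually.of_forall fun ω' => hK _)
      simpa using this
    have k1 := hS.integral_step (j := k + m) (K := K)
      (F := fun ω s => f (walk ξ (k + m) ω - walk ξ k ω + s))
      (((depOn_walk_sub ξ k (k + m) (by omega)).mono
        (by intro i hi; simp at hi ⊢; omega)).comp fun w s => f (w + s))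
      (fun _ _ => hK _)
    have k2 := hS.integral_step (j := m) (K := K) (F := fun ω s => f (walk ξ m ω + s))
      ((depOn_walk ξ m).comp fun w s => f (w + s)) (fun _ _ => hK _)
    have e1 : ∀ ω, walk ξ (k + (m + 1)) ω - walk ξ k ω
        = walk ξ (k + m) ω - walk ξ k ω + ξ (k + m) ω := by
      intro ω; rw [← add_assoc, walk_succ]; abel
    simp only [e1, walk_succ]
    rw [k1, k2]
    exact ih h K hb

/-! ### Transition kernel and Chapman–Kolmogorov -/

/-- The transition kernel started from the origin. -/
noncomputable def _root_.RWIntersection.kern (P : Measure Ω) (ξ : ℕ → Ω → Lattice) (n : ℕ) (y : Lattice) : ℝ :=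
  P.real {ω | walk ξ n ω = y}

lemma kern_eq_integral (hS : IsPlanarStep P ξ) (n : ℕ) (y : Lattice) :
    kern P ξ n y = ∫ ω, (if walk ξ n ω = y then (1 : ℝ) else 0) ∂P := by
  have hm : MeasurableSet {ω | walk ξ n ω = y} := hS.measurable_walk n (measurableSet_singleton y)
  have : (fun ω => if walk ξ n ω = y then (1 : ℝ) else 0)
      = Set.indicator {ω | walk ξ n ω = y} (fun _ => (1 : ℝ)) := by
    ext ω; simp [Set.indicator]
  rw [this, integral_indicator hm]
  simp [kern]

lemma _root_.RWIntersection.kern_nonneg (n : ℕ) (y : Lattice) : 0 ≤ kern P ξ n y :=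
  measureReal_nonneg

lemma _root_.RWIntersection.kern_le_one (n : ℕ) (y : Lattice) : kern P ξ n y ≤ 1 :=
  measureReal_le_one

lemma kern_sub (hS : IsPlanarStep P ξ) (k m : ℕ) (y : Lattice) :
    ∫ ω, (if walk ξ (k + m) ω - walk ξ k ω = y then (1 : ℝ) else 0) ∂P = kern P ξ m y := by
  rw [hS.kern_eq_integral,
    hS.integral_walk_sub k m (fun x => if x = y then (1 : ℝ) else 0) 1]
  intro x; split_ifs <;> simp

lemma kern_zero (y : Lattice) : kern P ξ 0 y = if y = 0 then 1 else 0 := by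
  unfold kern
  split_ifs with h
  · subst h; simp
  · have : {ω : Ω | walk ξ 0 ω = y} = ∅ := by
      ext ω; simp [walk_zero]; exact fun h' => h h'.symm
    rw [this]; simp

lemma kern_add_integral (hS : IsPlanarStep P ξ) (n m : ℕ) (y : Lattice) :
    kern P ξ (n + m) y = ∫ ω, kern P ξ m (y - walk ξ n ω) ∂P := by
  rw [hS.kern_eq_integral, hS.integral_walk_add n m (fun x => if x = y then (1 : ℝ) else 0) 1]
  · refine integral_congr_ae (Filter.Eventually.of_forall fun ω => ?_)
    simp only [hS.kern_eq_integral]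
    refine integral_congr_ae (Filter.Eventually.of_forall fun ω' => ?_)
    simp only [eq_sub_iff_add_eq']
  · intro x; split_ifs <;> simp

lemma hasSum_kern (hS : IsPlanarStep P ξ) (n : ℕ) (f : Lattice → ℝ)
    (hf : Integrable (fun ω => f (walk ξ n ω)) P) :
    HasSum (fun u => kern P ξ n u * f u) (∫ ω, f (walk ξ n ω) ∂P) := by
  have h1 := hasSum_integral_iUnion (μ := P) (f := fun ω => f (walk ξ n ω))
    (s := fun u : Lattice => {ω | walk ξ n ω = u})
    (fun u => hS.measurable_walk n (measurableSet_singleton u))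
    (by
      intro u v huv
      refine Set.disjoint_left.2 fun ω h h' => huv ?_
      simp only [Set.mem_ofPred_eq] at h h'
      rw [← h, ← h'])
    hf.integrableOn
  have h2 : (⋃ u : Lattice, {ω | walk ξ n ω = u}) = Set.univ := by
    ext ω; simp
  rw [h2, setIntegral_univ] at h1
  have e : (fun u => kern P ξ n u * f u)
      = fun u => ∫ ω in {ω | walk ξ n ω = u}, f (walk ξ n ω) ∂P := by
    funext u
    symm
    calc ∫ ω in {ω | walk ξ n ω = u}, f (walk ξ n ω) ∂P
        = ∫ ω in {ω | walk ξ n ω = u}, f u ∂P := by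
          refine setIntegral_congr_fun (hS.measurable_walk n (measurableSet_singleton u)) ?_
          intro ω hω
          simp only [Set.mem_ofPred_eq] at hω
          simp only [hω]
      _ = kern P ξ n u * f u := by simp [kern]
  rw [e]
  exact h1

lemma hasSum_kern_one (hS : IsPlanarStep P ξ) (n : ℕ) : HasSum (fun u => kern P ξ n u) 1 := by
  simpa using hS.hasSum_kern n (fun _ => (1 : ℝ)) (integrable_const _)

lemma integrable_of_bdd_walk (hS : IsPlanarStep P ξ) (n : ℕ) {f : Lattice → ℝ} {K : ℝ}
    (hf : ∀ x, |f x| ≤ K) : Integrable (fun ω => f (walk ξ n ω)) P :=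
  integrable_of_bdd (hS.measurable_depOn ((depOn_walk ξ n).comp f)) fun _ => hf _

lemma kern_add (hS : IsPlanarStep P ξ) (n m : ℕ) (y : Lattice) :
    HasSum (fun u => kern P ξ n u * kern P ξ m (y - u)) (kern P ξ (n + m) y) := by
  rw [hS.kern_add_integral]
  exact hS.hasSum_kern n (fun u => kern P ξ m (y - u)) (hS.integrable_of_bdd_walk n (K := 1)
    fun x => by
      rw [abs_of_nonneg (kern_nonneg (P := P) (ξ := ξ) m (y - x))]
      exact kern_le_one (P := P) (ξ := ξ) _ _)

end IsPlanarStep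

/-! ### Fourier inversion on the box -/

/-- The pairing of a frequency with a lattice point. -/
noncomputable def dot (θ : ℝ × ℝ) (y : Lattice) : ℝ := θ.1 * y 0 + θ.2 * y 1

/-- The `ℓ¹`-size of a lattice point. -/
noncomputable def sz (y : Lattice) : ℝ := |(y 0 : ℝ)| + |(y 1 : ℝ)|

lemma sz_nonneg (y : Lattice) : 0 ≤ sz y := by unfold sz; positivity

lemma dot_add (θ : ℝ × ℝ) (x y : Lattice) : dot θ (x + y) = dot θ x + dot θ y := by
  simp [dot]; ring

lemma dot_neg (θ : ℝ × ℝ) (x : Lattice) : dot θ (-x) = -dot θ x := by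
  simp [dot]; ring

lemma dot_sub (θ : ℝ × ℝ) (x y : Lattice) : dot θ (x - y) = dot θ x - dot θ y := by
  simp [dot]; ring

@[simp] lemma dot_zero (θ : ℝ × ℝ) : dot θ 0 = 0 := by simp [dot]

lemma abs_dot_le (θ : ℝ × ℝ) (y : Lattice) :
    |dot θ y| ≤ Real.sqrt (θ.1 ^ 2 + θ.2 ^ 2) * sz y := by
  have h1 : |θ.1| ≤ Real.sqrt (θ.1 ^ 2 + θ.2 ^ 2) :=
    Real.abs_le_sqrt (by nlinarith [sq_nonneg θ.2])
  have h2 : |θ.2| ≤ Real.sqrt (θ.1 ^ 2 + θ.2 ^ 2) :=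
    Real.abs_le_sqrt (by nlinarith [sq_nonneg θ.1])
  calc |dot θ y| ≤ |θ.1 * y 0| + |θ.2 * y 1| := abs_add_le _ _
    _ = |θ.1| * |(y 0 : ℝ)| + |θ.2| * |(y 1 : ℝ)| := by rw [abs_mul, abs_mul]
    _ ≤ Real.sqrt (θ.1 ^ 2 + θ.2 ^ 2) * |(y 0 : ℝ)| + Real.sqrt (θ.1 ^ 2 + θ.2 ^ 2) * |(y 1 : ℝ)| := by
        gcongr
    _ = _ := by unfold sz; ring

/-- Lebesgue measure on the box `(-π, π]²`. -/
noncomputable def boxMeasure : Measure (ℝ × ℝ) :=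
  (volume.restrict (Set.Ioc (-Real.pi) Real.pi)).prod
    (volume.restrict (Set.Ioc (-Real.pi) Real.pi))

instance : IsFiniteMeasure boxMeasure := by unfold boxMeasure; infer_instance

lemma ae_boxMeasure : ∀ᵐ θ ∂boxMeasure, |θ.1| ≤ Real.pi ∧ |θ.2| ≤ Real.pi := by
  have h : boxMeasure = volume.restrict
      (Set.Ioc (-Real.pi) Real.pi ×ˢ Set.Ioc (-Real.pi) Real.pi) := by
    unfold boxMeasure
    rw [Measure.prod_restrict]; rfl
  rw [h, ae_restrict_iff' (measurableSet_Ioc.prod measurableSet_Ioc)]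
  refine Filter.Eventually.of_forall fun θ hθ => ?_
  exact ⟨abs_le.2 ⟨hθ.1.1.le, hθ.1.2⟩, abs_le.2 ⟨hθ.2.1.le, hθ.2.2⟩⟩

/-- The phase `t` is needed because the double integral is computed one coordinate at a time, the
other coordinate acting as a phase. -/
lemma integral_cos_int (v : ℤ) (t : ℝ) :
    ∫ a in Set.Ioc (-Real.pi) Real.pi, Real.cos (a * v + t)
      = if v = 0 then 2 * Real.pi * Real.cos t else 0 := by
  rw [← intervalIntegral.integral_of_le (by linarith [Real.pi_pos])]
  split_ifs with h
  · subst h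
    simp only [Int.cast_zero, mul_zero, zero_add, intervalIntegral.integral_const, smul_eq_mul]
    ring
  · have hv : (v : ℝ) ≠ 0 := by exact_mod_cast h
    simp_rw [mul_comm _ (v : ℝ)]
    rw [intervalIntegral.integral_comp_mul_add _ hv, integral_cos]
    have : (v : ℝ) * Real.pi + t = (v * -Real.pi + t) + v * (2 * Real.pi) := by ring
    rw [this, Real.sin_add_int_mul_two_pi]
    simp

lemma integral_box_cos_dot (v : Lattice) :
    ∫ θ, Real.cos (dot θ v) ∂boxMeasure = if v = 0 then (2 * Real.pi) ^ 2 else 0 := by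
  unfold boxMeasure
  rw [integral_prod_symm]
  · simp only [dot, integral_cos_int]
    split_ifs with h1 h2 h2
    · have h3 : v 1 = 0 := by rw [h2]; rfl
      rw [integral_const_mul]
      have := integral_cos_int (v 1) 0
      simp only [add_zero, h3, if_true, Real.cos_zero] at this
      rw [h3, this]; ring
    · rw [integral_const_mul]
      have h3 : v 1 ≠ 0 := fun h3 => h2 (by ext i; fin_cases i <;> simp [h1, h3])
      have := integral_cos_int (v 1) 0
      simp only [add_zero, h3, if_false] at this
      rw [this]; ring
    · exact absurd (by rw [h2]; rfl) h1
    · simp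
  · refine Integrable.of_bound (C := 1) ?_ (Filter.Eventually.of_forall fun θ => ?_)
    · refine Continuous.aestronglyMeasurable ?_
      unfold dot; fun_prop
    · simpa using Real.abs_cos_le_one _

lemma integral_box_exp {B : ℝ} (hB : 0 < B) :
    Integrable (fun θ : ℝ × ℝ => Real.exp (-B * (θ.1 ^ 2 + θ.2 ^ 2))) boxMeasure ∧
    ∫ θ : ℝ × ℝ, Real.exp (-B * (θ.1 ^ 2 + θ.2 ^ 2)) ∂boxMeasure ≤ Real.pi / B := by
  have e : (fun θ : ℝ × ℝ => Real.exp (-B * (θ.1 ^ 2 + θ.2 ^ 2)))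
      = fun θ => Real.exp (-B * θ.1 ^ 2) * Real.exp (-B * θ.2 ^ 2) := by
    funext θ; rw [← Real.exp_add]; ring_nf
  have hi := integrable_exp_neg_mul_sq hB
  have h1 : ∫ x in Set.Ioc (-Real.pi) Real.pi, Real.exp (-B * x ^ 2) ≤ Real.sqrt (Real.pi / B) := by
    rw [← integral_gaussian]
    exact setIntegral_le_integral hi (Filter.Eventually.of_forall fun x => (Real.exp_pos _).le)
  have h0 : 0 ≤ ∫ x in Set.Ioc (-Real.pi) Real.pi, Real.exp (-B * x ^ 2) :=
    integral_nonneg fun x => (Real.exp_pos _).le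
  rw [e]
  refine ⟨hi.integrableOn.mul_prod hi.integrableOn, ?_⟩
  unfold boxMeasure
  rw [integral_prod_mul (μ := volume.restrict (Set.Ioc (-Real.pi) Real.pi))
    (ν := volume.restrict (Set.Ioc (-Real.pi) Real.pi))
    (fun x : ℝ => Real.exp (-B * x ^ 2)) (fun x : ℝ => Real.exp (-B * x ^ 2))]
  calc _ ≤ Real.sqrt (Real.pi / B) * Real.sqrt (Real.pi / B) := mul_le_mul h1 h1 h0 (Real.sqrt_nonneg _)
    _ = _ := Real.mul_self_sqrt (by positivity)

lemma abs_integral_box_le {g : ℝ × ℝ → ℝ} {A B : ℝ} (hB : 0 < B) (hA : 0 ≤ A)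
    (h : ∀ θ : ℝ × ℝ, |θ.1| ≤ Real.pi → |θ.2| ≤ Real.pi →
      |g θ| ≤ A * Real.exp (-B * (θ.1 ^ 2 + θ.2 ^ 2))) :
    |∫ θ, g θ ∂boxMeasure| ≤ A * (Real.pi / B) := by
  obtain ⟨h1, h2⟩ := integral_box_exp hB
  calc |∫ θ, g θ ∂boxMeasure| ≤ ∫ θ : ℝ × ℝ, A * Real.exp (-B * (θ.1 ^ 2 + θ.2 ^ 2)) ∂boxMeasure := by
        rw [← Real.norm_eq_abs]
        refine norm_integral_le_of_norm_le (h1.const_mul A) ?_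
        filter_upwards [ae_boxMeasure] with θ hθ
        exact h θ hθ.1 hθ.2
    _ = A * ∫ θ : ℝ × ℝ, Real.exp (-B * (θ.1 ^ 2 + θ.2 ^ 2)) ∂boxMeasure := integral_const_mul _ _
    _ ≤ _ := by gcongr

/-- The characteristic function of a step; it is real by symmetry. -/
noncomputable def charFn (P : Measure Ω) (ξ : ℕ → Ω → Lattice) (θ : ℝ × ℝ) : ℝ :=
  ∫ ω, Real.cos (dot θ (ξ 0 ω)) ∂P

namespace IsPlanarStep

variable {P : Measure Ω} [IsProbabilityMeasure P] {ξ : ℕ → Ω → Lattice}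

lemma measurable_step (hS : IsPlanarStep P ξ) (f : Lattice → ℝ) (i : ℕ) :
    Measurable (fun ω => f (ξ i ω)) := (measurable_of_countable f).comp (hS.meas i)

lemma integral_sin_zero (hS : IsPlanarStep P ξ) (θ : ℝ × ℝ) :
    ∫ ω, Real.sin (dot θ (ξ 0 ω)) ∂P = 0 := by
  have h := (hS.symm.comp (measurable_of_countable fun y => Real.sin (dot θ y))).integral_eq
  simp only [Function.comp_def, dot_neg, Real.sin_neg, integral_neg] at h
  linarith

lemma integral_cos_add (hS : IsPlanarStep P ξ) (θ : ℝ × ℝ) (t : ℝ) :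
    ∫ ω, Real.cos (dot θ (ξ 0 ω) + t) ∂P = charFn P ξ θ * Real.cos t := by
  simp only [Real.cos_add]
  rw [integral_sub, integral_mul_const, integral_mul_const, hS.integral_sin_zero]
  · simp [charFn]
  · exact (integrable_of_bdd (hS.measurable_step (fun y => Real.cos (dot θ y)) 0) (K := 1)
      fun ω => Real.abs_cos_le_one _).mul_const _
  · exact (integrable_of_bdd (hS.measurable_step (fun y => Real.sin (dot θ y)) 0) (K := 1)
      fun ω => Real.abs_sin_le_one _).mul_const _

/-- By symmetry the sine of a step has mean zero, so the cosine transform is already multiplicative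
and no complex characteristic function is needed. -/
lemma integral_cos_walk (hS : IsPlanarStep P ξ) (θ : ℝ × ℝ) (t : ℝ) (n : ℕ) :
    ∫ ω, Real.cos (dot θ (walk ξ n ω) + t) ∂P = charFn P ξ θ ^ n * Real.cos t := by
  induction n with
  | zero => simp
  | succ n ih =>
    have h := hS.integral_step (j := n) (K := 1)
      (F := fun ω s => Real.cos (dot θ s + (dot θ (walk ξ n ω) + t)))
      ((depOn_walk ξ n).comp fun w s => Real.cos (dot θ s + (dot θ w + t)))
      (fun _ _ => Real.abs_cos_le_one _)
    simp only [hS.integral_cos_add, integral_const_mul, ih] at h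
    rw [pow_succ', mul_assoc, ← h]
    refine integral_congr_ae (Filter.Eventually.of_forall fun ω => ?_)
    simp only [walk_succ, dot_add]; ring_nf

/-- Fubini for `cos (dot θ (X_n - y))`: integrating over the box first gives the indicator of `X_n =
y` by orthogonality, integrating over `Ω` first gives the power of `charFn`. -/
lemma kern_fourier (hS : IsPlanarStep P ξ) (n : ℕ) (y : Lattice) :
    (2 * Real.pi) ^ 2 * kern P ξ n y
      = ∫ θ, charFn P ξ θ ^ n * Real.cos (dot θ y) ∂boxMeasure := by
  have hint : Integrable (Function.uncurry fun (ω : Ω) (θ : ℝ × ℝ) =>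
      Real.cos (dot θ (walk ξ n ω) + -dot θ y)) (P.prod boxMeasure) := by
    refine Integrable.of_bound (C := 1) ?_ (Filter.Eventually.of_forall fun θ => ?_)
    · have hm : ∀ a : Fin 2, Measurable fun x : Ω × (ℝ × ℝ) => ((walk ξ n x.1 a : ℤ) : ℝ) := fun a =>
        (measurable_of_countable fun y : Lattice => ((y a : ℤ) : ℝ)).comp
          ((hS.measurable_walk n).comp measurable_fst)
      have h0 := hm 0
      have h1 := hm 1
      refine Measurable.aestronglyMeasurable ?_
      simp only [Function.uncurry_def, dot]
      fun_prop
    · simpa [Function.uncurry] using Real.abs_cos_le_one _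
  have h := integral_integral_swap hint
  simp only [hS.integral_cos_walk, Real.cos_neg] at h
  rw [← h]
  have e : ∀ ω, ∫ θ, Real.cos (dot θ (walk ξ n ω) + -dot θ y) ∂boxMeasure
      = (2 * Real.pi) ^ 2 * (if walk ξ n ω = y then (1 : ℝ) else 0) := by
    intro ω
    have := integral_box_cos_dot (walk ξ n ω - y)
    simp only [dot_sub, sub_eq_zero] at this
    simp only [← sub_eq_add_neg, this]
    split_ifs <;> simp
  simp only [e]
  rw [integral_const_mul, hS.kern_eq_integral]

lemma kern_neg (hS : IsPlanarStep P ξ) (n : ℕ) (y : Lattice) : kern P ξ n (-y) = kern P ξ n y := by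
  have h1 := hS.kern_fourier n y
  have h2 := hS.kern_fourier n (-y)
  simp only [dot_neg, Real.cos_neg] at h2
  rw [← h1] at h2
  exact mul_left_cancel₀ (by positivity) h2

/-! ### Gaussian decay of the characteristic function -/

lemma continuous_charFn (hS : IsPlanarStep P ξ) : Continuous (charFn P ξ) := by
  refine continuous_of_dominated (bound := fun _ => 1)
    (fun θ => (hS.measurable_step (fun y => Real.cos (dot θ y)) 0).aestronglyMeasurable)
    (fun θ => Filter.Eventually.of_forall fun ω => Real.abs_cos_le_one _)
    (integrable_const _) (Filter.Eventually.of_forall fun ω => ?_)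
  unfold dot; fun_prop

/-- The Bochner integral of a non-integrable function is `0`, which contradicts the unit variance.
-/
lemma integrable_sq (hS : IsPlanarStep P ξ) (a : Fin 2) :
    Integrable (fun ω => (ξ 0 ω a : ℝ) ^ 2) P := by
  by_contra h
  have h1 := hS.cov a a
  simp only [if_true, ← pow_two, integral_undef h] at h1
  norm_num at h1

lemma integral_sq (hS : IsPlanarStep P ξ) (a : Fin 2) : ∫ ω, (ξ 0 ω a : ℝ) ^ 2 ∂P = 1 := by
  have h1 := hS.cov a a
  simpa only [if_true, ← pow_two] using h1

lemma memLp_step (hS : IsPlanarStep P ξ) (a : Fin 2) :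
    MemLp (fun ω => (ξ 0 ω a : ℝ)) 2 P :=
  (memLp_two_iff_integrable_sq
    (hS.measurable_step (fun y => (y a : ℝ)) 0).aestronglyMeasurable).2 (hS.integrable_sq a)

lemma integrable_mul_step (hS : IsPlanarStep P ξ) (a b : Fin 2) :
    Integrable (fun ω => (ξ 0 ω a : ℝ) * (ξ 0 ω b : ℝ)) P :=
  (hS.memLp_step a).integrable_mul (hS.memLp_step b)

lemma integrable_dot_sq (hS : IsPlanarStep P ξ) (θ : ℝ × ℝ) :
    Integrable (fun ω => dot θ (ξ 0 ω) ^ 2) P := by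
  have e : (fun ω => dot θ (ξ 0 ω) ^ 2) = fun ω => θ.1 ^ 2 * ((ξ 0 ω 0 : ℝ) * (ξ 0 ω 0 : ℝ))
      + 2 * θ.1 * θ.2 * ((ξ 0 ω 0 : ℝ) * (ξ 0 ω 1 : ℝ))
      + θ.2 ^ 2 * ((ξ 0 ω 1 : ℝ) * (ξ 0 ω 1 : ℝ)) := by funext ω; unfold dot; ring
  rw [e]
  exact (((hS.integrable_mul_step 0 0).const_mul _).add
    ((hS.integrable_mul_step 0 1).const_mul _)).add ((hS.integrable_mul_step 1 1).const_mul _)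

lemma integral_dot_sq (hS : IsPlanarStep P ξ) (θ : ℝ × ℝ) :
    ∫ ω, dot θ (ξ 0 ω) ^ 2 ∂P = θ.1 ^ 2 + θ.2 ^ 2 := by
  have e : (fun ω => dot θ (ξ 0 ω) ^ 2) = fun ω => θ.1 ^ 2 * ((ξ 0 ω 0 : ℝ) * (ξ 0 ω 0 : ℝ))
      + 2 * θ.1 * θ.2 * ((ξ 0 ω 0 : ℝ) * (ξ 0 ω 1 : ℝ))
      + θ.2 ^ 2 * ((ξ 0 ω 1 : ℝ) * (ξ 0 ω 1 : ℝ)) := by funext ω; unfold dot; ring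
  have i1 := (hS.integrable_mul_step 0 0).const_mul (θ.1 ^ 2)
  have i2 := (hS.integrable_mul_step 0 1).const_mul (2 * θ.1 * θ.2)
  have i3 := (hS.integrable_mul_step 1 1).const_mul (θ.2 ^ 2)
  have i12 : Integrable (fun ω => θ.1 ^ 2 * ((ξ 0 ω 0 : ℝ) * (ξ 0 ω 0 : ℝ))
      + 2 * θ.1 * θ.2 * ((ξ 0 ω 0 : ℝ) * (ξ 0 ω 1 : ℝ))) P := i1.add i2
  rw [e, integral_add i12 i3, integral_add i1 i2, integral_const_mul, integral_const_mul,
    integral_const_mul, hS.cov, hS.cov, hS.cov]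
  simp

lemma one_sub_charFn_le (hS : IsPlanarStep P ξ) (θ : ℝ × ℝ) :
    1 - (θ.1 ^ 2 + θ.2 ^ 2) / 2 ≤ charFn P ξ θ := by
  have h : ∫ ω, (1 - dot θ (ξ 0 ω) ^ 2 / 2) ∂P ≤ charFn P ξ θ := by
    refine integral_mono ?_ ?_ fun ω => Real.one_sub_sq_div_two_le_cos
    · exact (integrable_const _).sub ((hS.integrable_dot_sq θ).div_const 2)
    · exact integrable_of_bdd (hS.measurable_step (fun y => Real.cos (dot θ y)) 0) (K := 1)
        fun ω => Real.abs_cos_le_one _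
  rw [integral_sub (integrable_const _) ((hS.integrable_dot_sq θ).div_const 2),
    integral_div, hS.integral_dot_sq] at h
  simpa using h

/-- The squared Euclidean length of a lattice point. -/
noncomputable def _root_.RWIntersection.nsq (y : Lattice) : ℝ := (y 0 : ℝ) ^ 2 + (y 1 : ℝ) ^ 2

lemma integrable_nsq (hS : IsPlanarStep P ξ) : Integrable (fun ω => nsq (ξ 0 ω)) P :=
  (hS.integrable_sq 0).add (hS.integrable_sq 1)

lemma _root_.RWIntersection.dot_sq_le (θ : ℝ × ℝ) (y : Lattice) :
    dot θ y ^ 2 ≤ (θ.1 ^ 2 + θ.2 ^ 2) * nsq y := by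
  unfold dot nsq
  nlinarith [sq_nonneg (θ.1 * y 1 - θ.2 * y 0)]

/-- Steps of squared length at most `K` keep at least half of the variance in every direction. They
are the steps for which the quadratic upper bound of the cosine can be used near frequency zero. -/
lemma exists_truncation (hS : IsPlanarStep P ξ) :
    ∃ K : ℕ, ∫ ω, (if (K : ℝ) < nsq (ξ 0 ω) then nsq (ξ 0 ω) else 0) ∂P ≤ 1 / 2 := by
  have h : Filter.Tendsto (fun K : ℕ => ∫ ω, (if (K : ℝ) < nsq (ξ 0 ω) then nsq (ξ 0 ω) else 0) ∂P)
      Filter.atTop (nhds (∫ ω, (0 : ℝ) ∂P)) := by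
    refine tendsto_integral_of_dominated_convergence (fun ω => nsq (ξ 0 ω)) (fun K =>
      (hS.measurable_step (fun y => if (K : ℝ) < nsq y then nsq y else 0) 0).aestronglyMeasurable)
      hS.integrable_nsq (fun K => Filter.Eventually.of_forall fun ω => ?_)
      (Filter.Eventually.of_forall fun ω => ?_)
    · have : 0 ≤ nsq (ξ 0 ω) := by unfold nsq; positivity
      split_ifs
      · rw [Real.norm_of_nonneg this]
      · simpa using this
    · refine tendsto_const_nhds.congr' ?_
      filter_upwards [Filter.eventually_ge_atTop ⌈nsq (ξ 0 ω)⌉₊] with K hK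
      rw [if_neg (not_lt.2 ((Nat.le_ceil _).trans (by exact_mod_cast hK)))]
  rw [integral_zero] at h
  exact (h.eventually_le_const (by norm_num : (0:ℝ) < 1 / 2)).exists

lemma charFn_near_zero (hS : IsPlanarStep P ξ) :
    ∃ ρ : ℝ, 0 < ρ ∧ ∀ θ : ℝ × ℝ, θ.1 ^ 2 + θ.2 ^ 2 ≤ ρ →
      |charFn P ξ θ| ≤ 1 - (θ.1 ^ 2 + θ.2 ^ 2) / Real.pi ^ 2 := by
  obtain ⟨K, hK⟩ := hS.exists_truncation
  refine ⟨min 1 (1 / (K + 1)), by positivity, fun θ hθ => ?_⟩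
  have h1 : θ.1 ^ 2 + θ.2 ^ 2 ≤ 1 := hθ.trans (min_le_left _ _)
  have h2 : (θ.1 ^ 2 + θ.2 ^ 2) * (K + 1) ≤ 1 := by
    have := hθ.trans (min_le_right _ _)
    rwa [le_div_iff₀ (by positivity)] at this
  have hr : 0 ≤ θ.1 ^ 2 + θ.2 ^ 2 := by positivity
  have hpi := Real.pi_gt_three
  have hpi2 : 0 < Real.pi ^ 2 := by positivity
  rw [abs_le]
  constructor
  · have h3 := hS.one_sub_charFn_le θ
    have : (θ.1 ^ 2 + θ.2 ^ 2) / Real.pi ^ 2 ≤ 1 := by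
      rw [div_le_one hpi2]; nlinarith
    linarith
  -- On short steps this is `cos x ≤ 1 - 2 x² / π²`, valid for `|x| ≤ π`. On long steps
  -- Cauchy–Schwarz makes the right side at least `1`.
  · have hpt : ∀ ω, Real.cos (dot θ (ξ 0 ω)) ≤ 1 - 2 / Real.pi ^ 2 * (dot θ (ξ 0 ω) ^ 2
        - (θ.1 ^ 2 + θ.2 ^ 2) * (if (K : ℝ) < nsq (ξ 0 ω) then nsq (ξ 0 ω) else 0)) := by
      intro ω
      have hd := dot_sq_le θ (ξ 0 ω)
      split_ifs with h
      · have : 0 ≤ 2 / Real.pi ^ 2 * ((θ.1 ^ 2 + θ.2 ^ 2) * nsq (ξ 0 ω) - dot θ (ξ 0 ω) ^ 2) :=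
          mul_nonneg (by positivity) (by linarith)
        have hc := Real.cos_le_one (dot θ (ξ 0 ω))
        linarith
      · rw [mul_zero, sub_zero]
        refine Real.cos_le_one_sub_mul_cos_sq ?_
        rw [← Real.sqrt_sq_eq_abs]
        refine Real.sqrt_le_iff.2 ⟨Real.pi_pos.le, ?_⟩
        push Not at h
        have : (θ.1 ^ 2 + θ.2 ^ 2) * nsq (ξ 0 ω) ≤ 1 := by nlinarith
        nlinarith
    have i1 := hS.integrable_dot_sq θ
    have i2 : Integrable (fun ω => if (K : ℝ) < nsq (ξ 0 ω) then nsq (ξ 0 ω) else 0) P := by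
      refine hS.integrable_nsq.mono'
        (hS.measurable_step (fun y => if (K : ℝ) < nsq y then nsq y else 0) 0).aestronglyMeasurable
        (Filter.Eventually.of_forall fun ω => ?_)
      have : 0 ≤ nsq (ξ 0 ω) := by unfold nsq; positivity
      split_ifs
      · rw [Real.norm_of_nonneg this]
      · simpa using this
    have i3 : Integrable (fun ω => dot θ (ξ 0 ω) ^ 2
        - (θ.1 ^ 2 + θ.2 ^ 2) * (if (K : ℝ) < nsq (ξ 0 ω) then nsq (ξ 0 ω) else 0)) P :=
      i1.sub (i2.const_mul _)
    have h4 := integral_mono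
      (integrable_of_bdd (hS.measurable_step (fun y => Real.cos (dot θ y)) 0) (K := 1)
        fun ω => Real.abs_cos_le_one _)
      ((integrable_const (1 : ℝ)).sub (i3.const_mul (2 / Real.pi ^ 2))) hpt
    have h5 : ∫ ω, (1 - 2 / Real.pi ^ 2 * (dot θ (ξ 0 ω) ^ 2
        - (θ.1 ^ 2 + θ.2 ^ 2) * (if (K : ℝ) < nsq (ξ 0 ω) then nsq (ξ 0 ω) else 0))) ∂P
        = 1 - 2 / Real.pi ^ 2 * ((θ.1 ^ 2 + θ.2 ^ 2) - (θ.1 ^ 2 + θ.2 ^ 2) *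
          ∫ ω, (if (K : ℝ) < nsq (ξ 0 ω) then nsq (ξ 0 ω) else 0) ∂P) := by
      rw [integral_sub (integrable_const _) (i3.const_mul _),
        integral_const_mul, integral_sub i1 (i2.const_mul _), integral_const_mul,
        hS.integral_dot_sq]
      simp
    have h4' : charFn P ξ θ ≤ _ := h4.trans_eq h5
    refine h4'.trans ?_
    have h6 : (θ.1 ^ 2 + θ.2 ^ 2) * ∫ ω, (if (K : ℝ) < nsq (ξ 0 ω) then nsq (ξ 0 ω) else 0) ∂P
        ≤ (θ.1 ^ 2 + θ.2 ^ 2) * (1 / 2) := by gcongr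
    have h7 : 2 / Real.pi ^ 2 * ((θ.1 ^ 2 + θ.2 ^ 2) * (1 / 2)) ≤ 2 / Real.pi ^ 2 *
        ((θ.1 ^ 2 + θ.2 ^ 2) - (θ.1 ^ 2 + θ.2 ^ 2) *
          ∫ ω, (if (K : ℝ) < nsq (ξ 0 ω) then nsq (ξ 0 ω) else 0) ∂P) :=
      mul_le_mul_of_nonneg_left (by linarith) (by positivity)
    have h8 : 2 / Real.pi ^ 2 * ((θ.1 ^ 2 + θ.2 ^ 2) * (1 / 2))
        = (θ.1 ^ 2 + θ.2 ^ 2) / Real.pi ^ 2 := by ring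
    linarith

lemma abs_charFn_le_one (hS : IsPlanarStep P ξ) (θ : ℝ × ℝ) : |charFn P ξ θ| ≤ 1 := by
  have := norm_integral_le_of_norm_le_const (μ := P) (f := fun ω => Real.cos (dot θ (ξ 0 ω)))
    (C := 1) (Filter.Eventually.of_forall fun ω => Real.abs_cos_le_one _)
  simpa [charFn] using this

/-- With `e` the sign of `charFn`, the nonnegative variable `1 - e cos` has mean zero, so it
vanishes on every atom. -/
lemma cos_eq_of_abs_charFn_eq_one (hS : IsPlanarStep P ξ) {θ : ℝ × ℝ}
    (h : |charFn P ξ θ| = 1) :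
    ∃ e : ℝ, e ^ 2 = 1 ∧ ∀ s, P {ω | ξ 0 ω = s} ≠ 0 → Real.cos (dot θ s) = e := by
  obtain ⟨e, he, hφ⟩ : ∃ e : ℝ, e ^ 2 = 1 ∧ e * charFn P ξ θ = 1 := by
    rcases abs_choice (charFn P ξ θ) with h' | h'
    · exact ⟨1, by norm_num, by linarith⟩
    · exact ⟨-1, by norm_num, by linarith⟩
  refine ⟨e, he, fun s hs => ?_⟩
  have hle : ∀ x : ℝ, e * Real.cos x ≤ 1 := by
    intro x
    nlinarith [Real.cos_sq_le_one x, sq_nonneg (e - Real.cos x)]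
  have hi : Integrable (fun ω => Real.cos (dot θ (ξ 0 ω))) P :=
    integrable_of_bdd (hS.measurable_step (fun y => Real.cos (dot θ y)) 0) (K := 1)
        fun ω => Real.abs_cos_le_one _
  have h0 : ∫ ω, (1 - e * Real.cos (dot θ (ξ 0 ω))) ∂P = 0 := by
    rw [integral_sub (integrable_const _) (hi.const_mul e), integral_const_mul]
    simp only [integral_const, probReal_univ, smul_eq_mul, mul_one]
    change 1 - e * charFn P ξ θ = 0
    linarith
  have h1 := (integral_eq_zero_iff_of_nonneg (fun ω => sub_nonneg.2 (hle _))
    ((integrable_const _).sub (hi.const_mul e))).1 h0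
  by_contra hne
  refine hs (measure_mono_null ?_ (ae_iff.1 h1))
  intro ω hω h2
  simp only [Set.mem_ofPred_eq] at hω
  simp only [Pi.zero_apply, hω] at h2
  exact hne (by linear_combination (-e) * h2 - Real.cos (dot θ s) * he)

lemma exists_support (hS : IsPlanarStep P ξ) : ∃ s, P {ω | ξ 0 ω = s} ≠ 0 := by
  by_contra! h
  have h1 : P (⋃ s : Lattice, {ω | ξ 0 ω = s}) = 0 := measure_iUnion_null h
  have h2 : (⋃ s : Lattice, {ω | ξ 0 ω = s}) = Set.univ := by ext ω; simp
  rw [h2] at h1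
  simp at h1

lemma _root_.RWIntersection.eq_zero_of_cos_eq_one {x : ℝ} (h : Real.cos x = 1) (hx : |x| ≤ Real.pi) :
    x = 0 := by
  have := abs_le.1 hx
  exact (Real.cos_eq_one_iff_of_lt_of_lt (by linarith [Real.pi_pos]) (by linarith [Real.pi_pos])).1 h

/-- If the modulus were `1`, the cosine would equal the same sign on all atoms, hence `cos (dot θ (s
- s₀)) = 1` for all atoms `s`. Aperiodicity, used with the translate by `-s₀`, extends this to all
of `ℤ²`. The two unit vectors then force `θ = 0`, because the coordinates of `θ` lie in `[-π, π]`.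
-/
lemma abs_charFn_lt_one (hS : IsPlanarStep P ξ) {θ : ℝ × ℝ} (h1 : |θ.1| ≤ Real.pi)
    (h2 : |θ.2| ≤ Real.pi) (h0 : θ ≠ 0) : |charFn P ξ θ| < 1 := by
  refine lt_of_le_of_ne (hS.abs_charFn_le_one θ) fun h => h0 ?_
  obtain ⟨e, he, hcos⟩ := hS.cos_eq_of_abs_charFn_eq_one h
  obtain ⟨s₀, hs₀⟩ := hS.exists_support
  have hsin : ∀ x : ℝ, Real.cos x ^ 2 = 1 → Real.sin x = 0 := by
    intro x hx
    have := Real.sin_sq_add_cos_sq x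
    nlinarith
  have hall : ∀ y : Lattice, Real.cos (dot θ y) = 1 := by
    intro y
    have hy : y ∈ AddSubgroup.closure {y : Lattice | ∃ s, P {ω | ξ 0 ω = s} ≠ 0 ∧ y = -s₀ + s} := by
      rw [hS.aper]; trivial
    induction hy using AddSubgroup.closure_induction with
    | mem x hx =>
      obtain ⟨s, hs, rfl⟩ := hx
      have c1 := hcos s hs
      have c2 := hcos s₀ hs₀
      rw [dot_add, dot_neg, Real.cos_add, Real.cos_neg, Real.sin_neg, hsin (dot θ s) (by rw [c1, he]),
        c1, c2]
      nlinarith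
    | zero => simp
    | add x y _ _ hx hy =>
      rw [dot_add, Real.cos_add, hx, hy, hsin (dot θ x) (by rw [hx]; norm_num)]; ring
    | neg x _ hx => rw [dot_neg, Real.cos_neg, hx]
  have e1 := hall ![1, 0]
  have e2 := hall ![0, 1]
  simp only [dot, Matrix.cons_val_zero, Matrix.cons_val_one, Int.cast_one, Int.cast_zero, mul_one,
    mul_zero, add_zero, zero_add] at e1 e2
  exact Prod.ext (eq_zero_of_cos_eq_one e1 h1) (eq_zero_of_cos_eq_one e2 h2)

/-- Near zero the quadratic bound applies. On the compact rest of the box the modulus stays below `1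
- η`, and there `|θ|² ≤ 2π²` turns the gap `η` into a quadratic bound. -/
lemma exists_charFn_le (hS : IsPlanarStep P ξ) :
    ∃ c : ℝ, 0 < c ∧ ∀ θ : ℝ × ℝ, |θ.1| ≤ Real.pi → |θ.2| ≤ Real.pi →
      |charFn P ξ θ| ≤ Real.exp (-c * (θ.1 ^ 2 + θ.2 ^ 2)) := by
  obtain ⟨ρ, hρ, hnear⟩ := hS.charFn_near_zero
  have hpi : 0 < Real.pi ^ 2 := by positivity
  suffices hsuff : ∃ c : ℝ, 0 < c ∧ ∀ θ : ℝ × ℝ, |θ.1| ≤ Real.pi → |θ.2| ≤ Real.pi →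
      |charFn P ξ θ| ≤ 1 - c * (θ.1 ^ 2 + θ.2 ^ 2) by
    obtain ⟨c, hc, h⟩ := hsuff
    refine ⟨c, hc, fun θ h1 h2 => (h θ h1 h2).trans ?_⟩
    have := Real.add_one_le_exp (-c * (θ.1 ^ 2 + θ.2 ^ 2))
    linarith
  set S : Set (ℝ × ℝ) := (Set.Icc (-Real.pi) Real.pi ×ˢ Set.Icc (-Real.pi) Real.pi) ∩
    {θ | ρ ≤ θ.1 ^ 2 + θ.2 ^ 2} with hSdef
  have hcomp : IsCompact S := (isCompact_Icc.prod isCompact_Icc).inter_right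
    (isClosed_le continuous_const (by fun_prop))
  have hfar : ∃ η : ℝ, 0 < η ∧ ∀ θ ∈ S, |charFn P ξ θ| ≤ 1 - η := by
    rcases S.eq_empty_or_nonempty with h | h
    · exact ⟨1, one_pos, by simp [h]⟩
    · obtain ⟨θ₀, hθ₀, hmax⟩ := hcomp.exists_isMaxOn h (hS.continuous_charFn.abs).continuousOn
      refine ⟨1 - |charFn P ξ θ₀|, ?_, fun θ hθ => ?_⟩
      · have : θ₀ ≠ 0 := by
          rintro rfl
          have := hθ₀.2
          simp at this; linarith
        have := hS.abs_charFn_lt_one (abs_le.2 hθ₀.1.1) (abs_le.2 hθ₀.1.2) this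
        linarith
      · have := hmax hθ
        simp only [Set.mem_ofPred_eq] at this
        linarith
  obtain ⟨η, hη, hfar⟩ := hfar
  refine ⟨min (1 / Real.pi ^ 2) (η / (2 * Real.pi ^ 2)), by positivity, fun θ h1 h2 => ?_⟩
  have hr : 0 ≤ θ.1 ^ 2 + θ.2 ^ 2 := by positivity
  by_cases h : θ.1 ^ 2 + θ.2 ^ 2 ≤ ρ
  · refine (hnear θ h).trans ?_
    have : min (1 / Real.pi ^ 2) (η / (2 * Real.pi ^ 2)) * (θ.1 ^ 2 + θ.2 ^ 2)
        ≤ 1 / Real.pi ^ 2 * (θ.1 ^ 2 + θ.2 ^ 2) := by gcongr; exact min_le_left _ _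
    have e : 1 / Real.pi ^ 2 * (θ.1 ^ 2 + θ.2 ^ 2) = (θ.1 ^ 2 + θ.2 ^ 2) / Real.pi ^ 2 := by ring
    linarith
  · push Not at h
    refine (hfar θ ⟨⟨abs_le.1 h1, abs_le.1 h2⟩, h.le⟩).trans ?_
    have h3 : θ.1 ^ 2 ≤ Real.pi ^ 2 := sq_le_sq' (abs_le.1 h1).1 (abs_le.1 h1).2
    have h4 : θ.2 ^ 2 ≤ Real.pi ^ 2 := sq_le_sq' (abs_le.1 h2).1 (abs_le.1 h2).2
    have : min (1 / Real.pi ^ 2) (η / (2 * Real.pi ^ 2)) * (θ.1 ^ 2 + θ.2 ^ 2)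
        ≤ η / (2 * Real.pi ^ 2) * (2 * Real.pi ^ 2) := by
      gcongr
      · exact min_le_right _ _
      · linarith
    rw [div_mul_cancel₀ _ (by positivity)] at this
    linarith

end IsPlanarStep

/-! ### Heat kernel bounds -/

lemma mul_exp_neg_le (x : ℝ) : x * Real.exp (-2 * x) ≤ Real.exp (-x) := by
  have h1 : x ≤ Real.exp x := by linarith [Real.add_one_le_exp x]
  have e : Real.exp (-x) = Real.exp x * Real.exp (-2 * x) := by rw [← Real.exp_add]; ring_nf
  rw [e]
  gcongr

/-- Half of a Gaussian exponent absorbs a factor `|θ|`; `mul_exp_neg_le` does the same for `|θ|²`.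
-/
lemma sqrt_mul_exp_neg_le {x : ℝ} (hx : 0 ≤ x) : Real.sqrt x * Real.exp (-2 * x) ≤ Real.exp (-x) := by
  have h1 : Real.sqrt x ≤ Real.exp x := by
    have h2 := Real.add_one_le_exp x
    have h3 : Real.sqrt x ≤ x + 1 := by
      rw [Real.sqrt_le_left (by linarith)]; nlinarith
    linarith
  have e : Real.exp (-x) = Real.exp x * Real.exp (-2 * x) := by rw [← Real.exp_add]; ring_nf
  rw [e]
  gcongr

lemma abs_cos_sub_cos_le (x y : ℝ) : |Real.cos x - Real.cos y| ≤ |x - y| := by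
  rw [Real.cos_sub_cos, abs_mul, abs_mul]
  have h1 := Real.abs_sin_le_one ((x + y) / 2)
  have h2 : |Real.sin ((x - y) / 2)| ≤ |(x - y) / 2| := Real.abs_sin_le_abs
  have h3 : |(x - y) / 2| = |x - y| / 2 := by rw [abs_div]; norm_num
  have h4 : |(-2 : ℝ)| = 2 := by norm_num
  rw [h4]
  nlinarith [abs_nonneg (Real.sin ((x + y) / 2)), abs_nonneg (Real.sin ((x - y) / 2))]

namespace IsPlanarStep

variable {P : Measure Ω} [IsProbabilityMeasure P] {ξ : ℕ → Ω → Lattice}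

lemma charFn_pow_le {c : ℝ} (hc : ∀ θ : ℝ × ℝ, |θ.1| ≤ Real.pi → |θ.2| ≤ Real.pi →
      |charFn P ξ θ| ≤ Real.exp (-c * (θ.1 ^ 2 + θ.2 ^ 2))) (n : ℕ) {θ : ℝ × ℝ}
    (h1 : |θ.1| ≤ Real.pi) (h2 : |θ.2| ≤ Real.pi) :
    |charFn P ξ θ ^ n| ≤ Real.exp (-(c * n) * (θ.1 ^ 2 + θ.2 ^ 2)) := by
  rw [abs_pow]
  calc _ ≤ Real.exp (-c * (θ.1 ^ 2 + θ.2 ^ 2)) ^ n := by gcongr; exact hc θ h1 h2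
    _ = _ := by rw [← Real.exp_nat_mul]; ring_nf

lemma integrable_charFn_cos (hS : IsPlanarStep P ξ) (n : ℕ) (y : Lattice) :
    Integrable (fun θ => charFn P ξ θ ^ n * Real.cos (dot θ y)) boxMeasure := by
  refine Integrable.of_bound (C := 1) ?_ (Filter.Eventually.of_forall fun θ => ?_)
  · refine Continuous.aestronglyMeasurable ?_
    have := hS.continuous_charFn
    unfold dot; fun_prop
  · rw [norm_mul, norm_pow]
    exact mul_le_one₀ (pow_le_one₀ (norm_nonneg _) (hS.abs_charFn_le_one θ)) (norm_nonneg _)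
      (Real.abs_cos_le_one _)

/-- Heat kernel bounds: the kernel, its first differences, and its second difference at `0`. -/
lemma exists_kern_bounds (hS : IsPlanarStep P ξ) :
    ∃ C : ℝ, 1 ≤ C ∧ ∀ m : ℕ, 1 ≤ m → (∀ y, kern P ξ m y ≤ C / m) ∧
      (∀ y s, |kern P ξ m (y + s) - kern P ξ m y| ≤ C * sz s / (m * Real.sqrt m)) ∧
      (∀ s, kern P ξ (m + m) 0 - kern P ξ (m + m) s ≤ C * sz s ^ 2 / (m : ℝ) ^ 2) := by
  obtain ⟨c, hc, hφ⟩ := hS.exists_charFn_le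
  have hpi : 0 < Real.pi := Real.pi_pos
  set C₁ := Real.pi / c
  set C₂ := Real.sqrt (2 / c) * (2 * Real.pi / c)
  set C₃ := 1 / (2 * c) * (Real.pi / c)
  have hC₁ : 0 < C₁ := by positivity
  have hC₂ : 0 < C₂ := by positivity
  have hC₃ : 0 < C₃ := by positivity
  have hpi1 : 1 ≤ (2 * Real.pi) ^ 2 := by nlinarith [Real.pi_gt_three]
  refine ⟨1 + C₁ + C₂ + C₃, by linarith, fun m hm => ?_⟩
  have hm' : (0 : ℝ) < m := by exact_mod_cast hm
  -- The factor `(2π)²` of the inversion formula is at least `1` and is dropped.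
  have hscale : ∀ {x b : ℝ}, |(2 * Real.pi) ^ 2 * x| ≤ b → |x| ≤ b := by
    intro x b h
    rw [abs_mul, abs_of_pos (by positivity)] at h
    nlinarith [abs_nonneg x]
  refine ⟨fun y => ?_, fun y s => ?_, fun s => ?_⟩
  · have h1 : |(2 * Real.pi) ^ 2 * kern P ξ m y| ≤ 1 * (Real.pi / (c * m)) := by
      rw [hS.kern_fourier]
      refine abs_integral_box_le (by positivity) zero_le_one fun θ h1 h2 => ?_
      rw [abs_mul, one_mul]
      calc _ ≤ |charFn P ξ θ ^ m| * 1 := by gcongr; exact Real.abs_cos_le_one _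
        _ ≤ _ := by rw [mul_one]; exact charFn_pow_le hφ m h1 h2
    refine (le_abs_self _).trans ((hscale h1).trans ?_)
    rw [one_mul, show Real.pi / (c * m) = C₁ / m by simp only [C₁]; field_simp]
    gcongr; linarith
  · have h1 : |(2 * Real.pi) ^ 2 * (kern P ξ m (y + s) - kern P ξ m y)|
        ≤ (Real.sqrt (2 / (c * m)) * sz s) * (Real.pi / (c * m / 2)) := by
      rw [mul_sub, hS.kern_fourier, hS.kern_fourier,
        ← integral_sub (hS.integrable_charFn_cos _ _) (hS.integrable_charFn_cos _ _)]
      refine abs_integral_box_le (by positivity) (mul_nonneg (Real.sqrt_nonneg _) (sz_nonneg s)) fun θ h1 h2 => ?_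
      set r2 := θ.1 ^ 2 + θ.2 ^ 2 with hr2
      have hr : 0 ≤ r2 := by positivity
      have a1 : |Real.cos (dot θ (y + s)) - Real.cos (dot θ y)| ≤ Real.sqrt r2 * sz s := by
        refine (abs_cos_sub_cos_le _ _).trans ?_
        rw [dot_add, add_sub_cancel_left]
        exact abs_dot_le θ s
      have a2 := charFn_pow_le hφ m h1 h2
      have a3 := sqrt_mul_exp_neg_le (x := c * m / 2 * r2) (by positivity)
      have a4 : Real.sqrt r2 = Real.sqrt (2 / (c * m)) * Real.sqrt (c * m / 2 * r2) := by
        rw [← Real.sqrt_mul (by positivity)]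
        congr 1; field_simp
      rw [← mul_sub, abs_mul]
      calc _ ≤ Real.exp (-(c * m) * r2) * (Real.sqrt r2 * sz s) := by
              gcongr
        _ = Real.sqrt (2 / (c * m)) * sz s *
            (Real.sqrt (c * m / 2 * r2) * Real.exp (-2 * (c * m / 2 * r2))) := by
              rw [a4, show -2 * (c * m / 2 * r2) = -(c * m) * r2 by ring]; ring
        _ ≤ Real.sqrt (2 / (c * m)) * sz s * Real.exp (-(c * m / 2 * r2)) :=
              mul_le_mul_of_nonneg_left a3 (mul_nonneg (Real.sqrt_nonneg _) (sz_nonneg s))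
        _ = _ := by ring_nf
    refine (hscale h1).trans ?_
    have e : Real.sqrt (2 / (c * m)) * sz s * (Real.pi / (c * m / 2))
        = C₂ * sz s / (m * Real.sqrt m) := by
      simp only [C₂]
      rw [show 2 / (c * m) = (2 / c) / m by field_simp, Real.sqrt_div (by positivity)]
      field_simp
    rw [e]
    have := sz_nonneg s
    gcongr; linarith
  · have h1 : |(2 * Real.pi) ^ 2 * (kern P ξ (m + m) 0 - kern P ξ (m + m) s)|
        ≤ (sz s ^ 2 * (1 / (2 * (c * m)))) * (Real.pi / (c * m)) := by
      rw [mul_sub, hS.kern_fourier, hS.kern_fourier,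
        ← integral_sub (hS.integrable_charFn_cos _ _) (hS.integrable_charFn_cos _ _)]
      refine abs_integral_box_le (by positivity) (by positivity) fun θ h1 h2 => ?_
      set r2 := θ.1 ^ 2 + θ.2 ^ 2 with hr2
      have hr : 0 ≤ r2 := by positivity
      have a1 : |1 - Real.cos (dot θ s)| ≤ r2 * sz s ^ 2 / 2 := by
        rw [abs_of_nonneg (by linarith [Real.cos_le_one (dot θ s)])]
        have := Real.one_sub_sq_div_two_le_cos (x := dot θ s)
        have h3 : dot θ s ^ 2 ≤ r2 * sz s ^ 2 := by
          have := abs_dot_le θ s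
          rw [← sq_abs]
          calc _ ≤ (Real.sqrt r2 * sz s) ^ 2 := by gcongr
            _ = _ := by rw [mul_pow, Real.sq_sqrt hr]
        linarith
      -- Time `m + m` gives the exponent `-2cm|θ|²`; one half of it absorbs the factor `|θ|²` from
      -- `1 - cos`, which gains `1/m`.
      have a2 := charFn_pow_le hφ (m + m) h1 h2
      have a3 := mul_exp_neg_le (c * m * r2)
      rw [← mul_sub, abs_mul, dot_zero, Real.cos_zero]
      calc _ ≤ Real.exp (-(c * (m + m : ℕ)) * r2) * (r2 * sz s ^ 2 / 2) := by
              gcongr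
        _ = sz s ^ 2 * (1 / (2 * (c * m))) * (c * m * r2 * Real.exp (-2 * (c * m * r2))) := by
              rw [show -2 * (c * m * r2) = -(c * (m + m : ℕ)) * r2 by push_cast; ring]
              field_simp
        _ ≤ sz s ^ 2 * (1 / (2 * (c * m))) * Real.exp (-(c * m * r2)) :=
              mul_le_mul_of_nonneg_left a3 (by positivity)
        _ = _ := by ring_nf
    refine (le_abs_self _).trans ((hscale h1).trans ?_)
    have e : sz s ^ 2 * (1 / (2 * (c * m))) * (Real.pi / (c * m)) = C₃ * sz s ^ 2 / (m : ℝ) ^ 2 := by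
      simp only [C₃]; field_simp
    rw [e]
    gcongr; linarith

end IsPlanarStep

/-! ### Total variation of a translated kernel -/

/-- The `ℓ¹`-norm of `f` is at most `A`. -/
def L1Le (f : Lattice → ℝ) (A : ℝ) : Prop := ∀ F : Finset Lattice, ∑ y ∈ F, |f y| ≤ A

lemma L1Le.nonneg {f : Lattice → ℝ} {A : ℝ} (h : L1Le f A) : 0 ≤ A := by simpa using h ∅

lemma L1Le.mono {f g : Lattice → ℝ} {A B : ℝ} (h : L1Le f A) (hfg : ∀ y, |g y| ≤ |f y|)
    (hAB : A ≤ B) : L1Le g B :=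
  fun F => (Finset.sum_le_sum fun y _ => hfg y).trans ((h F).trans hAB)

lemma L1Le.add {f g : Lattice → ℝ} {A B : ℝ} (h : L1Le f A) (h' : L1Le g B) :
    L1Le (fun y => f y + g y) (A + B) := fun F => by
  calc _ ≤ ∑ y ∈ F, (|f y| + |g y|) := Finset.sum_le_sum fun y _ => abs_add_le _ _
    _ ≤ _ := by rw [Finset.sum_add_distrib]; exact add_le_add (h F) (h' F)

lemma L1Le.sum {ι : Type*} (s : Finset ι) {f : ι → Lattice → ℝ} {A : ι → ℝ}
    (h : ∀ i ∈ s, L1Le (f i) (A i)) : L1Le (fun y => ∑ i ∈ s, f i y) (∑ i ∈ s, A i) := fun F => by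
  calc _ ≤ ∑ y ∈ F, ∑ i ∈ s, |f i y| := Finset.sum_le_sum fun y _ => Finset.abs_sum_le_sum_abs _ _
    _ = ∑ i ∈ s, ∑ y ∈ F, |f i y| := Finset.sum_comm
    _ ≤ _ := Finset.sum_le_sum fun i hi => h i hi F

lemma sum_shift_le {f : Lattice → ℝ} {A : ℝ} (h : ∀ F : Finset Lattice, ∑ y ∈ F, f y ≤ A)
    (e : Lattice ≃ Lattice) (F : Finset Lattice) : ∑ y ∈ F, f (e y) ≤ A := by
  have := h (F.map e.toEmbedding)
  rwa [Finset.sum_map] at this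

lemma L1Le.comp_equiv {f : Lattice → ℝ} {A : ℝ} (h : L1Le f A) (e : Lattice ≃ Lattice) :
    L1Le (fun y => f (e y)) A :=
  sum_shift_le (f := fun y => |f y|) h e

lemma one_le_sz {s : Lattice} (hs : s ≠ 0) : 1 ≤ sz s := by
  have h : s 0 ≠ 0 ∨ s 1 ≠ 0 := by
    by_contra! h
    exact hs (by ext i; fin_cases i <;> simp [h.1, h.2])
  unfold sz
  rcases h with h | h
  · have : (1 : ℝ) ≤ |(s 0 : ℝ)| := by exact_mod_cast Int.one_le_abs h
    linarith [abs_nonneg (s 1 : ℝ)]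
  · have : (1 : ℝ) ≤ |(s 1 : ℝ)| := by exact_mod_cast Int.one_le_abs h
    linarith [abs_nonneg (s 0 : ℝ)]

lemma abs_apply_le_sz (s : Lattice) (a : Fin 2) : |(s a : ℝ)| ≤ sz s := by
  unfold sz
  fin_cases a
  · simp
  · simp

lemma sum_Icc_inv_le (R : ℕ) :
    ∑ k ∈ Finset.Icc (-(R : ℤ)) R, (1 : ℝ) / (1 + |(k : ℝ)|) ≤ 2 * (1 + Real.log (R + 1)) := by
  classical
  have hsub : Finset.Icc (-(R : ℤ)) R ⊆ (Finset.range (R + 1)).image (fun j : ℕ => (j : ℤ)) ∪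
      (Finset.range (R + 1)).image (fun j : ℕ => -(j : ℤ)) := by
    intro k hk
    rw [Finset.mem_Icc] at hk
    simp only [Finset.mem_union, Finset.mem_image, Finset.mem_range]
    rcases le_total 0 k with h | h
    · exact Or.inl ⟨k.toNat, by omega, by omega⟩
    · exact Or.inr ⟨(-k).toNat, by omega, by omega⟩
  have hh : ∑ j ∈ Finset.range (R + 1), (1 : ℝ) / (1 + j) ≤ 1 + Real.log (R + 1) := by
    have := harmonic_le_one_add_log (R + 1)
    simp only [harmonic, Rat.cast_sum, Rat.cast_inv, Rat.cast_natCast] at this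
    push_cast at this
    calc _ = ∑ j ∈ Finset.range (R + 1), ((j : ℝ) + 1)⁻¹ :=
          Finset.sum_congr rfl fun j _ => by rw [one_div, add_comm]
      _ ≤ _ := this
  have hnn : ∀ k : ℤ, 0 ≤ (1 : ℝ) / (1 + |(k : ℝ)|) := fun k => by positivity
  refine (Finset.sum_le_sum_of_subset_of_nonneg hsub fun k _ _ => hnn k).trans ?_
  have h1 := Finset.sum_union_inter (s₁ := (Finset.range (R + 1)).image (fun j : ℕ => (j : ℤ)))
    (s₂ := (Finset.range (R + 1)).image (fun j : ℕ => -(j : ℤ)))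
    (f := fun k : ℤ => (1 : ℝ) / (1 + |(k : ℝ)|))
  have h2 : 0 ≤ ∑ k ∈ (Finset.range (R + 1)).image (fun j : ℕ => (j : ℤ)) ∩
      (Finset.range (R + 1)).image (fun j : ℕ => -(j : ℤ)), (1 : ℝ) / (1 + |(k : ℝ)|) :=
    Finset.sum_nonneg fun k _ => hnn k
  rw [Finset.sum_image (by intro a _ b _ h; simpa using h),
    Finset.sum_image (by intro a _ b _ h; simpa using h)] at h1
  have e1 : ∀ j : ℕ, (1 : ℝ) / (1 + |((-(j : ℤ) : ℤ) : ℝ)|) = 1 / (1 + j) := by intro j; simp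
  have e2 : ∀ j : ℕ, (1 : ℝ) / (1 + |(((j : ℤ) : ℤ) : ℝ)|) = 1 / (1 + j) := by intro j; simp
  simp only [e1, e2] at h1
  linarith

/-- Since `m ≥ 1`, the summand is at most `2 / ((1 + |y₀|)(1 + |y₁|))`, and the sum over a square
factors into two harmonic sums. -/
lemma sum_box_inv_le (R : ℕ) {m : ℝ} (hm : 1 ≤ m) (F : Finset Lattice)
    (hF : ∀ y ∈ F, ∀ a, |(y a : ℝ)| ≤ R) :
    ∑ y ∈ F, 1 / (m + nsq y) ≤ 2 * (2 * (1 + Real.log (R + 1))) ^ 2 := by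
  classical
  have hsub : F ⊆ Fintype.piFinset (fun _ : Fin 2 => Finset.Icc (-(R : ℤ)) R) := by
    intro y hy
    rw [Fintype.mem_piFinset]
    intro a
    have := hF y hy a
    rw [← Int.cast_abs] at this
    have : |y a| ≤ (R : ℤ) := by exact_mod_cast this
    exact Finset.mem_Icc.2 (abs_le.1 this)
  have hpt : ∀ y : Lattice, 1 / (m + nsq y) ≤ 2 * ∏ a : Fin 2, (1 : ℝ) / (1 + |(y a : ℝ)|) := by
    intro y
    rw [Fin.prod_univ_two]
    have h0 := sq_abs (y 0 : ℝ)
    have h1 := sq_abs (y 1 : ℝ)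
    have e : (2 : ℝ) * (1 / (1 + |(y 0 : ℝ)|) * (1 / (1 + |(y 1 : ℝ)|)))
        = 2 / ((1 + |(y 0 : ℝ)|) * (1 + |(y 1 : ℝ)|)) := by field_simp
    rw [e, div_le_div_iff₀ (by unfold nsq; positivity) (by positivity)]
    unfold nsq
    nlinarith [sq_nonneg (|(y 0 : ℝ)| - |(y 1 : ℝ)|), sq_nonneg (|(y 0 : ℝ)| - 1),
      sq_nonneg (|(y 1 : ℝ)| - 1)]
  calc ∑ y ∈ F, 1 / (m + nsq y) ≤ ∑ y ∈ F, 2 * ∏ a : Fin 2, (1 : ℝ) / (1 + |(y a : ℝ)|) :=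
        Finset.sum_le_sum fun y _ => hpt y
    _ ≤ ∑ y ∈ Fintype.piFinset (fun _ : Fin 2 => Finset.Icc (-(R : ℤ)) R),
          2 * ∏ a : Fin 2, (1 : ℝ) / (1 + |(y a : ℝ)|) :=
        Finset.sum_le_sum_of_subset_of_nonneg hsub fun y _ _ => by positivity
    _ = 2 * (∑ k ∈ Finset.Icc (-(R : ℤ)) R, (1 : ℝ) / (1 + |(k : ℝ)|)) ^ 2 := by
        rw [← Finset.mul_sum, ← Finset.prod_univ_sum (fun _ : Fin 2 => Finset.Icc (-(R : ℤ)) R)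
          (fun _ k => (1 : ℝ) / (1 + |(k : ℝ)|)), Fin.prod_univ_two, pow_two]
    _ ≤ _ := by
        gcongr
        exact sum_Icc_inv_le R

/-- Cauchy–Schwarz for the weight `w`, obtained from `∑ w (x - t)² ≥ 0` with `t = S / A`. -/
lemma sq_tsum_mul_le {w x : Lattice → ℝ} {A B : ℝ} (hw : ∀ u, 0 ≤ w u) (hws : Summable w)
    (hA : ∑' u, w u ≤ A) (hA0 : 0 < A) (hx : ∀ u, |x u| ≤ B) :
    (∑' u, w u * x u) ^ 2 ≤ A * ∑' u, w u * x u ^ 2 := by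
  have hB : 0 ≤ B := (abs_nonneg _).trans (hx 0)
  have s1 : Summable fun u => w u * x u := by
    refine Summable.of_norm_bounded (hws.mul_right B) fun u => ?_
    rw [Real.norm_eq_abs, abs_mul, abs_of_nonneg (hw u)]
    exact mul_le_mul_of_nonneg_left (hx u) (hw u)
  have s2 : Summable fun u => w u * x u ^ 2 := by
    refine Summable.of_norm_bounded (hws.mul_right (B ^ 2)) fun u => ?_
    rw [Real.norm_eq_abs, abs_mul, abs_of_nonneg (hw u), abs_of_nonneg (sq_nonneg _), ← sq_abs]
    exact mul_le_mul_of_nonneg_left (by gcongr; exact hx u) (hw u)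
  set S := ∑' u, w u * x u
  set T := ∑' u, w u * x u ^ 2
  set t := S / A
  have h : 0 ≤ T - 2 * t * S + t ^ 2 * ∑' u, w u := by
    have h1 : HasSum (fun u => w u * x u ^ 2 - 2 * t * (w u * x u) + t ^ 2 * w u)
        (T - 2 * t * S + t ^ 2 * ∑' u, w u) :=
      ((s2.hasSum.sub (s1.hasSum.mul_left (2 * t)))).add (hws.hasSum.mul_left (t ^ 2))
    refine h1.nonneg fun u => ?_
    have : w u * x u ^ 2 - 2 * t * (w u * x u) + t ^ 2 * w u = w u * (x u - t) ^ 2 := by ring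
    rw [this]
    exact mul_nonneg (hw u) (sq_nonneg _)
  have h2 : t ^ 2 * ∑' u, w u ≤ t ^ 2 * A := by gcongr
  have h3 : t * A = S := div_mul_cancel₀ _ hA0.ne'
  have h4 : t ^ 2 * A = t * S := by rw [pow_two, mul_assoc, h3]
  have h5 : t * S ≤ T := by linarith
  calc S ^ 2 = A * (t * S) := by rw [← h3]; ring
    _ ≤ A * T := by gcongr

namespace IsPlanarStep

variable {P : Measure Ω} [IsProbabilityMeasure P] {ξ : ℕ → Ω → Lattice}

lemma integral_step_coord (hS : IsPlanarStep P ξ) (i : ℕ) (a : Fin 2) :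
    ∫ ω, (ξ i ω a : ℝ) ∂P = 0 := by
  have h1 := ((hS.ident i).comp (measurable_of_countable fun y : Lattice => (y a : ℝ))).integral_eq
  have h := (hS.symm.comp (measurable_of_countable fun y : Lattice => (y a : ℝ))).integral_eq
  simp only [Function.comp_def, Pi.neg_apply, Int.cast_neg, integral_neg] at h h1
  linarith

lemma memLp_walk (hS : IsPlanarStep P ξ) (a : Fin 2) (n : ℕ) :
    MemLp (fun ω => (walk ξ n ω a : ℝ)) 2 P := by
  induction n with
  | zero => simp
  | succ n ih =>
    have h1 : MemLp (fun ω => (ξ n ω a : ℝ)) 2 P :=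
      (((hS.ident n).comp (measurable_of_countable fun y : Lattice => (y a : ℝ))).memLp_iff).2
        (hS.memLp_step a)
    convert ih.add h1 using 1
    ext ω; simp [walk_succ]

lemma integrable_walk_sq (hS : IsPlanarStep P ξ) (a : Fin 2) (n : ℕ) :
    Integrable (fun ω => (walk ξ n ω a : ℝ) ^ 2) P := (hS.memLp_walk a n).integrable_sq

lemma integral_walk_sq (hS : IsPlanarStep P ξ) (a : Fin 2) (n : ℕ) :
    ∫ ω, (walk ξ n ω a : ℝ) ^ 2 ∂P = n := by
  induction n with
  | zero => simp
  | succ n ih =>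
    have h1 : MemLp (fun ω => (ξ n ω a : ℝ)) 2 P :=
      (((hS.ident n).comp (measurable_of_countable fun y : Lattice => (y a : ℝ))).memLp_iff).2
        (hS.memLp_step a)
    have h2 := ((hS.ident n).comp
      (measurable_of_countable fun y : Lattice => (y a : ℝ) ^ 2)).integral_eq
    simp only [Function.comp_def, hS.integral_sq] at h2
    have h3 := hS.integral_mul_depOn (A := Finset.range n) (B := {n}) (by simp)
      (F := fun ω => (walk ξ n ω a : ℝ)) (H := fun ω => (ξ n ω a : ℝ))
      ((depOn_walk ξ n).comp fun w => (w a : ℝ))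
      (fun ω ω' h => by simp only [h n (by simp)])
    rw [hS.integral_step_coord, mul_zero] at h3
    have i1 := hS.integrable_walk_sq a n
    have i2 : Integrable (fun ω => (walk ξ n ω a : ℝ) * (ξ n ω a : ℝ)) P :=
      (hS.memLp_walk a n).integrable_mul h1
    have i3 : Integrable (fun ω => (ξ n ω a : ℝ) ^ 2) P := h1.integrable_sq
    have e : (fun ω => (walk ξ (n + 1) ω a : ℝ) ^ 2) = fun ω => (walk ξ n ω a : ℝ) ^ 2 +
        2 * ((walk ξ n ω a : ℝ) * (ξ n ω a : ℝ)) + (ξ n ω a : ℝ) ^ 2 := by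
      funext ω; simp only [walk_succ, Pi.add_apply, Int.cast_add]; ring
    have i12 : Integrable (fun ω => (walk ξ n ω a : ℝ) ^ 2 +
        2 * ((walk ξ n ω a : ℝ) * (ξ n ω a : ℝ))) P := i1.add (i2.const_mul 2)
    rw [e, integral_add i12 i3, integral_add i1 (i2.const_mul 2), integral_const_mul, h3, h2, ih]
    push_cast; ring

lemma integrable_walk_abs (hS : IsPlanarStep P ξ) (a : Fin 2) (n : ℕ) :
    Integrable (fun ω => |(walk ξ n ω a : ℝ)|) P :=
  ((hS.memLp_walk a n).integrable one_le_two).abs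

lemma integral_walk_abs_le (hS : IsPlanarStep P ξ) (a : Fin 2) (n : ℕ) :
    ∫ ω, |(walk ξ n ω a : ℝ)| ∂P ≤ Real.sqrt n := by
  rcases Nat.eq_zero_or_pos n with rfl | hn
  · simp
  have hn' : (0 : ℝ) < n := by exact_mod_cast hn
  have hs : 0 < Real.sqrt n := Real.sqrt_pos.2 hn'
  have h : ∫ ω, |(walk ξ n ω a : ℝ)| ∂P
      ≤ ∫ ω, ((walk ξ n ω a : ℝ) ^ 2 / (2 * Real.sqrt n) + Real.sqrt n / 2) ∂P := by
    refine integral_mono (hS.integrable_walk_abs a n)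
      (((hS.integrable_walk_sq a n).div_const _).add (integrable_const _)) fun ω => ?_
    have : (walk ξ n ω a : ℝ) ^ 2 / (2 * Real.sqrt n) + Real.sqrt n / 2 - |(walk ξ n ω a : ℝ)|
        = (|(walk ξ n ω a : ℝ)| - Real.sqrt n) ^ 2 / (2 * Real.sqrt n) := by
      rw [← sq_abs (walk ξ n ω a : ℝ)]
      field_simp; ring
    have h2 : 0 ≤ (|(walk ξ n ω a : ℝ)| - Real.sqrt n) ^ 2 / (2 * Real.sqrt n) := by positivity
    simp only
    linarith
  rw [integral_add ((hS.integrable_walk_sq a n).div_const _) (integrable_const _), integral_div,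
    hS.integral_walk_sq] at h
  simp only [integral_const, probReal_univ, smul_eq_mul, one_mul] at h
  have e : (n : ℝ) / (2 * Real.sqrt n) = Real.sqrt n / 2 := by
    rw [div_eq_div_iff (by positivity) (by norm_num)]
    nlinarith [Real.mul_self_sqrt hn'.le]
  linarith

lemma kern_l1 (hS : IsPlanarStep P ξ) (n : ℕ) : L1Le (kern P ξ n) 1 := by
  intro F
  simp only [abs_of_nonneg (kern_nonneg (P := P) (ξ := ξ) n _)]
  exact sum_le_hasSum F (fun y _ => kern_nonneg n y) (hS.hasSum_kern_one n)

lemma kern_chebyshev (hS : IsPlanarStep P ξ) (n : ℕ) (a : Fin 2) {R : ℝ} (hR : 0 < R)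
    (F : Finset Lattice) (hF : ∀ y ∈ F, R ≤ |(y a : ℝ)|) : ∑ y ∈ F, kern P ξ n y ≤ n / R ^ 2 := by
  have h := hS.hasSum_kern n (fun y => (y a : ℝ) ^ 2) (hS.integrable_walk_sq a n)
  rw [hS.integral_walk_sq] at h
  have h1 := sum_le_hasSum F (fun y _ => mul_nonneg (kern_nonneg n y) (sq_nonneg _)) h
  rw [le_div_iff₀ (by positivity), Finset.sum_mul]
  refine (Finset.sum_le_sum fun y hy => ?_).trans h1
  refine mul_le_mul_of_nonneg_left ?_ (kern_nonneg n y)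
  rw [← sq_abs (y a : ℝ)]
  have := hF y hy
  gcongr

/-- By symmetry and Chapman–Kolmogorov, `∑ p_m(y) p_m(y + s) = p_{2m}(s)`. The full `ℓ²` norm of the
difference is thus an on-diagonal second difference, which Fourier inversion controls. -/
lemma kern_diff_sq (hS : IsPlanarStep P ξ) (m : ℕ) (s : Lattice) (F : Finset Lattice) :
    ∑ y ∈ F, (kern P ξ m (y + s) - kern P ξ m y) ^ 2
      ≤ 2 * (kern P ξ (m + m) 0 - kern P ξ (m + m) s) := by
  have h0 : HasSum (fun u => kern P ξ m u ^ 2) (kern P ξ (m + m) 0) := by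
    have := hS.kern_add m m 0
    simpa only [zero_sub, hS.kern_neg, ← pow_two] using this
  have h1 : HasSum (fun u => kern P ξ m (u + s) ^ 2) (kern P ξ (m + m) 0) :=
    (Equiv.addRight s).hasSum_iff (f := fun u => kern P ξ m u ^ 2) |>.2 h0
  have h2 : HasSum (fun u => kern P ξ m u * kern P ξ m (u + s)) (kern P ξ (m + m) s) := by
    have := hS.kern_add m m (-s)
    rw [hS.kern_neg (m + m) s] at this
    have e : ∀ u, kern P ξ m (-s - u) = kern P ξ m (u + s) := fun u => by
      rw [← hS.kern_neg m (-s - u), neg_sub, sub_neg_eq_add]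
    simpa only [e] using this
  have h3 := (h1.add h0).sub (h2.mul_left 2)
  have e : (fun u => kern P ξ m (u + s) ^ 2 + kern P ξ m u ^ 2
      - 2 * (kern P ξ m u * kern P ξ m (u + s)))
      = fun u => (kern P ξ m (u + s) - kern P ξ m u) ^ 2 := by funext u; ring
  rw [e] at h3
  have h4 := sum_le_hasSum F (fun y _ => sq_nonneg _) h3
  linarith

/-- `y_a p_{2m}(y)` as a convolution. -/
lemma hasSum_coord_kern (hS : IsPlanarStep P ξ) (m : ℕ) (a : Fin 2) (y : Lattice) :
    HasSum (fun u => kern P ξ m u * |(u a : ℝ)|) (∫ ω, |(walk ξ m ω a : ℝ)| ∂P) ∧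
    HasSum (fun u => (u a : ℝ) * kern P ξ m u * kern P ξ m (y - u))
      ((y a : ℝ) * kern P ξ (m + m) y / 2) := by
  have h0 := hS.hasSum_kern m (fun y => |(y a : ℝ)|) (hS.integrable_walk_abs a m)
  refine ⟨h0, ?_⟩
  have hs : Summable (fun u => (u a : ℝ) * kern P ξ m u * kern P ξ m (y - u)) := by
    refine Summable.of_norm_bounded h0.summable fun u => ?_
    have h1 := kern_nonneg (P := P) (ξ := ξ) m u
    have h2 := kern_nonneg (P := P) (ξ := ξ) m (y - u)
    have h3 := kern_le_one (P := P) (ξ := ξ) m (y - u)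
    rw [Real.norm_eq_abs, abs_mul, abs_mul, abs_of_nonneg h1, abs_of_nonneg h2]
    calc _ ≤ |(u a : ℝ)| * kern P ξ m u * 1 := by gcongr
      _ = _ := by ring
  obtain ⟨S, hS1⟩ := hs
  -- Under `u ↦ y - u` the sum keeps its value while the weight `u_a` becomes `y_a - u_a`; adding
  -- the two shows that each is half of `y_a p_{2m}(y)`.
  have hS2 : HasSum (fun u => ((y - u) a : ℝ) * kern P ξ m (y - u) * kern P ξ m u) S := by
    have := (Equiv.hasSum_iff (Equiv.subLeft y)).2 hS1
    simpa [Function.comp_def] using this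
  have h3 := (hS.kern_add m m y).mul_left (y a : ℝ)
  have h4 := hS1.add hS2
  have e : (fun u => (u a : ℝ) * kern P ξ m u * kern P ξ m (y - u) +
      ((y - u) a : ℝ) * kern P ξ m (y - u) * kern P ξ m u)
      = fun u => (y a : ℝ) * (kern P ξ m u * kern P ξ m (y - u)) := by
    funext u
    simp only [Pi.sub_apply, Int.cast_sub]; ring
  rw [e] at h4
  have h5 := h4.unique h3
  have h6 : S = (y a : ℝ) * kern P ξ (m + m) y / 2 := by linarith
  rwa [← h6]

/-- In `y_a p_{2m}(y) = 2 ∑ u_a p_m(u) p_m(y - u)` the increment in `y` falls on the second factor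
only. The weight `|u_a| p_m(u)` has mass at most `E|X_m| ≤ √m`, coordinatewise, so Cauchy–Schwarz
gives the factor `4m`. No differentiation of the characteristic function is needed. -/
lemma coord_kern_diff_sq (hS : IsPlanarStep P ξ) {m : ℕ} (hm : 1 ≤ m) (a : Fin 2) (s : Lattice)
    {V : ℝ} (hV : ∀ F : Finset Lattice, ∑ y ∈ F, (kern P ξ m (y + s) - kern P ξ m y) ^ 2 ≤ V)
    (F : Finset Lattice) :
    ∑ y ∈ F, (((y + s) a : ℝ) * kern P ξ (m + m) (y + s) - (y a : ℝ) * kern P ξ (m + m) y) ^ 2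
      ≤ 4 * m * V := by
  have hm' : (0 : ℝ) < m := by exact_mod_cast hm
  have hsq : 0 < Real.sqrt m := Real.sqrt_pos.2 hm'
  set D : Lattice → ℝ := fun y => kern P ξ m (y + s) - kern P ξ m y with hD
  have hDb : ∀ y, |D y| ≤ 1 := fun y => by
    have h1 := kern_nonneg (P := P) (ξ := ξ) m (y + s)
    have h2 := kern_nonneg (P := P) (ξ := ξ) m y
    have h3 := kern_le_one (P := P) (ξ := ξ) m (y + s)
    have h4 := kern_le_one (P := P) (ξ := ξ) m y
    exact abs_le.2 ⟨by simp only [hD]; linarith, by simp only [hD]; linarith⟩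
  have h0 := (hS.hasSum_coord_kern m a 0).1
  set w : Lattice → ℝ := fun u => kern P ξ m u * |(u a : ℝ)| with hw
  have hwn : ∀ u, 0 ≤ w u := fun u => mul_nonneg (kern_nonneg _ _) (abs_nonneg _)
  have hwA : ∑' u, w u ≤ Real.sqrt m := by rw [h0.tsum_eq]; exact hS.integral_walk_abs_le a m
  have hsum2 : ∀ y, Summable fun u => w u * D (y - u) ^ 2 := fun y => by
    refine Summable.of_norm_bounded h0.summable fun u => ?_
    rw [Real.norm_eq_abs, abs_mul, abs_of_nonneg (hwn u), abs_of_nonneg (sq_nonneg _), ← sq_abs]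
    calc w u * |D (y - u)| ^ 2 ≤ w u * 1 ^ 2 := by
          have := hwn u
          gcongr; exact hDb _
      _ = w u := by ring
  have hpt : ∀ y : Lattice, (((y + s) a : ℝ) * kern P ξ (m + m) (y + s)
      - (y a : ℝ) * kern P ξ (m + m) y) ^ 2 ≤ 4 * Real.sqrt m * ∑' u, w u * D (y - u) ^ 2 := by
    intro y
    have h1 := (hS.hasSum_coord_kern m a (y + s)).2.sub (hS.hasSum_coord_kern m a y).2
    have e : (fun u => (u a : ℝ) * kern P ξ m u * kern P ξ m (y + s - u) -
        (u a : ℝ) * kern P ξ m u * kern P ξ m (y - u))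
        = fun u => w u * (SignType.sign (u a : ℝ) * D (y - u)) := by
      funext u
      have : (u a : ℝ) = |(u a : ℝ)| * SignType.sign (u a : ℝ) := (abs_mul_sign _).symm
      simp only [hw, hD]
      rw [show y + s - u = y - u + s by abel]
      calc _ = (u a : ℝ) * kern P ξ m u * (kern P ξ m (y - u + s) - kern P ξ m (y - u)) := by ring
        _ = (|(u a : ℝ)| * SignType.sign (u a : ℝ)) * kern P ξ m u *
            (kern P ξ m (y - u + s) - kern P ξ m (y - u)) := by rw [← this]
        _ = _ := by ring
    rw [e] at h1
    have hsgn : ∀ u : Lattice, ((SignType.sign (u a : ℝ) : SignType) : ℝ) ^ 2 ≤ 1 := by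
      intro u
      rcases lt_trichotomy (u a : ℝ) 0 with h | h | h
      · simp [sign_neg h]
      · simp [h]
      · simp [sign_pos h]
    have h2 := sq_tsum_mul_le (w := w) (x := fun u => SignType.sign (u a : ℝ) * D (y - u)) (B := 1)
      hwn h0.summable hwA hsq (fun u => by
        rw [abs_mul]
        exact mul_le_one₀ ((sq_le_one_iff_abs_le_one _).1 (hsgn u)) (abs_nonneg _) (hDb _))
    rw [h1.tsum_eq] at h2
    have h3 : ∑' u, w u * (SignType.sign (u a : ℝ) * D (y - u)) ^ 2 ≤ ∑' u, w u * D (y - u) ^ 2 := by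
      have hle : ∀ u, w u * (SignType.sign (u a : ℝ) * D (y - u)) ^ 2 ≤ w u * D (y - u) ^ 2 := by
        intro u
        refine mul_le_mul_of_nonneg_left ?_ (hwn u)
        rw [mul_pow]
        exact mul_le_of_le_one_left (sq_nonneg _) (hsgn u)
      exact Summable.tsum_le_tsum hle (Summable.of_nonneg_of_le
        (fun u => mul_nonneg (hwn u) (sq_nonneg _)) hle (hsum2 y)) (hsum2 y)
    have h4 := h2.trans (mul_le_mul_of_nonneg_left h3 hsq.le)
    nlinarith
  calc _ ≤ ∑ y ∈ F, 4 * Real.sqrt m * ∑' u, w u * D (y - u) ^ 2 :=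
        Finset.sum_le_sum fun y _ => hpt y
    _ = 4 * Real.sqrt m * ∑' u, ∑ y ∈ F, w u * D (y - u) ^ 2 := by
        rw [← Finset.mul_sum, Summable.tsum_finsetSum fun y _ => hsum2 y]
    _ ≤ 4 * Real.sqrt m * ∑' u, w u * V := by
        refine mul_le_mul_of_nonneg_left ?_ (by positivity)
        refine Summable.tsum_le_tsum (fun u => ?_) (summable_sum fun y _ => hsum2 y)
          (h0.summable.mul_right V)
        rw [← Finset.mul_sum]
        exact mul_le_mul_of_nonneg_left
          (sum_shift_le (f := fun y => D y ^ 2) hV (Equiv.subRight u) F) (hwn u)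
    _ = 4 * Real.sqrt m * ((∑' u, w u) * V) := by rw [tsum_mul_right]
    _ ≤ 4 * Real.sqrt m * (Real.sqrt m * V) := by
        have : 0 ≤ V := by simpa using hV ∅
        gcongr
    _ = 4 * m * V := by rw [← mul_assoc, mul_assoc 4, Real.mul_self_sqrt hm'.le]

lemma kern_diff_l1_le_two (hS : IsPlanarStep P ξ) (l : ℕ) (s : Lattice) :
    L1Le (fun y => kern P ξ l (y + s) - kern P ξ l y) 2 := by
  have h1 := (hS.kern_l1 l).comp_equiv (Equiv.addRight s)
  have h2 : L1Le (fun y => -kern P ξ l y) 1 := (hS.kern_l1 l).mono (fun y => by rw [abs_neg]) le_rfl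
  have h3 := h1.add h2
  refine h3.mono (fun y => le_of_eq ?_) (by norm_num)
  simp [sub_eq_add_neg]

/-- Weighted `ℓ²`-bound for the difference of the kernel at an even time. -/
lemma weighted_diff_sq (hS : IsPlanarStep P ξ) {C : ℝ} (hC0 : 1 ≤ C)
    (hC : ∀ m : ℕ, 1 ≤ m → (∀ y, kern P ξ m y ≤ C / m) ∧
      (∀ y s, |kern P ξ m (y + s) - kern P ξ m y| ≤ C * sz s / (m * Real.sqrt m)) ∧
      (∀ s, kern P ξ (m + m) 0 - kern P ξ (m + m) s ≤ C * sz s ^ 2 / (m : ℝ) ^ 2))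
    {m : ℕ} (hm : 1 ≤ m) (s : Lattice) (F : Finset Lattice) :
    ∑ y ∈ F, (m + nsq y) * (kern P ξ (m + m) (y + s) - kern P ξ (m + m) y) ^ 2
      ≤ 37 * C * sz s ^ 2 / m := by
  have hm' : (1 : ℝ) ≤ m := by exact_mod_cast hm
  have hz := sz_nonneg s
  set D : Lattice → ℝ := fun y => kern P ξ (m + m) (y + s) - kern P ξ (m + m) y with hD
  have ha : ∑ y ∈ F, D y ^ 2 ≤ C * sz s ^ 2 / (m : ℝ) ^ 2 := by
    refine (hS.kern_diff_sq (m + m) s F).trans ?_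
    have h1 := (hC (m + m) (by omega)).2.2 s
    calc _ ≤ 2 * (C * sz s ^ 2 / ((m + m : ℕ) : ℝ) ^ 2) := by gcongr
      _ = (C * sz s ^ 2 / (m : ℝ) ^ 2) / 2 := by push_cast; field_simp; ring
      _ ≤ _ := half_le_self (by positivity)
  have hV : ∀ F : Finset Lattice, ∑ y ∈ F, (kern P ξ m (y + s) - kern P ξ m y) ^ 2
      ≤ 2 * C * sz s ^ 2 / (m : ℝ) ^ 2 := by
    intro F
    refine (hS.kern_diff_sq m s F).trans ?_
    have h1 := (hC m hm).2.2 s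
    calc _ ≤ 2 * (C * sz s ^ 2 / (m : ℝ) ^ 2) := by gcongr
      _ = _ := by ring
  have hc : ∑ y ∈ F, kern P ξ (m + m) (y + s) ^ 2 ≤ C / m := by
    have h1 := (hS.kern_l1 (m + m)).comp_equiv (Equiv.addRight s) F
    simp only [Equiv.coe_addRight, abs_of_nonneg (kern_nonneg (P := P) (ξ := ξ) (m + m) _)] at h1
    calc _ ≤ ∑ y ∈ F, C / m * kern P ξ (m + m) (y + s) := by
          refine Finset.sum_le_sum fun y _ => ?_
          rw [pow_two]
          refine mul_le_mul_of_nonneg_right ?_ (kern_nonneg _ _)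
          refine ((hC (m + m) (by omega)).1 _).trans ?_
          push_cast
          gcongr; linarith
      _ ≤ C / m * 1 := by
          rw [← Finset.mul_sum]
          gcongr
      _ = _ := mul_one _
  have hd : ∀ a : Fin 2, ∑ y ∈ F, ((y a : ℝ) * D y) ^ 2 ≤ 18 * C * sz s ^ 2 / m := by
    intro a
    have hW := hS.coord_kern_diff_sq hm a s hV F
    -- Moving the coordinate inside the difference, `y_a D(y)` is the increment of `y_a p_{2m}(y)`
    -- minus `s_a p_{2m}(y + s)`. The second term is small because `∑ p² ≤ sup p`.
    have hpt : ∀ y : Lattice, ((y a : ℝ) * D y) ^ 2 ≤ 2 * (((y + s) a : ℝ) * kern P ξ (m + m) (y + s)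
        - (y a : ℝ) * kern P ξ (m + m) y) ^ 2 + 2 * sz s ^ 2 * kern P ξ (m + m) (y + s) ^ 2 := by
      intro y
      have e : (y a : ℝ) * D y = (((y + s) a : ℝ) * kern P ξ (m + m) (y + s)
        - (y a : ℝ) * kern P ξ (m + m) y) - (s a : ℝ) * kern P ξ (m + m) (y + s) := by
        simp only [hD, Pi.add_apply, Int.cast_add]; ring
      have h1 : (s a : ℝ) ^ 2 ≤ sz s ^ 2 := by
        rw [← sq_abs (s a : ℝ)]
        have := abs_apply_le_sz s a
        gcongr
      have h2 : ((s a : ℝ) * kern P ξ (m + m) (y + s)) ^ 2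
          ≤ sz s ^ 2 * kern P ξ (m + m) (y + s) ^ 2 := by
        rw [mul_pow]; gcongr
      rw [e]
      generalize ((y + s) a : ℝ) * kern P ξ (m + m) (y + s)
        - (y a : ℝ) * kern P ξ (m + m) y = A at *
      generalize (s a : ℝ) * kern P ξ (m + m) (y + s) = B at *
      nlinarith [sq_nonneg (A + B)]
    refine (Finset.sum_le_sum fun y _ => hpt y).trans ?_
    rw [Finset.sum_add_distrib, ← Finset.mul_sum, ← Finset.mul_sum]
    calc _ ≤ 2 * (4 * m * (2 * C * sz s ^ 2 / (m : ℝ) ^ 2)) + 2 * sz s ^ 2 * (C / m) := by gcongr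
      _ = 18 * C * sz s ^ 2 / m := by field_simp; ring
  have e : ∀ y, (m + nsq y) * D y ^ 2
      = m * D y ^ 2 + (((y 0 : ℝ) * D y) ^ 2 + ((y 1 : ℝ) * D y) ^ 2) := fun y => by
    unfold nsq; ring
  rw [Finset.sum_congr rfl fun y _ => e y, Finset.sum_add_distrib, Finset.sum_add_distrib,
    ← Finset.mul_sum]
  calc _ ≤ m * (C * sz s ^ 2 / (m : ℝ) ^ 2) + (18 * C * sz s ^ 2 / m + 18 * C * sz s ^ 2 / m) := by
        gcongr
        · exact hd 0
        · exact hd 1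
    _ = _ := by field_simp; ring

lemma nsq_nonneg (y : Lattice) : 0 ≤ nsq y := by unfold nsq; positivity

/-- Inside the square of radius `2m`, Cauchy–Schwarz pairs the weighted `ℓ²` bound with `∑ 1/(m +
|y|²)`, whose square root is the logarithm. Outside, Chebyshev bounds both kernels by `O(1/m)`. If
`|s| ≥ √m`, the trivial bound `2` suffices. -/
lemma kern_diff_l1_even (hS : IsPlanarStep P ξ) {C : ℝ} (hC0 : 1 ≤ C)
    (hC : ∀ m : ℕ, 1 ≤ m → (∀ y, kern P ξ m y ≤ C / m) ∧
      (∀ y s, |kern P ξ m (y + s) - kern P ξ m y| ≤ C * sz s / (m * Real.sqrt m)) ∧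
      (∀ s, kern P ξ (m + m) 0 - kern P ξ (m + m) s ≤ C * sz s ^ 2 / (m : ℝ) ^ 2))
    {m : ℕ} (hm : 1 ≤ m) (s : Lattice) :
    L1Le (fun y => kern P ξ (m + m) (y + s) - kern P ξ (m + m) y)
      (28 * C * sz s / Real.sqrt m * (1 + Real.log (2 * m + 1))) := by
  classical
  intro F
  have hm' : (1 : ℝ) ≤ m := by exact_mod_cast hm
  have hsm : 1 ≤ Real.sqrt m := Real.one_le_sqrt.2 hm'
  have hz := sz_nonneg s
  have hlog : 0 ≤ Real.log (2 * m + 1) := Real.log_nonneg (by linarith)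
  rcases eq_or_ne s 0 with rfl | hs
  · simp only [add_zero, sub_self, abs_zero, Finset.sum_const_zero]
    positivity
  have hs1 := one_le_sz hs
  set D : Lattice → ℝ := fun y => kern P ξ (m + m) (y + s) - kern P ξ (m + m) y with hD
  rcases le_total (Real.sqrt m) (sz s) with hbig | hsmall
  · refine (hS.kern_diff_l1_le_two (m + m) s F).trans ?_
    have h1 : 1 ≤ sz s / Real.sqrt m := (one_le_div (by positivity)).2 hbig
    calc (2 : ℝ) ≤ 28 * 1 * 1 * 1 := by norm_num
      _ ≤ 28 * C * (sz s / Real.sqrt m) * (1 + Real.log (2 * m + 1)) := by gcongr; linarith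
      _ = _ := by ring
  have hsm2 : Real.sqrt m ≤ m := by
    nlinarith [Real.mul_self_sqrt (show (0:ℝ) ≤ m by linarith)]
  set I := F.filter fun y => ∀ a, |(y a : ℝ)| ≤ ((2 * m : ℕ) : ℝ) with hI
  set O := F.filter fun y => ¬ ∀ a, |(y a : ℝ)| ≤ ((2 * m : ℕ) : ℝ) with hO
  have hsplit : ∑ y ∈ F, |D y| = ∑ y ∈ I, |D y| + ∑ y ∈ O, |D y| :=
    (Finset.sum_filter_add_sum_filter_not F _ _).symm
  have hin : ∑ y ∈ I, |D y| ≤ 20 * C * sz s / Real.sqrt m * (1 + Real.log (2 * m + 1)) := by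
    have hcs := Finset.sum_mul_sq_le_sq_mul_sq I (fun y => Real.sqrt (m + nsq y) * |D y|)
      (fun y => 1 / Real.sqrt (m + nsq y))
    have hpos : ∀ y : Lattice, 0 < m + nsq y := fun y => by
      have := nsq_nonneg y; linarith
    have e1 : ∀ y, Real.sqrt (m + nsq y) * |D y| * (1 / Real.sqrt (m + nsq y)) = |D y| := by
      intro y
      have := Real.sqrt_pos.2 (hpos y)
      field_simp
    have e2 : ∀ y, (Real.sqrt (m + nsq y) * |D y|) ^ 2 = (m + nsq y) * D y ^ 2 := by
      intro y
      rw [mul_pow, Real.sq_sqrt (hpos y).le, sq_abs]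
    have e3 : ∀ y : Lattice, (1 / Real.sqrt (m + nsq y)) ^ 2 = 1 / (m + nsq y) := by
      intro y
      rw [div_pow, Real.sq_sqrt (hpos y).le, one_pow]
    simp only [e1, e2, e3] at hcs
    have h1 := hS.weighted_diff_sq hC0 hC hm s I
    have h2 := sum_box_inv_le (2 * m) hm' I (fun y hy => (Finset.mem_filter.1 hy).2)
    refine (le_abs_self _).trans (abs_le_of_sq_le_sq ?_ (by positivity))
    push_cast at h2
    calc _ ≤ (37 * C * sz s ^ 2 / m) * (2 * (2 * (1 + Real.log (2 * m + 1))) ^ 2) := by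
          refine hcs.trans (mul_le_mul h1 h2 ?_ (by positivity))
          exact Finset.sum_nonneg fun y _ => by have := hpos y; positivity
      _ = 296 * C * (sz s ^ 2 / m * (1 + Real.log (2 * m + 1)) ^ 2) := by ring
      _ ≤ 400 * C ^ 2 * (sz s ^ 2 / m * (1 + Real.log (2 * m + 1)) ^ 2) := by
          gcongr ?_ * _
          nlinarith
      _ = _ := by
          rw [mul_pow, div_pow, Real.sq_sqrt (by linarith)]; ring
  have hout : ∑ y ∈ O, |D y| ≤ 8 * C * sz s / Real.sqrt m * (1 + Real.log (2 * m + 1)) := by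
    have hch : ∀ (e : Lattice ≃ Lattice), (∀ y a, |((2 * m : ℕ) : ℝ)| < |(y a : ℝ)| →
        (m : ℝ) ≤ |((e y) a : ℝ)|) → ∑ y ∈ O, kern P ξ (m + m) (e y) ≤ 4 / m := by
      intro e he
      have hcov : O ⊆ O.filter (fun y => (m : ℝ) ≤ |((e y) 0 : ℝ)|) ∪
          O.filter (fun y => (m : ℝ) ≤ |((e y) 1 : ℝ)|) := by
        intro y hy
        have h1 := (Finset.mem_filter.1 hy).2
        push Not at h1
        obtain ⟨a, ha⟩ := h1
        have h2 := he y a (by rwa [abs_of_nonneg (by positivity)])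
        rw [Finset.mem_union]
        fin_cases a
        · exact Or.inl (Finset.mem_filter.2 ⟨hy, h2⟩)
        · exact Or.inr (Finset.mem_filter.2 ⟨hy, h2⟩)
      have hone : ∀ a : Fin 2, ∑ y ∈ O.filter (fun y => (m : ℝ) ≤ |((e y) a : ℝ)|),
          kern P ξ (m + m) (e y) ≤ 2 / m := by
        intro a
        have h1 := hS.kern_chebyshev (m + m) a (R := m) (by linarith)
          ((O.filter (fun y => (m : ℝ) ≤ |((e y) a : ℝ)|)).map e.toEmbedding) (by
            intro y hy
            obtain ⟨x, hx, rfl⟩ := Finset.mem_map.1 hy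
            exact (Finset.mem_filter.1 hx).2)
        rw [Finset.sum_map] at h1
        refine h1.trans_eq ?_
        push_cast; field_simp; ring
      calc _ ≤ _ := Finset.sum_le_sum_of_subset_of_nonneg hcov fun y _ _ => kern_nonneg _ _
        _ ≤ ∑ y ∈ O.filter (fun y => (m : ℝ) ≤ |((e y) 0 : ℝ)|), kern P ξ (m + m) (e y) +
            ∑ y ∈ O.filter (fun y => (m : ℝ) ≤ |((e y) 1 : ℝ)|), kern P ξ (m + m) (e y) := by
            rw [← Finset.sum_union_inter]
            have : 0 ≤ ∑ y ∈ O.filter (fun y => (m : ℝ) ≤ |((e y) 0 : ℝ)|) ∩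
              O.filter (fun y => (m : ℝ) ≤ |((e y) 1 : ℝ)|), kern P ξ (m + m) (e y) :=
              Finset.sum_nonneg fun y _ => kern_nonneg _ _
            linarith
        _ ≤ 2 / m + 2 / m := add_le_add (hone 0) (hone 1)
        _ = 4 / m := by ring
    have h1 := hch (Equiv.refl _) (fun y a h => by
      rw [abs_of_nonneg (by positivity)] at h
      push_cast at h
      simp only [Equiv.refl_apply]
      linarith)
    -- In this case `|s| ≤ √m ≤ m`, so a point outside radius `2m` stays outside radius `m` after
    -- translation.
    have h2 := hch (Equiv.addRight s) (fun y a h => by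
      rw [abs_of_nonneg (by positivity)] at h
      push_cast at h
      simp only [Equiv.coe_addRight, Pi.add_apply, Int.cast_add]
      have h3 := abs_apply_le_sz s a
      have h4 := abs_sub_abs_le_abs_sub (y a : ℝ) (-(s a : ℝ))
      rw [abs_neg, sub_neg_eq_add] at h4
      linarith)
    simp only [Equiv.refl_apply, Equiv.coe_addRight] at h1 h2
    calc ∑ y ∈ O, |D y| ≤ ∑ y ∈ O, (kern P ξ (m + m) (y + s) + kern P ξ (m + m) y) := by
          refine Finset.sum_le_sum fun y _ => ?_
          have a1 := kern_nonneg (P := P) (ξ := ξ) (m + m) (y + s)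
          have a2 := kern_nonneg (P := P) (ξ := ξ) (m + m) y
          exact abs_le.2 ⟨by simp only [hD]; linarith, by simp only [hD]; linarith⟩
      _ ≤ 4 / m + 4 / m := by rw [Finset.sum_add_distrib]; exact add_le_add h2 h1
      _ = 8 * 1 * 1 / m * 1 := by ring
      _ ≤ 8 * C * sz s / Real.sqrt m * (1 + Real.log (2 * m + 1)) := by gcongr; linarith
  calc ∑ y ∈ F, |D y| ≤ 20 * C * sz s / Real.sqrt m * (1 + Real.log (2 * m + 1)) +
        8 * C * sz s / Real.sqrt m * (1 + Real.log (2 * m + 1)) := by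
        rw [hsplit]; exact add_le_add hin hout
    _ = _ := by ring

/-- Convolution with the law of a step contracts `ℓ¹`; this carries the even-time bound to odd
times. -/
lemma kern_diff_l1_step (hS : IsPlanarStep P ξ) {l : ℕ} {s : Lattice} {A : ℝ}
    (h : L1Le (fun y => kern P ξ l (y + s) - kern P ξ l y) A) :
    L1Le (fun y => kern P ξ (1 + l) (y + s) - kern P ξ (1 + l) y) A := by
  intro F
  have hi : ∀ y, Integrable (fun ω => kern P ξ l (y - walk ξ 1 ω)) P := fun y =>
    hS.integrable_of_bdd_walk 1 (f := fun x => kern P ξ l (y - x)) (K := 1) fun x => by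
      rw [abs_of_nonneg (kern_nonneg (P := P) (ξ := ξ) l (y - x))]
      exact kern_le_one (P := P) (ξ := ξ) _ _
  have e : ∀ y, kern P ξ (1 + l) (y + s) - kern P ξ (1 + l) y
      = ∫ ω, (kern P ξ l (y + s - walk ξ 1 ω) - kern P ξ l (y - walk ξ 1 ω)) ∂P := fun y => by
    rw [hS.kern_add_integral, hS.kern_add_integral, integral_sub (hi _) (hi _)]
  calc _ ≤ ∑ y ∈ F, ∫ ω, |kern P ξ l (y + s - walk ξ 1 ω) - kern P ξ l (y - walk ξ 1 ω)| ∂P := by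
        refine Finset.sum_le_sum fun y _ => ?_
        beta_reduce
        rw [e]
        exact abs_integral_le_integral_abs
    _ = ∫ ω, ∑ y ∈ F, |kern P ξ l (y + s - walk ξ 1 ω) - kern P ξ l (y - walk ξ 1 ω)| ∂P :=
        (integral_finsetSum _ fun y _ => ((hi _).sub (hi _)).abs).symm
    _ ≤ ∫ ω, A ∂P := by
        refine integral_mono (integrable_finsetSum _ fun y _ => ((hi _).sub (hi _)).abs)
          (integrable_const _) fun ω => ?_
        have := sum_shift_le (f := fun y => |kern P ξ l (y + s) - kern P ξ l y|) h
          (Equiv.subRight (walk ξ 1 ω)) F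
        simp only [Equiv.subRight_apply] at this
        refine le_trans (le_of_eq (Finset.sum_congr rfl fun y _ => ?_)) this
        rw [show y + s - walk ξ 1 ω = y - walk ξ 1 ω + s by abel]
    _ = A := by simp

/-- The total variation distance between the walk and its translate. -/
lemma exists_kern_diff_l1 (hS : IsPlanarStep P ξ) :
    ∃ C : ℝ, 1 ≤ C ∧ ∀ l : ℕ, 1 ≤ l → (∀ y, kern P ξ l y ≤ C / l) ∧
      (∀ y s, |kern P ξ l (y + s) - kern P ξ l y| ≤ C * sz s / (l * Real.sqrt l)) ∧
      (∀ s, L1Le (fun y => kern P ξ l (y + s) - kern P ξ l y)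
        (C * sz s * (1 + Real.log l) / Real.sqrt l)) := by
  obtain ⟨C, hC0, hC⟩ := hS.exists_kern_bounds
  refine ⟨112 * C, by linarith, fun l hl => ⟨fun y => ?_, fun y s => ?_, fun s => ?_⟩⟩
  · refine ((hC l hl).1 y).trans ?_
    gcongr; linarith
  · refine ((hC l hl).2.1 y s).trans ?_
    have := sz_nonneg s
    gcongr; linarith
  have hz := sz_nonneg s
  have hl' : (1 : ℝ) ≤ l := by exact_mod_cast hl
  have hlog : 0 ≤ Real.log l := Real.log_nonneg hl'
  have hcmp : ∀ m : ℕ, 1 ≤ m → 2 * m ≤ l → l ≤ 2 * m + 1 →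
      28 * C * sz s / Real.sqrt m * (1 + Real.log (2 * m + 1))
        ≤ 112 * C * sz s * (1 + Real.log l) / Real.sqrt l := by
    intro m hm h1 h2
    have hm' : (1 : ℝ) ≤ m := by exact_mod_cast hm
    have h1' : 2 * (m : ℝ) ≤ l := by exact_mod_cast h1
    have h2' : (l : ℝ) ≤ 2 * m + 1 := by exact_mod_cast h2
    have h3 : Real.log (2 * m + 1) ≤ 1 + 2 * Real.log l := by
      have : Real.log (2 * m + 1) ≤ Real.log (2 * l) := Real.log_le_log (by linarith) (by linarith)
      rw [Real.log_mul (by norm_num) (by linarith)] at this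
      linarith [Real.log_two_lt_d9]
    have h4 : Real.sqrt l ≤ 2 * Real.sqrt m := by
      rw [Real.sqrt_le_left (by positivity), mul_pow, Real.sq_sqrt (by linarith)]
      linarith
    have hsm : 0 < Real.sqrt m := Real.sqrt_pos.2 (by linarith)
    have hsl : 0 < Real.sqrt l := Real.sqrt_pos.2 (by linarith)
    rw [div_mul_eq_mul_div, div_le_div_iff₀ hsm hsl]
    calc _ ≤ 28 * C * sz s * (1 + (1 + 2 * Real.log l)) * (2 * Real.sqrt m) := by gcongr
      _ = _ := by ring
  rcases Nat.even_or_odd' l with ⟨m, hm | hm⟩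
  · have hm1 : 1 ≤ m := by omega
    obtain rfl : l = m + m := by omega
    exact (hS.kern_diff_l1_even hC0 hC hm1 s).mono (fun y => le_rfl)
      (hcmp m hm1 (by omega) (by omega))
  · rcases Nat.eq_zero_or_pos m with rfl | hm1
    -- Time `1` has no positive even predecessor; the trivial bound `2` is enough since a nonzero
    -- `s` has size at least `1`.
    · rcases eq_or_ne s 0 with rfl | hs
      · intro F
        simp only [add_zero, sub_self, abs_zero, Finset.sum_const_zero]
        positivity
      · refine (hS.kern_diff_l1_le_two l s).mono (fun y => le_rfl) ?_
        have h1 := one_le_sz hs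
        have : (l : ℝ) = 1 := by rw [hm]; norm_num
        rw [this, Real.log_one, Real.sqrt_one]
        nlinarith
    · have h1 := hS.kern_diff_l1_step (hS.kern_diff_l1_even hC0 hC hm1 s)
      rw [show 1 + (m + m) = l by omega] at h1
      exact h1.mono (fun y => le_rfl) (hcmp m hm1 (by omega) (by omega))

end IsPlanarStep

/-! ### Potential kernel and truncated Green functions -/

lemma sz_add_le (x y : Lattice) : sz (x + y) ≤ sz x + sz y := by
  unfold sz
  simp only [Pi.add_apply, Int.cast_add]
  linarith [abs_add_le (x 0 : ℝ) (y 0), abs_add_le (x 1 : ℝ) (y 1)]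

lemma sz_neg (x : Lattice) : sz (-x) = sz x := by simp [sz]

lemma sz_sub_le (x y : Lattice) : sz (x - y) ≤ sz x + sz y := by
  rw [sub_eq_add_neg, ← sz_neg y]; exact sz_add_le _ _

lemma sz_axisPoint (r : ℤ) : sz (axisPoint r) = |(r : ℝ)| := by simp [sz, axisPoint]

lemma inv_mul_sqrt_le {x : ℝ} (hx : 1 ≤ x) :
    1 / ((x + 1) * Real.sqrt (x + 1)) ≤ 2 / Real.sqrt x - 2 / Real.sqrt (x + 1) := by
  have h1 : 0 < Real.sqrt x := Real.sqrt_pos.2 (by linarith)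
  have h2 : 0 < Real.sqrt (x + 1) := Real.sqrt_pos.2 (by linarith)
  have e1 := Real.sq_sqrt (show 0 ≤ x by linarith)
  have e2 := Real.sq_sqrt (show 0 ≤ x + 1 by linarith)
  set a := Real.sqrt x
  set b := Real.sqrt (x + 1)
  have hab : a ≤ b := Real.sqrt_le_sqrt (by linarith)
  rw [← e2, div_sub_div _ _ h1.ne' h2.ne', div_le_div_iff₀ (by positivity) (by positivity)]
  have h3 : (b - a) * (b + a) = 1 := by ring_nf; linarith
  have h4 : 1 ≤ (b - a) * (2 * b) := by
    rw [← h3]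
    exact mul_le_mul_of_nonneg_left (by linarith) (by linarith)
  have h5 : a * b * 1 ≤ b * b * ((b - a) * (2 * b)) := by gcongr
  nlinarith

lemma sum_inv_mul_sqrt_le (T N : ℕ) (hT : 1 ≤ T) :
    ∑ j ∈ Finset.range N, 1 / (((j + T : ℕ) + 1 : ℝ) * Real.sqrt ((j + T : ℕ) + 1))
      ≤ 2 / Real.sqrt T := by
  have h : ∑ j ∈ Finset.range N, 1 / (((j + T : ℕ) + 1 : ℝ) * Real.sqrt ((j + T : ℕ) + 1))
      ≤ 2 / Real.sqrt T - 2 / Real.sqrt ((N + T : ℕ) : ℝ) := by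
    induction N with
    | zero => simp
    | succ N ih =>
      rw [Finset.sum_range_succ]
      have h1 := inv_mul_sqrt_le (x := ((N + T : ℕ) : ℝ)) (by exact_mod_cast (by omega))
      have e : ((N + 1 + T : ℕ) : ℝ) = ((N + T : ℕ) : ℝ) + 1 := by push_cast; ring
      rw [e]
      linarith
  have : 0 ≤ 2 / Real.sqrt ((N + T : ℕ) : ℝ) := by positivity
  linarith

/-- Applied to differences `p_j(z) - p_j(z')`, whose decay is `j^{-3/2}`: the series of the
potential kernel converges, and its tail beyond `T` is of order `T^{-1/2}`. -/
lemma summable_and_tail_le {f : ℕ → ℝ} {B : ℝ} (hB : 0 ≤ B)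
    (hf : ∀ j : ℕ, |f j| ≤ B / (((j + 1 : ℕ) : ℝ) * Real.sqrt ((j + 1 : ℕ) : ℝ))) :
    Summable f ∧ ∀ T : ℕ, 1 ≤ T → |∑' j, f j - ∑ j ∈ Finset.range T, f j| ≤ 2 * B / Real.sqrt T := by
  have hf' : ∀ T j : ℕ, |f (j + T)|
      ≤ B * (1 / (((j + T : ℕ) + 1 : ℝ) * Real.sqrt ((j + T : ℕ) + 1))) := fun T j => by
    have := hf (j + T)
    push_cast at this ⊢
    rw [mul_one_div]; exact this
  have hpart : ∀ T, 1 ≤ T → ∀ N, ∑ j ∈ Finset.range N, |f (j + T)| ≤ 2 * B / Real.sqrt T := by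
    intro T hT N
    calc _ ≤ ∑ j ∈ Finset.range N,
          B * (1 / (((j + T : ℕ) + 1 : ℝ) * Real.sqrt ((j + T : ℕ) + 1))) :=
          Finset.sum_le_sum fun j _ => hf' T j
      _ ≤ B * (2 / Real.sqrt T) := by
          rw [← Finset.mul_sum]
          exact mul_le_mul_of_nonneg_left (sum_inv_mul_sqrt_le T N hT) hB
      _ = _ := by ring
  have hsT : ∀ T, 1 ≤ T → Summable fun j => |f (j + T)| := fun T hT =>
    summable_of_sum_range_le (fun _ => abs_nonneg _) (hpart T hT)
  have hs : Summable f := ((summable_nat_add_iff (f := fun j => |f j|) 1).1 (hsT 1 le_rfl)).of_abs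
  refine ⟨hs, fun T hT => ?_⟩
  rw [← hs.sum_add_tsum_nat_add T, add_sub_cancel_left]
  calc |∑' j, f (j + T)| ≤ ∑' j, |f (j + T)| := by
        have := norm_tsum_le_tsum_norm (f := fun j => f (j + T)) (hsT T hT)
        simpa using this
    _ ≤ _ := Real.tsum_le_of_sum_range_le (fun _ => abs_nonneg _) (hpart T hT)

lemma sum_inv_sqrt_le (T : ℕ) :
    ∑ l ∈ Finset.range T, 1 / Real.sqrt ((l + 1 : ℕ) : ℝ) ≤ 2 * Real.sqrt T := by
  induction T with
  | zero => simp
  | succ T ih =>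
    rw [Finset.sum_range_succ]
    have h2 : 0 < Real.sqrt ((T + 1 : ℕ) : ℝ) := Real.sqrt_pos.2 (by positivity)
    have e1 := Real.sq_sqrt (show (0 : ℝ) ≤ T by positivity)
    have e2 := Real.sq_sqrt (show (0 : ℝ) ≤ ((T + 1 : ℕ) : ℝ) by positivity)
    have hab : Real.sqrt T ≤ Real.sqrt ((T + 1 : ℕ) : ℝ) := Real.sqrt_le_sqrt (by push_cast; linarith)
    have h0 := Real.sqrt_nonneg (T : ℝ)
    have h3 : 1 / Real.sqrt ((T + 1 : ℕ) : ℝ) ≤ 2 * (Real.sqrt ((T + 1 : ℕ) : ℝ) - Real.sqrt T) := by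
      rw [div_le_iff₀ h2]
      push_cast at *
      nlinarith
    linarith

/-- `∑_{l < T} p_l`. -/
noncomputable def usum (P : Measure Ω) (ξ : ℕ → Ω → Lattice) (T : ℕ) (y : Lattice) : ℝ :=
  ∑ l ∈ Finset.range T, kern P ξ l y

/-- `∑_{1 ≤ l ≤ T} p_l`. -/
noncomputable def vsum (P : Measure Ω) (ξ : ℕ → Ω → Lattice) (T : ℕ) (y : Lattice) : ℝ :=
  ∑ l ∈ Finset.range T, kern P ξ (l + 1) y

/-- All the estimates on the transition kernel and on the potential kernel, with one constant. -/
structure KernelBounds (P : Measure Ω) (ξ : ℕ → Ω → Lattice) (C : ℝ) : Prop where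
  one_le : 1 ≤ C
  summable : ∀ z, Summable (potentialTerm P ξ z)
  kern_le : ∀ l : ℕ, 1 ≤ l → ∀ y, kern P ξ l y ≤ C / l
  diff_kern : ∀ (n T : ℕ) (s : Lattice), 1 ≤ T → T ≤ n →
    L1Le (fun y => kern P ξ T (y + s) - kern P ξ T y) (C * sz s * (1 + Real.log n) / Real.sqrt T)
  diff_usum : ∀ (n T : ℕ) (s : Lattice), 1 ≤ T → T ≤ n →
    L1Le (fun y => usum P ξ T (y + s) - usum P ξ T y) (C * sz s * (1 + Real.log n) * Real.sqrt T)
  potentialDiff_le : ∀ (n : ℕ) (r : ℤ) (z : Lattice), 1 ≤ n → |(r : ℝ) - Real.sqrt n| < 1 →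
    sz z ≤ 2 * Real.sqrt n → |potentialDiff P ξ r z| ≤ C * (1 + Real.log n)
  comp_le : ∀ (n T : ℕ) (r : ℤ) (z : Lattice), 1 ≤ T → T ≤ n → |(r : ℝ) - Real.sqrt n| < 1 →
    sz z ≤ 2 * Real.sqrt n → |vsum P ξ T z - potentialDiff P ξ r z| ≤ C * (1 + Real.log n)
  comp_diff : ∀ (T : ℕ) (r : ℤ) (z z' : Lattice), 1 ≤ T →
    |(vsum P ξ T z - potentialDiff P ξ r z) - (vsum P ξ T z' - potentialDiff P ξ r z')|
      ≤ C * sz (z - z') / Real.sqrt T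

namespace IsPlanarStep

variable {P : Measure Ω} [IsProbabilityMeasure P] {ξ : ℕ → Ω → Lattice}

lemma potentialTerm_eq (y : Lattice) (j : ℕ) :
    potentialTerm P ξ y j = kern P ξ (j + 1) y - kern P ξ (j + 1) (axisPoint 1) := by
  simp [potentialTerm, transProb, kern]

/-- The sum telescopes. Together with `integral_usum_add_step` this is the discrete Poisson equation
behind the Tanaka formula. -/
lemma usum_sub_vsum (T : ℕ) (y : Lattice) :
    usum P ξ T y - vsum P ξ T y = kern P ξ 0 y - kern P ξ T y := by
  unfold usum vsum
  rw [← Finset.sum_sub_distrib]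
  exact Finset.sum_range_sub' (fun l => kern P ξ l y) T

lemma usum_nonneg (T : ℕ) (y : Lattice) : 0 ≤ usum P ξ T y :=
  Finset.sum_nonneg fun _ _ => kern_nonneg _ _

lemma vsum_nonneg (T : ℕ) (y : Lattice) : 0 ≤ vsum P ξ T y :=
  Finset.sum_nonneg fun _ _ => kern_nonneg _ _

lemma usum_l1 (hS : IsPlanarStep P ξ) (T : ℕ) : L1Le (usum P ξ T) T := by
  exact (L1Le.sum (Finset.range T) fun l _ => hS.kern_l1 l).mono (fun _ => le_rfl) (by simp)

lemma vsum_l1 (hS : IsPlanarStep P ξ) (T : ℕ) : L1Le (vsum P ξ T) T := by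
  exact (L1Le.sum (Finset.range T) fun l _ => hS.kern_l1 (l + 1)).mono (fun _ => le_rfl) (by simp)

lemma vsum_neg (hS : IsPlanarStep P ξ) (T : ℕ) (y : Lattice) : vsum P ξ T (-y) = vsum P ξ T y := by
  unfold vsum
  exact Finset.sum_congr rfl fun l _ => hS.kern_neg _ _

lemma integral_kern_add_step (hS : IsPlanarStep P ξ) (l : ℕ) (y : Lattice) :
    ∫ ω, kern P ξ l (y + ξ 0 ω) ∂P = kern P ξ (l + 1) y := by
  rw [add_comm l 1, ← hS.kern_neg, hS.kern_add_integral]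
  refine integral_congr_ae (Filter.Eventually.of_forall fun ω => ?_)
  simp only [walk_succ, walk_zero, zero_add]
  rw [← hS.kern_neg, neg_add']

lemma integrable_kern_add_step (hS : IsPlanarStep P ξ) (l : ℕ) (y : Lattice) :
    Integrable (fun ω => kern P ξ l (y + ξ 0 ω)) P :=
  integrable_of_bdd (hS.measurable_step (fun s => kern P ξ l (y + s)) 0) (K := 1) fun ω => by
    rw [abs_of_nonneg (kern_nonneg (P := P) (ξ := ξ) l _)]
    exact kern_le_one (P := P) (ξ := ξ) _ _

lemma integral_usum_add_step (hS : IsPlanarStep P ξ) (T : ℕ) (y : Lattice) :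
    ∫ ω, usum P ξ T (y + ξ 0 ω) ∂P = vsum P ξ T y := by
  unfold usum vsum
  rw [integral_finsetSum _ fun l _ => hS.integrable_kern_add_step l y]
  exact Finset.sum_congr rfl fun l _ => hS.integral_kern_add_step l y

lemma usum_le (T : ℕ) (y : Lattice) : usum P ξ T y ≤ T := by
  calc usum P ξ T y ≤ ∑ l ∈ Finset.range T, (1 : ℝ) := Finset.sum_le_sum fun l _ => kern_le_one _ _
    _ = T := by simp

/-- The last two fields express the role of the renormalization: `vsum` at `T` and the potential
difference have the same singular part. Between `z` and `z'` their discrepancy changes by a tail of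
the potential series, hence by `O(|z - z'| / √T)`. The factor `15` absorbs the `14` from two values
of the potential and the `1` from the truncated Green function. -/
lemma exists_kernelBounds (hS : IsPlanarStep P ξ) : ∃ C, KernelBounds P ξ C := by
  obtain ⟨C, hC0, hC⟩ := hS.exists_kern_diff_l1
  have hCp : 0 < C := by linarith
  have hdiff : ∀ z z' j, |kern P ξ (j + 1) z - kern P ξ (j + 1) z'|
      ≤ C * sz (z - z') / (((j + 1 : ℕ) : ℝ) * Real.sqrt ((j + 1 : ℕ) : ℝ)) := fun z z' j => by
    have := (hC (j + 1) (by omega)).2.1 z' (z - z')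
    rwa [add_sub_cancel] at this
  have hst : ∀ z, Summable (potentialTerm P ξ z) := fun z => by
    refine (summable_and_tail_le (B := C * sz (z - axisPoint 1))
      (mul_nonneg hCp.le (sz_nonneg _)) fun j => ?_).1
    rw [potentialTerm_eq]; exact hdiff _ _ _
  have hpd : ∀ z z' T, 1 ≤ T → |(vsum P ξ T z - potential P ξ z) - (vsum P ξ T z' - potential P ξ z')|
      ≤ 2 * (C * sz (z - z')) / Real.sqrt T := by
    intro z z' T hT
    have h1 := (summable_and_tail_le (f := fun j => kern P ξ (j + 1) z - kern P ξ (j + 1) z')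
      (mul_nonneg hCp.le (sz_nonneg _)) (hdiff z z')).2 T hT
    have e : ∑' j, (kern P ξ (j + 1) z - kern P ξ (j + 1) z') = potential P ξ z - potential P ξ z' := by
      unfold potential
      rw [← (hst z).tsum_sub (hst z')]
      refine tsum_congr fun j => ?_
      rw [potentialTerm_eq, potentialTerm_eq]; ring
    rw [e, Finset.sum_sub_distrib, abs_sub_comm] at h1
    refine le_trans (le_of_eq ?_) h1
    congr 1
    unfold vsum; ring
  have hlog : ∀ n : ℕ, 0 ≤ Real.log n := fun n => Real.log_natCast_nonneg n
  have hv : ∀ T n z, 1 ≤ T → T ≤ n → vsum P ξ T z ≤ C * (1 + Real.log n) := by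
    intro T n z hT hTn
    have hh := harmonic_le_one_add_log T
    simp only [harmonic, Rat.cast_sum, Rat.cast_inv, Rat.cast_natCast] at hh
    calc vsum P ξ T z ≤ ∑ l ∈ Finset.range T, C * ((l + 1 : ℕ) : ℝ)⁻¹ :=
          Finset.sum_le_sum fun l _ => (hC (l + 1) (by omega)).1 z
      _ ≤ C * (1 + Real.log T) := by
          rw [← Finset.mul_sum]
          gcongr
      _ ≤ _ := by gcongr
  have hpot : ∀ (n : ℕ) z, 1 ≤ n → sz z ≤ 2 * Real.sqrt n → |potential P ξ z| ≤ 7 * C * (1 + Real.log n) := by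
    intro n z hn hz
    have hn' : (1 : ℝ) ≤ n := by exact_mod_cast hn
    have hsn : 1 ≤ Real.sqrt n := Real.one_le_sqrt.2 hn'
    -- The potential vanishes at `e₁`, so `z` is compared with `e₁` at `T = n`: both truncated sums
    -- are logarithmic, and the tail is bounded because `|z - e₁| ≤ 3√n`.
    have h0 : potential P ξ (axisPoint 1) = 0 := by
      unfold potential
      simp [potentialTerm_eq]
    have h1 := hpd z (axisPoint 1) n hn
    rw [h0, sub_zero] at h1
    have h2 := hv n n z hn le_rfl
    have h3 := hv n n (axisPoint 1) hn le_rfl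
    have h4 := vsum_nonneg (P := P) (ξ := ξ) n z
    have h5 := vsum_nonneg (P := P) (ξ := ξ) n (axisPoint 1)
    have h6 : 2 * (C * sz (z - axisPoint 1)) / Real.sqrt n ≤ 6 * C := by
      rw [div_le_iff₀ (by linarith)]
      have := sz_sub_le z (axisPoint 1)
      rw [sz_axisPoint] at this
      norm_num at this
      have : sz (z - axisPoint 1) ≤ 3 * Real.sqrt n := by linarith
      nlinarith
    have h7 : 6 * C * 1 ≤ 6 * C * (1 + Real.log n) := by
      gcongr; linarith [hlog n]
    have := abs_le.1 (h1.trans h6)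
    exact abs_le.2 ⟨by linarith, by linarith⟩
  have hpd14 : ∀ (n : ℕ) (r : ℤ) (z : Lattice), 1 ≤ n → |(r : ℝ) - Real.sqrt n| < 1 →
      sz z ≤ 2 * Real.sqrt n → |potentialDiff P ξ r z| ≤ 14 * C * (1 + Real.log n) := by
    intro n r z hn hr hz
    have hsn : 1 ≤ Real.sqrt n := Real.one_le_sqrt.2 (by exact_mod_cast hn)
    have h1 := hpot n z hn hz
    have h2 := hpot n (axisPoint r) hn (by
      rw [sz_axisPoint]
      have := abs_sub_abs_le_abs_sub (r : ℝ) (Real.sqrt n)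
      rw [abs_of_nonneg (Real.sqrt_nonneg _)] at this
      linarith)
    unfold potentialDiff
    refine (abs_sub _ _).trans ?_
    linarith
  refine ⟨15 * C, ⟨by linarith, hst, fun l hl y => ?_, fun n T s hT hTn => ?_, fun n T s hT hTn => ?_,
    fun n r z hn hr hz => ?_, fun n T r z hT hTn hr hz => ?_, fun T r z z' hT => ?_⟩⟩
  · refine ((hC l hl).1 y).trans ?_
    gcongr; linarith
  · refine ((hC T hT).2.2 s).mono (fun _ => le_rfl) ?_
    have := sz_nonneg s
    have h1 := hlog T
    have hT' : (0 : ℝ) < T := by exact_mod_cast hT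
    gcongr
    linarith
  · have hz := sz_nonneg s
    have hl := hlog n
    have hT1 : 1 ≤ Real.sqrt T := Real.one_le_sqrt.2 (by exact_mod_cast hT)
    obtain ⟨t, rfl⟩ : ∃ t, T = t + 1 := ⟨T - 1, by omega⟩
    have e : (fun y => usum P ξ (t + 1) (y + s) - usum P ξ (t + 1) y) = fun y =>
        (∑ l ∈ Finset.range t, (kern P ξ (l + 1) (y + s) - kern P ξ (l + 1) y))
          + (kern P ξ 0 (y + s) - kern P ξ 0 y) := by
      funext y
      unfold usum
      rw [Finset.sum_range_succ', Finset.sum_range_succ', Finset.sum_sub_distrib]; ring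
    -- Time `0` is not covered by the bound in `1/√l`; here the trivial `2` is at most `2|s|`, since
    -- `s = 0` gives zero and otherwise `|s| ≥ 1`.
    have h0 : L1Le (fun y => kern P ξ 0 (y + s) - kern P ξ 0 y) (2 * sz s) := by
      rcases eq_or_ne s 0 with rfl | hs
      · intro F; simp [sz]
      · exact (hS.kern_diff_l1_le_two 0 s).mono (fun _ => le_rfl) (by linarith [one_le_sz hs])
    have h1 := L1Le.sum (Finset.range t) fun l _ => (hC (l + 1) (by omega)).2.2 s
    rw [e]
    refine (h1.add h0).mono (fun _ => le_rfl) ?_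
    have h2 : ∑ l ∈ Finset.range t, C * sz s * (1 + Real.log ((l + 1 : ℕ) : ℝ)) /
        Real.sqrt ((l + 1 : ℕ) : ℝ) ≤ C * sz s * (1 + Real.log n) * (2 * Real.sqrt t) := by
      calc _ ≤ ∑ l ∈ Finset.range t, C * sz s * (1 + Real.log n) * (1 / Real.sqrt ((l + 1 : ℕ) : ℝ)) := by
            refine Finset.sum_le_sum fun l hl => ?_
            rw [Finset.mem_range] at hl
            rw [mul_one_div]
            gcongr
            omega
        _ ≤ _ := by
            rw [← Finset.mul_sum]
            gcongr
            exact sum_inv_sqrt_le t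
    have h3 : Real.sqrt t ≤ Real.sqrt ((t + 1 : ℕ) : ℝ) := Real.sqrt_le_sqrt (by push_cast; linarith)
    have h4 : C * sz s * (1 + Real.log n) * (2 * Real.sqrt t)
        ≤ C * sz s * (1 + Real.log n) * (2 * Real.sqrt ((t + 1 : ℕ) : ℝ)) := by gcongr
    have h5 : 2 * sz s * 1 * 1 ≤ 2 * (C * sz s) * (1 + Real.log n) * Real.sqrt ((t + 1 : ℕ) : ℝ) := by
      gcongr
      · nlinarith
      · linarith
    have h6 : 0 ≤ C * sz s * (1 + Real.log n) * Real.sqrt ((t + 1 : ℕ) : ℝ) := by positivity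
    linarith
  · refine (hpd14 n r z hn hr hz).trans ?_
    have := hlog n
    gcongr; linarith
  · have h1 := hpd14 n r z (hT.trans hTn) hr hz
    have h2 := hv T n z hT hTn
    have h3 := vsum_nonneg (P := P) (ξ := ξ) T z
    have h4 := abs_le.1 h1
    exact abs_le.2 ⟨by linarith, by linarith⟩
  · have h1 := hpd z z' T hT
    have e : (vsum P ξ T z - potentialDiff P ξ r z) - (vsum P ξ T z' - potentialDiff P ξ r z')
        = (vsum P ξ T z - potential P ξ z) - (vsum P ξ T z' - potential P ξ z') := by
      unfold potentialDiff; ring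
    rw [e]
    refine h1.trans ?_
    have := sz_nonneg (z - z')
    rw [← mul_assoc]
    gcongr; linarith

end IsPlanarStep

/-! ### Maximal number of visits -/

/-- The number of times in `[j, n]` at which the path is where it was at time `j`. -/
noncomputable def returns (X : ℕ → Lattice) (n j : ℕ) : ℝ :=
  ∑ i ∈ Finset.Ico j (n + 1), if X i - X j = 0 then (1 : ℝ) else 0

/-- The maximal number of visits to a point up to time `n`. -/
noncomputable def maxVisits (X : ℕ → Lattice) (n : ℕ) : ℝ :=
  (Finset.range (n + 1)).sup' ⟨0, by simp⟩ (returns X n)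

lemma returns_nonneg (X : ℕ → Lattice) (n j : ℕ) : 0 ≤ returns X n j :=
  Finset.sum_nonneg fun i _ => by split_ifs <;> simp

lemma returns_le (X : ℕ → Lattice) (n j : ℕ) : returns X n j ≤ n + 1 := by
  calc returns X n j ≤ ∑ i ∈ Finset.Ico j (n + 1), (1 : ℝ) :=
        Finset.sum_le_sum fun i _ => by split_ifs <;> simp
    _ = ((n + 1 - j : ℕ) : ℝ) := by simp
    _ ≤ ((n + 1 : ℕ) : ℝ) := by exact_mod_cast Nat.sub_le _ _
    _ = _ := by push_cast; ring

lemma returns_le_maxVisits (X : ℕ → Lattice) {n j : ℕ} (hj : j ≤ n) :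
    returns X n j ≤ maxVisits X n :=
  Finset.le_sup' (returns X n) (Finset.mem_range.2 (Nat.lt_succ_of_le hj))

lemma maxVisits_nonneg (X : ℕ → Lattice) (n : ℕ) : 0 ≤ maxVisits X n :=
  (returns_nonneg X n 0).trans (returns_le_maxVisits X (Nat.zero_le n))

lemma maxVisits_le (X : ℕ → Lattice) (n : ℕ) : maxVisits X n ≤ n + 1 :=
  Finset.sup'_le _ _ fun j _ => returns_le X n j

/-- All visits to `y` occur from the first one on, so they are counted by the returns from that
time. -/
lemma card_visits_le (X : ℕ → Lattice) (n : ℕ) (y : Lattice) :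
    (((Finset.range (n + 1)).filter fun i => X i = y).card : ℝ) ≤ maxVisits X n := by
  rcases ((Finset.range (n + 1)).filter fun i => X i = y).eq_empty_or_nonempty with h | h
  · rw [h]; simpa using maxVisits_nonneg X n
  · set j := ((Finset.range (n + 1)).filter fun i => X i = y).min' h with hj
    have hjm := Finset.mem_filter.1 (Finset.min'_mem _ h)
    have hjn : j ≤ n := by have := Finset.mem_range.1 hjm.1; omega
    refine le_trans ?_ (returns_le_maxVisits X hjn)
    unfold returns
    rw [← Finset.sum_filter, Finset.sum_const, nsmul_eq_mul, mul_one]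
    norm_cast
    refine Finset.card_le_card fun i hi => ?_
    have h1 := Finset.min'_le _ i hi
    rw [Finset.mem_filter, Finset.mem_range] at hi
    rw [Finset.mem_filter, Finset.mem_Ico]
    refine ⟨⟨h1, hi.1⟩, ?_⟩
    rw [hi.2, hjm.2, sub_self]

/-- The occupation bound: sums along the path are controlled by the maximal local time. -/
lemma sum_path_le (X : ℕ → Lattice) (n : ℕ) {f : Lattice → ℝ} {A : ℝ} (hf : L1Le f A) :
    ∑ i ∈ Finset.range (n + 1), |f (X i)| ≤ maxVisits X n * A := by
  rw [Finset.sum_comp (fun y => |f y|) X]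
  calc _ ≤ ∑ y ∈ (Finset.range (n + 1)).image X, maxVisits X n * |f y| := by
        refine Finset.sum_le_sum fun y _ => ?_
        rw [nsmul_eq_mul]
        exact mul_le_mul_of_nonneg_right (card_visits_le X n y) (abs_nonneg _)
    _ ≤ _ := by
        rw [← Finset.mul_sum]
        exact mul_le_mul_of_nonneg_left (hf _) (maxVisits_nonneg X n)

lemma sum_path_subset_le (X : ℕ → Lattice) {n : ℕ} {f : Lattice → ℝ} {A : ℝ} (hf : L1Le f A)
    {S : Finset ℕ} (hS : S ⊆ Finset.range (n + 1)) (e : Lattice ≃ Lattice) :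
    ∑ i ∈ S, |f (e (X i))| ≤ maxVisits X n * A :=
  (Finset.sum_le_sum_of_subset_of_nonneg hS fun _ _ _ => abs_nonneg _).trans
    (sum_path_le X n (hf.comp_equiv e))

lemma pow_succ_sub_pow_succ_le {x y : ℝ} (hy : 0 ≤ y) (hyx : y ≤ x) (p : ℕ) :
    x ^ (p + 1) - y ^ (p + 1) ≤ (p + 1) * ((x - y) * x ^ p) := by
  induction p with
  | zero => simp
  | succ p ih =>
    have e : x ^ (p + 1 + 1) - y ^ (p + 1 + 1)
        = x * (x ^ (p + 1) - y ^ (p + 1)) + (x - y) * y ^ (p + 1) := by ring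
    have h1 : x * (x ^ (p + 1) - y ^ (p + 1)) ≤ x * ((p + 1) * ((x - y) * x ^ p)) :=
      mul_le_mul_of_nonneg_left ih (hy.trans hyx)
    have h2 : (x - y) * y ^ (p + 1) ≤ (x - y) * x ^ (p + 1) := by
      have : 0 ≤ x - y := by linarith
      gcongr
    rw [e]
    push_cast
    calc _ ≤ x * ((p + 1) * ((x - y) * x ^ p)) + (x - y) * x ^ (p + 1) := add_le_add h1 h2
      _ = _ := by ring

/-- The power of a sum is dominated through its tail sums. -/
lemma pow_sum_le_sum_tail {a : ℕ → ℝ} (ha : ∀ i, 0 ≤ a i) (p N j : ℕ) :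
    (∑ i ∈ Finset.Ico j N, a i) ^ (p + 1)
      ≤ (p + 1) * ∑ i ∈ Finset.Ico j N, a i * (∑ k ∈ Finset.Ico i N, a k) ^ p := by
  rcases Nat.lt_or_ge N j with h | h
  · rw [Finset.Ico_eq_empty_of_le h.le]; simp
  obtain ⟨d, rfl⟩ := Nat.exists_eq_add_of_le h
  clear h
  induction d generalizing j with
  | zero => simp
  | succ d ih =>
    have hlt : j < j + (d + 1) := by omega
    have h1 := ih (j + 1)
    rw [show j + 1 + d = j + (d + 1) by omega] at h1
    have h2 := pow_succ_sub_pow_succ_le (x := ∑ i ∈ Finset.Ico j (j + (d + 1)), a i)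
      (y := ∑ i ∈ Finset.Ico (j + 1) (j + (d + 1)), a i)
      (Finset.sum_nonneg fun i _ => ha i)
      (by rw [Finset.sum_eq_sum_Ico_succ_bot hlt]; linarith [ha j]) p
    have e : ∑ i ∈ Finset.Ico j (j + (d + 1)), a i - ∑ i ∈ Finset.Ico (j + 1) (j + (d + 1)), a i
        = a j := by rw [Finset.sum_eq_sum_Ico_succ_bot hlt]; ring
    rw [e] at h2
    rw [Finset.sum_eq_sum_Ico_succ_bot hlt (fun i => a i * (∑ k ∈ Finset.Ico i (j + (d + 1)), a k) ^ p),
      mul_add]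
    linarith

/-- From `x^p / p! ≤ e^x`: any power of the logarithm costs one factor `n`. For this reason no
logarithm survives in the moment estimates. -/
lemma one_add_log_pow_le (p n : ℕ) (hn : 1 ≤ n) :
    (1 + Real.log n) ^ p ≤ (p.factorial : ℝ) * Real.exp 1 * n := by
  have h0 : 0 ≤ Real.log n := Real.log_natCast_nonneg n
  have h1 := Real.pow_div_factorial_le_exp (1 + Real.log n) (by linarith) p
  rw [Real.exp_add, Real.exp_log (by exact_mod_cast hn), div_le_iff₀ (by positivity)] at h1
  linarith

namespace IsPlanarStep

variable {P : Measure Ω} [IsProbabilityMeasure P] {ξ : ℕ → Ω → Lattice}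

lemma depOn_returns (ξ : ℕ → Ω → Lattice) (n j : ℕ) :
    DepOn ξ (Finset.Ico j n) (fun ω => returns (fun i => walk ξ i ω) n j) := by
  unfold returns
  refine DepOn.sum _ fun i hi => ?_
  rw [Finset.mem_Ico] at hi
  exact ((depOn_walk_sub ξ j i hi.1).mono (Finset.Ico_subset_Ico le_rfl (by omega))).comp
    fun w => if w = 0 then (1 : ℝ) else 0

/-- Kac's moment argument: the power is expanded through tail sums. At a return time the future
returns are independent of the past, so each exponent contributes `p + 1` times `∑ p_l(0) ≤ 2C(1 +
log n)`. -/
lemma integral_returns_pow_le (hS : IsPlanarStep P ξ) {C : ℝ} (hC : KernelBounds P ξ C) (n : ℕ)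
    (hn : 1 ≤ n) (p : ℕ) : ∀ j,
    ∫ ω, returns (fun i => walk ξ i ω) n j ^ p ∂P
      ≤ (p.factorial : ℝ) * (2 * C * (1 + Real.log n)) ^ p := by
  have hC1 := hC.one_le
  have hl : 0 ≤ Real.log n := Real.log_natCast_nonneg n
  induction p with
  | zero => intro j; simp
  | succ p ih =>
    intro j
    set R : ℕ → Ω → ℝ := fun j ω => returns (fun i => walk ξ i ω) n j with hR
    set δ : ℕ → Ω → ℝ := fun i ω => if walk ξ i ω - walk ξ j ω = 0 then (1 : ℝ) else 0 with hδ
    have hRm : ∀ i, Measurable (R i) := fun i => hS.measurable_depOn (depOn_returns ξ n i)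
    have hRb : ∀ i k ω, |R i ω ^ k| ≤ ((n : ℝ) + 1) ^ k := fun i k ω => by
      rw [abs_pow, abs_of_nonneg (returns_nonneg _ _ _)]
      exact pow_le_pow_left₀ (returns_nonneg _ _ _) (returns_le _ _ _) k
    have hδb : ∀ i ω, |δ i ω| ≤ 1 := fun i ω => by simp only [hδ]; split_ifs <;> simp
    have hδd : ∀ i, j ≤ i → DepOn ξ (Finset.Ico j i) (δ i) := fun i hi =>
      (depOn_walk_sub ξ j i hi).comp fun w => if w = 0 then (1 : ℝ) else 0
    have hint : ∀ i ∈ Finset.Ico j (n + 1), Integrable (fun ω => δ i ω * R i ω ^ p) P := by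
      intro i hi
      rw [Finset.mem_Ico] at hi
      refine integrable_of_bdd (K := 1 * ((n : ℝ) + 1) ^ p)
        ((hS.measurable_depOn (hδd i hi.1)).mul ((hRm i).pow_const p)) fun ω => ?_
      rw [abs_mul]
      exact mul_le_mul (hδb i ω) (hRb i p ω) (abs_nonneg _) zero_le_one
    have hpt : ∀ ω, R j ω ^ (p + 1) ≤ (p + 1) * ∑ i ∈ Finset.Ico j (n + 1), δ i ω * R i ω ^ p := by
      intro ω
      refine (pow_sum_le_sum_tail (a := fun i => δ i ω) (fun i => by
        simp only [hδ]; split_ifs <;> simp) p (n + 1) j).trans_eq ?_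
      congr 1
      refine Finset.sum_congr rfl fun i _ => ?_
      -- At a return time `X_i = X_j`, so the tail sum counts the returns from `i`; otherwise the
      -- summand has factor zero.
      by_cases h : walk ξ i ω - walk ξ j ω = 0
      · have : walk ξ i ω = walk ξ j ω := sub_eq_zero.1 h
        simp only [hR, hδ, returns, this]
      · simp only [hδ, h, if_false, zero_mul]
    have hstep : ∀ i ∈ Finset.Ico j (n + 1), ∫ ω, δ i ω * R i ω ^ p ∂P
        ≤ kern P ξ (i - j) 0 * ((p.factorial : ℝ) * (2 * C * (1 + Real.log n)) ^ p) := by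
      intro i hi
      rw [Finset.mem_Ico] at hi
      rw [hS.integral_mul_depOn (Finset.Ico_disjoint_Ico_consecutive j i n) (hδd i hi.1)
        ((depOn_returns ξ n i).comp fun x => x ^ p)]
      have := hS.kern_sub j (i - j) 0
      rw [show j + (i - j) = i by omega] at this
      rw [show ∫ ω, δ i ω ∂P = kern P ξ (i - j) 0 from this]
      exact mul_le_mul_of_nonneg_left (ih i) (kern_nonneg _ _)
    have hks : ∑ i ∈ Finset.Ico j (n + 1), kern P ξ (i - j) 0 ≤ 2 * C * (1 + Real.log n) := by
      rw [Finset.sum_Ico_eq_sum_range]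
      simp only [add_tsub_cancel_left]
      calc _ ≤ ∑ k ∈ Finset.range (n + 1), kern P ξ k 0 :=
            Finset.sum_le_sum_of_subset_of_nonneg (Finset.range_subset_range.2 (by omega))
              fun _ _ _ => kern_nonneg _ _
        _ ≤ ∑ k ∈ Finset.range n, C * ((k : ℝ) + 1)⁻¹ + 1 := by
            rw [Finset.sum_range_succ']
            refine add_le_add (Finset.sum_le_sum fun k _ => ?_) (kern_le_one _ _)
            have := hC.kern_le (k + 1) (by omega) 0
            push_cast at this
            rwa [div_eq_mul_inv] at this
        _ ≤ C * (1 + Real.log n) + 1 := by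
            rw [← Finset.mul_sum]
            have := harmonic_le_one_add_log n
            simp only [harmonic, Rat.cast_sum, Rat.cast_inv, Rat.cast_natCast] at this
            push_cast at this
            gcongr
        _ ≤ _ := by nlinarith
    have hIR : Integrable (fun ω => R j ω ^ (p + 1)) P :=
      integrable_of_bdd ((hRm j).pow_const _) (hRb j (p + 1))
    calc ∫ ω, R j ω ^ (p + 1) ∂P
        ≤ ∫ ω, (p + 1) * ∑ i ∈ Finset.Ico j (n + 1), δ i ω * R i ω ^ p ∂P :=
          integral_mono hIR ((integrable_finsetSum _ hint).const_mul _) hpt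
      _ = (p + 1) * ∑ i ∈ Finset.Ico j (n + 1), ∫ ω, δ i ω * R i ω ^ p ∂P := by
          rw [integral_const_mul, integral_finsetSum _ hint]
      _ ≤ (p + 1) * ∑ i ∈ Finset.Ico j (n + 1),
            kern P ξ (i - j) 0 * ((p.factorial : ℝ) * (2 * C * (1 + Real.log n)) ^ p) := by
          gcongr with i hi
          exact hstep i hi
      _ ≤ (p + 1) * (2 * C * (1 + Real.log n) *
            ((p.factorial : ℝ) * (2 * C * (1 + Real.log n)) ^ p)) := by
          rw [← Finset.sum_mul]
          gcongr
      _ = _ := by rw [Nat.factorial_succ]; push_cast; ring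

lemma depOn_maxVisits (ξ : ℕ → Ω → Lattice) (n : ℕ) :
    DepOn ξ (Finset.range n) (fun ω => maxVisits (fun i => walk ξ i ω) n) := by
  intro ω ω' h
  unfold maxVisits
  refine Finset.sup'_congr _ rfl fun j _ => ?_
  refine depOn_returns ξ n j ω ω' fun i hi => h i ?_
  rw [Finset.mem_Ico] at hi
  exact Finset.mem_range.2 hi.2

/-- The random factor that controls all path sums up to time `n`. -/
noncomputable def _root_.RWIntersection.lam (ξ : ℕ → Ω → Lattice) (C : ℝ) (n : ℕ) (ω : Ω) : ℝ :=
  maxVisits (fun i => walk ξ i ω) n + C * (1 + Real.log n)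

lemma _root_.RWIntersection.depOn_lam (ξ : ℕ → Ω → Lattice) (C : ℝ) (n : ℕ) :
    DepOn ξ (Finset.range n) (lam ξ C n) :=
  (depOn_maxVisits ξ n).comp fun x => x + C * (1 + Real.log n)

lemma _root_.RWIntersection.one_le_lam {C : ℝ} (hC : 1 ≤ C) (n : ℕ) (ω : Ω) : 1 ≤ lam ξ C n ω := by
  have h0 : 0 ≤ Real.log n := Real.log_natCast_nonneg n
  have h1 := maxVisits_nonneg (fun i => walk ξ i ω) n
  unfold lam
  nlinarith

lemma _root_.RWIntersection.lam_le {C : ℝ} (hC : 1 ≤ C) (n : ℕ) (ω : Ω) :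
    lam ξ C n ω ≤ n + 1 + C * (1 + Real.log n) := by
  unfold lam
  linarith [maxVisits_le (fun i => walk ξ i ω) n]

/-- The maximum over `n + 1` starting times, bounded by the sum, costs one factor `n`, and the
logarithms cost another. The loss does not depend on `p`, so `MomO.of_sq` can reduce it. -/
lemma exists_integral_lam_pow_le (hS : IsPlanarStep P ξ) {C : ℝ} (hC : KernelBounds P ξ C) (p : ℕ) :
    ∃ K : ℝ, ∀ n : ℕ, 1 ≤ n → ∫ ω, lam ξ C n ω ^ p ∂P ≤ K * (n : ℝ) ^ 2 := by
  have hC1 := hC.one_le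
  refine ⟨2 ^ p * ((2 * p.factorial * (2 * C) ^ p + C ^ p) * (p.factorial * Real.exp 1)), fun n hn => ?_⟩
  have hn' : (1 : ℝ) ≤ n := by exact_mod_cast hn
  have hl : 0 ≤ Real.log n := Real.log_natCast_nonneg n
  set L := 1 + Real.log n with hL
  have hL0 : 0 ≤ L := by linarith
  set V : Ω → ℝ := fun ω => maxVisits (fun i => walk ξ i ω) n with hV
  have hV0 : ∀ ω, 0 ≤ V ω := fun ω => maxVisits_nonneg _ _
  have hVm : Measurable V := hS.measurable_depOn (depOn_maxVisits ξ n)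
  have hVb : ∀ ω, |V ω ^ p| ≤ ((n : ℝ) + 1) ^ p := fun ω => by
    rw [abs_pow, abs_of_nonneg (hV0 ω)]
    exact pow_le_pow_left₀ (hV0 ω) (maxVisits_le _ _) p
  have hRi : ∀ j, Integrable (fun ω => returns (fun i => walk ξ i ω) n j ^ p) P := fun j =>
    integrable_of_bdd (K := ((n : ℝ) + 1) ^ p)
      ((hS.measurable_depOn (depOn_returns ξ n j)).pow_const p) fun ω => by
      rw [abs_pow, abs_of_nonneg (returns_nonneg _ _ _)]
      exact pow_le_pow_left₀ (returns_nonneg _ _ _) (returns_le _ _ _) p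
  have hVp : ∫ ω, V ω ^ p ∂P ≤ (n + 1) * ((p.factorial : ℝ) * (2 * C * L) ^ p) := by
    calc ∫ ω, V ω ^ p ∂P
        ≤ ∫ ω, ∑ j ∈ Finset.range (n + 1), returns (fun i => walk ξ i ω) n j ^ p ∂P := by
          refine integral_mono (integrable_of_bdd (hVm.pow_const p) hVb)
            (integrable_finsetSum _ fun j _ => hRi j) fun ω => ?_
          obtain ⟨j, hj, he⟩ := Finset.exists_mem_eq_sup' (s := Finset.range (n + 1)) ⟨0, by simp⟩
            (returns (fun i => walk ξ i ω) n)
          have : V ω = returns (fun i => walk ξ i ω) n j := he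
          simp only [this]
          exact Finset.single_le_sum
            (f := fun j => returns (fun i => walk ξ i ω) n j ^ p)
            (fun i _ => pow_nonneg (returns_nonneg _ _ _) p) hj
      _ = ∑ j ∈ Finset.range (n + 1), ∫ ω, returns (fun i => walk ξ i ω) n j ^ p ∂P :=
          integral_finsetSum _ fun j _ => hRi j
      _ ≤ ∑ j ∈ Finset.range (n + 1), (p.factorial : ℝ) * (2 * C * L) ^ p :=
          Finset.sum_le_sum fun j _ => hS.integral_returns_pow_le hC n hn p j
      _ = _ := by simp
  have hLp := one_add_log_pow_le p n hn
  calc ∫ ω, lam ξ C n ω ^ p ∂P ≤ ∫ ω, 2 ^ p * (V ω ^ p + (C * L) ^ p) ∂P := by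
        have i1 : Integrable (fun ω => V ω ^ p) P := integrable_of_bdd (hVm.pow_const p) hVb
        refine integral_mono_of_nonneg (Filter.Eventually.of_forall fun ω => ?_)
          ((i1.add (integrable_const _)).const_mul _) (Filter.Eventually.of_forall fun ω => ?_)
        · exact pow_nonneg (zero_le_one.trans (one_le_lam hC1 n ω)) p
        · have h1 : 0 ≤ C * L := by positivity
          have h2 := hV0 ω
          change (V ω + C * L) ^ p ≤ 2 ^ p * (V ω ^ p + (C * L) ^ p)
          calc (V ω + C * L) ^ p ≤ (2 * max (V ω) (C * L)) ^ p := by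
                gcongr
                linarith [le_max_left (V ω) (C * L), le_max_right (V ω) (C * L)]
            _ = 2 ^ p * (max (V ω) (C * L)) ^ p := mul_pow _ _ _
            _ ≤ _ := by
                gcongr
                rcases max_choice (V ω) (C * L) with h | h <;> rw [h]
                · linarith [pow_nonneg h1 p]
                · linarith [pow_nonneg h2 p]
    _ = 2 ^ p * (∫ ω, V ω ^ p ∂P + (C * L) ^ p) := by
        rw [integral_const_mul, integral_add (integrable_of_bdd (hVm.pow_const p) hVb)
          (integrable_const _)]
        simp
    _ ≤ 2 ^ p * ((n + 1) * ((p.factorial : ℝ) * (2 * C * L) ^ p) + (C * L) ^ p) := by gcongr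
    _ ≤ 2 ^ p * ((2 * n) * ((p.factorial : ℝ) * (2 * C * L) ^ p) + n * (C * L) ^ p) := by
        gcongr
        · linarith
        · exact le_mul_of_one_le_left (by positivity) hn'
    _ = 2 ^ p * ((2 * p.factorial * (2 * C) ^ p + C ^ p) * L ^ p) * n := by
        rw [mul_pow (2 * C) L, mul_pow C L]; ring
    _ ≤ 2 ^ p * ((2 * p.factorial * (2 * C) ^ p + C ^ p) * ((p.factorial : ℝ) * Real.exp 1 * n)) * n := by
        gcongr
    _ = _ := by ring

end IsPlanarStep

/-! ### Chains and the discrete Tanaka formula -/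

/-- The renormalized weight of the chains that end at time `j`; the shifts are listed from the last
one to the first one, and `g` is the renormalization. -/
noncomputable def chainW (g : Lattice → ℝ) (X : ℕ → Lattice) : List Lattice → ℕ → ℝ
  | [], _ => 1
  | z :: l, j => (∑ i ∈ Finset.range j, chainW g X l i * if X j - X i = z then 1 else 0)
      - g z * chainW g X l j

/-- The renormalized weight of the chains up to time `N`. -/
noncomputable def chainS (g : Lattice → ℝ) (X : ℕ → Lattice) (l : List Lattice) (N : ℕ) : ℝ :=
  ∑ j ∈ Finset.range (N + 1), chainW g X l j

/-- The smoothed part of the weight of a chain with last shift `z`. -/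
noncomputable def smoothPart (k : Lattice → ℝ) (c : ℝ) (X : ℕ → Lattice) (L : ℕ → ℝ) (N : ℕ)
    (z : Lattice) : ℝ :=
  ∑ j ∈ Finset.range (N + 1), ∑ i ∈ Finset.range j, L i * k (X j - X i - z)
    + c * ∑ j ∈ Finset.range (N + 1), L j

/-- The increment of the martingale in the Tanaka formula. -/
noncomputable def martDiff (u v : Lattice → ℝ) (X : ℕ → Lattice) (L : ℕ → ℝ) (z : Lattice)
    (j : ℕ) : ℝ :=
  ∑ i ∈ Finset.range (j + 1), L i * (u (X (j + 1) - X i - z) - v (X j - X i - z))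

/-- The final term in the Tanaka formula. -/
noncomputable def finalPart (v : Lattice → ℝ) (X : ℕ → Lattice) (L : ℕ → ℝ) (N : ℕ)
    (z : Lattice) : ℝ :=
  ∑ i ∈ Finset.range (N + 1), L i * v (X N - X i - z)

/-- Induction on `N`. At the new time the indicator is `k + u - v`, and `u - v` splits into
`u(X_{N+1} - ·) - v(X_N - ·)`, the martingale increment, and a telescoping increment of `v`. The new
index `i = N + 1` enters the last sum with value zero. The weights `L` are arbitrary. -/
lemma tanaka {u v k : Lattice → ℝ} (hu : ∀ y, u y - v y = (if y = 0 then 1 else 0) - k y)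
    (X : ℕ → Lattice) (L : ℕ → ℝ) (z : Lattice) (N : ℕ) :
    ∑ j ∈ Finset.range (N + 1), ∑ i ∈ Finset.range j, (L i * if X j - X i = z then 1 else 0)
      = ∑ j ∈ Finset.range (N + 1), ∑ i ∈ Finset.range j, L i * k (X j - X i - z)
        + ∑ j ∈ Finset.range N, martDiff u v X L z j
        + ∑ i ∈ Finset.range (N + 1), L i * (v (-z) - v (X N - X i - z)) := by
  induction N with
  | zero => simp
  | succ N ih =>
    rw [Finset.sum_range_succ, ih, Finset.sum_range_succ _ (N + 1),
      Finset.sum_range_succ (fun j => martDiff u v X L z j) N,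
      Finset.sum_range_succ (fun i => L i * (v (-z) - v (X (N + 1) - X i - z))) (N + 1)]
    unfold martDiff
    have e : ∀ i, (L i * if X (N + 1) - X i = z then 1 else 0)
        = L i * k (X (N + 1) - X i - z) + (L i * (u (X (N + 1) - X i - z) - v (X N - X i - z))
          + (L i * (v (-z) - v (X (N + 1) - X i - z)) - L i * (v (-z) - v (X N - X i - z)))) := by
      intro i
      have := hu (X (N + 1) - X i - z)
      simp only [sub_eq_zero (b := z)] at this
      linear_combination (-L i) * this
    rw [Finset.sum_congr rfl fun i _ => e i, Finset.sum_add_distrib, Finset.sum_add_distrib,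
      Finset.sum_sub_distrib, sub_self (X (N + 1)), zero_sub]
    ring

/-- The term `v(-z) = v(z)` of the Tanaka formula meets the renormalization `-g z`. Only `v z - g z`
remains, which varies slowly in `z` although `g` alone does not. -/
lemma chainS_cons {u v k g : Lattice → ℝ} (hu : ∀ y, u y - v y = (if y = 0 then 1 else 0) - k y)
    (hv : ∀ y, v (-y) = v y) (X : ℕ → Lattice) (z : Lattice) (l : List Lattice) (N : ℕ) :
    chainS g X (z :: l) N = smoothPart k (v z - g z) X (chainW g X l) N z
      + ∑ j ∈ Finset.range N, martDiff u v X (chainW g X l) z j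
      - finalPart v X (chainW g X l) N z := by
  have h := tanaka hu X (chainW g X l) z N
  unfold chainS smoothPart finalPart
  simp only [chainW, Finset.sum_sub_distrib, ← Finset.mul_sum, mul_sub, hv] at h ⊢
  rw [h, ← Finset.sum_mul]
  ring

/-- Each shift multiplies the bound by the number of visits to one point, for the sum over `i`, plus
the bound of the renormalization. -/
lemma abs_chainW_le (g : Lattice → ℝ) (X : ℕ → Lattice) {n : ℕ} {B : ℝ} (hB : 0 ≤ B)
    (l : List Lattice) (hl : ∀ z ∈ l, |g z| ≤ B) : ∀ j ≤ n,
    |chainW g X l j| ≤ (maxVisits X n + B) ^ l.length := by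
  have hV := maxVisits_nonneg X n
  induction l with
  | nil => intro j hj; simp [chainW]
  | cons z l ih =>
    intro j hj
    have ih' := ih fun z hz => hl z (List.mem_cons_of_mem _ hz)
    have hΛ : 0 ≤ (maxVisits X n + B) ^ l.length := by positivity
    have h1 : |∑ i ∈ Finset.range j, chainW g X l i * (if X j - X i = z then (1 : ℝ) else 0)|
        ≤ maxVisits X n * (maxVisits X n + B) ^ l.length := by
      calc _ ≤ ∑ i ∈ Finset.range j, (maxVisits X n + B) ^ l.length *
            (if X j - X i = z then (1 : ℝ) else 0) := by
            refine (Finset.abs_sum_le_sum_abs _ _).trans (Finset.sum_le_sum fun i hi => ?_)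
            rw [Finset.mem_range] at hi
            rw [abs_mul]
            have := ih' i (by omega)
            split_ifs
            · simpa using this
            · simp
        _ = (((Finset.range j).filter fun i => X j - X i = z).card : ℝ) *
            (maxVisits X n + B) ^ l.length := by
            rw [← Finset.mul_sum, ← Finset.sum_filter, Finset.sum_const, nsmul_eq_mul, mul_one, mul_comm]
        _ ≤ _ := by
            refine mul_le_mul_of_nonneg_right ?_ hΛ
            refine le_trans ?_ (card_visits_le X n (X j - z))
            norm_cast
            refine Finset.card_le_card fun i hi => ?_
            rw [Finset.mem_filter, Finset.mem_range] at hi ⊢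
            refine ⟨by omega, ?_⟩
            rw [← hi.2]; abel
    have h2 : |g z * chainW g X l j| ≤ B * (maxVisits X n + B) ^ l.length := by
      rw [abs_mul]
      exact mul_le_mul (hl z List.mem_cons_self) (ih' j hj) (abs_nonneg _) hB
    rw [chainW, List.length_cons, pow_succ']
    refine (abs_sub _ _).trans ?_
    linarith

/-- The reflection-translation `x ↦ a - x - z` of the lattice. -/
def reflect (a z : Lattice) : Lattice ≃ Lattice := (Equiv.subLeft a).trans (Equiv.subRight z)

@[simp] lemma reflect_apply (a z x : Lattice) : reflect a z x = a - x - z := rfl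

lemma finalPart_le {v : Lattice → ℝ} {A Λ : ℝ} (hv : L1Le v A) (X : ℕ → Lattice) (L : ℕ → ℝ)
    {n N : ℕ} (hN : N ≤ n) (hL : ∀ j ≤ n, |L j| ≤ Λ) (z : Lattice) :
    |finalPart v X L N z| ≤ Λ * (maxVisits X n * A) := by
  have hΛ : 0 ≤ Λ := (abs_nonneg _).trans (hL 0 (Nat.zero_le n))
  unfold finalPart
  calc _ ≤ ∑ i ∈ Finset.range (N + 1), Λ * |v (reflect (X N) z (X i))| := by
        refine (Finset.abs_sum_le_sum_abs _ _).trans (Finset.sum_le_sum fun i hi => ?_)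
        rw [Finset.mem_range] at hi
        rw [abs_mul]
        exact mul_le_mul_of_nonneg_right (hL i (by omega)) (abs_nonneg _)
    _ ≤ _ := by
        rw [← Finset.mul_sum]
        exact mul_le_mul_of_nonneg_left (sum_path_subset_le X hv
          (Finset.range_subset_range.2 (by omega)) (reflect (X N) z)) hΛ

lemma martStep_abs_le {u v : Lattice → ℝ} {A B Λ : ℝ} (hu : L1Le u A) (hv : L1Le v B)
    (X : ℕ → Lattice) (L : ℕ → ℝ) {n j : ℕ} (hj : j ≤ n) (hL : ∀ j ≤ n, |L j| ≤ Λ)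
    (x z : Lattice) :
    |∑ i ∈ Finset.range (j + 1), L i * (u (x - X i - z) - v (X j - X i - z))|
      ≤ Λ * (maxVisits X n * (A + B)) := by
  have hΛ : 0 ≤ Λ := (abs_nonneg _).trans (hL 0 (Nat.zero_le n))
  have hsub : Finset.range (j + 1) ⊆ Finset.range (n + 1) := Finset.range_subset_range.2 (by omega)
  have h1 := sum_path_subset_le X hu hsub (reflect x z)
  have h2 := sum_path_subset_le X hv hsub (reflect (X j) z)
  calc _ ≤ ∑ i ∈ Finset.range (j + 1),
          Λ * (|u (reflect x z (X i))| + |v (reflect (X j) z (X i))|) := by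
        refine (Finset.abs_sum_le_sum_abs _ _).trans (Finset.sum_le_sum fun i hi => ?_)
        rw [Finset.mem_range] at hi
        rw [abs_mul]
        exact mul_le_mul (hL i (by omega)) (abs_sub _ _) (abs_nonneg _) hΛ
    _ ≤ _ := by
        rw [← Finset.mul_sum, Finset.sum_add_distrib, mul_add (maxVisits X n)]
        gcongr

/-- The change of the martingale increment under a change of the last step. -/
lemma martStep_le {u : Lattice → ℝ} {A Λ : ℝ} {s : Lattice}
    (hu : L1Le (fun y => u (y + s) - u y) A)
    (X : ℕ → Lattice) (L : ℕ → ℝ) {n j : ℕ} (hj : j ≤ n) (hL : ∀ j ≤ n, |L j| ≤ Λ)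
    (z : Lattice) :
    |∑ i ∈ Finset.range (j + 1), L i * u (X j + s - X i - z)
      - ∑ i ∈ Finset.range (j + 1), L i * u (X j - X i - z)| ≤ Λ * (maxVisits X n * A) := by
  have hΛ : 0 ≤ Λ := (abs_nonneg _).trans (hL 0 (Nat.zero_le n))
  have h1 := sum_path_subset_le X hu (Finset.range_subset_range.2 (show j + 1 ≤ n + 1 by omega))
    (reflect (X j) z)
  rw [← Finset.sum_sub_distrib]
  calc _ ≤ ∑ i ∈ Finset.range (j + 1),
          Λ * |u (reflect (X j) z (X i) + s) - u (reflect (X j) z (X i))| := by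
        refine (Finset.abs_sum_le_sum_abs _ _).trans (Finset.sum_le_sum fun i hi => ?_)
        rw [Finset.mem_range] at hi
        rw [← mul_sub, abs_mul, reflect_apply, show X j + s - X i - z = X j - X i - z + s by abel]
        exact mul_le_mul_of_nonneg_right (hL i (by omega)) (abs_nonneg _)
    _ ≤ _ := by
        rw [← Finset.mul_sum]
        gcongr

lemma smoothPart_sub_le {k : Lattice → ℝ} {A Λ : ℝ} {c c' : ℝ} {z z' : Lattice}
    (hk : L1Le (fun y => k (y + (z' - z)) - k y) A) (X : ℕ → Lattice) (L : ℕ → ℝ) {n N : ℕ}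
    (hN : N ≤ n) (hL : ∀ j ≤ n, |L j| ≤ Λ) :
    |smoothPart k c X L N z - smoothPart k c' X L N z'|
      ≤ (n + 1) * (Λ * (maxVisits X n * A)) + |c - c'| * ((n + 1) * Λ) := by
  have hΛ : 0 ≤ Λ := (abs_nonneg _).trans (hL 0 (Nat.zero_le n))
  have hA : 0 ≤ A := hk.nonneg
  have hV := maxVisits_nonneg X n
  have hNn : ((N : ℝ) + 1) ≤ n + 1 := by exact_mod_cast Nat.succ_le_succ hN
  have e : smoothPart k c X L N z - smoothPart k c' X L N z'
      = (∑ j ∈ Finset.range (N + 1), ∑ i ∈ Finset.range j,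
          L i * (k (X j - X i - z) - k (X j - X i - z')))
        + (c - c') * ∑ j ∈ Finset.range (N + 1), L j := by
    unfold smoothPart
    simp only [mul_sub, Finset.sum_sub_distrib]
    ring
  have h1 : |∑ j ∈ Finset.range (N + 1), ∑ i ∈ Finset.range j,
          L i * (k (X j - X i - z) - k (X j - X i - z'))| ≤ (n + 1) * (Λ * (maxVisits X n * A)) := by
    calc _ ≤ ∑ j ∈ Finset.range (N + 1), Λ * (maxVisits X n * A) := by
          refine (Finset.abs_sum_le_sum_abs _ _).trans (Finset.sum_le_sum fun j hj => ?_)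
          rw [Finset.mem_range] at hj
          calc _ ≤ ∑ i ∈ Finset.range j, Λ *
                |k (reflect (X j) z' (X i) + (z' - z)) - k (reflect (X j) z' (X i))| := by
                refine (Finset.abs_sum_le_sum_abs _ _).trans (Finset.sum_le_sum fun i hi => ?_)
                rw [Finset.mem_range] at hi
                rw [abs_mul, reflect_apply,
                  show X j - X i - z' + (z' - z) = X j - X i - z by abel]
                exact mul_le_mul_of_nonneg_right (hL i (by omega)) (abs_nonneg _)
            _ ≤ _ := by
                rw [← Finset.mul_sum]
                exact mul_le_mul_of_nonneg_left (sum_path_subset_le X hk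
                  (Finset.range_subset_range.2 (by omega)) (reflect (X j) z')) hΛ
      _ = ((N : ℝ) + 1) * (Λ * (maxVisits X n * A)) := by simp
      _ ≤ _ := by gcongr
  have h2 : |∑ j ∈ Finset.range (N + 1), L j| ≤ (n + 1) * Λ := by
    calc _ ≤ ∑ j ∈ Finset.range (N + 1), Λ := by
          refine (Finset.abs_sum_le_sum_abs _ _).trans (Finset.sum_le_sum fun j hj => ?_)
          rw [Finset.mem_range] at hj
          exact hL j (by omega)
      _ = ((N : ℝ) + 1) * Λ := by simp
      _ ≤ _ := by gcongr
  rw [e]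
  refine (abs_add_le _ _).trans (add_le_add h1 ?_)
  rw [abs_mul]
  gcongr

/-- The part of a block before `j` is an interval, so its sum is a difference of two partial sums,
each at most `M`. -/
lemma sum_filter_div_le {D : ℕ → ℝ} {n b : ℕ} {M : ℝ} (hb : 1 ≤ b)
    (hD : ∀ m ≤ n + 1, |∑ i ∈ Finset.range m, D i| ≤ M) {j : ℕ} (hj : j ≤ n + 1) (t : ℕ) :
    |∑ i ∈ (Finset.range j).filter (fun i => i / b = t), D i| ≤ 2 * M := by
  have e : (Finset.range j).filter (fun i => i / b = t)
      = Finset.Ico (min j (t * b)) (min j ((t + 1) * b)) := by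
    ext i
    rw [Finset.mem_filter, Finset.mem_range, Finset.mem_Ico, Nat.div_eq_iff (by omega)]
    have : (t + 1) * b = t * b + b := by ring
    omega
  rw [e, Finset.sum_Ico_eq_sub _ (min_le_min le_rfl (by gcongr; omega))]
  refine (abs_sub _ _).trans ?_
  have h1 := hD (min j (t * b)) (by omega)
  have h2 := hD (min j ((t + 1) * b)) (by omega)
  linarith

/-- Replacing the weights in the smoothed part: the positions are frozen along blocks of
length `b`. -/
lemma smoothPart_weights_le {k : Lattice → ℝ} {A : Lattice → ℝ} {K Λ M : ℝ} {c : ℝ} {z : Lattice}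
    (hk : L1Le k K) (hA : ∀ s, L1Le (fun y => k (y + s) - k y) (A s)) (X : ℕ → Lattice)
    (L L' : ℕ → ℝ) {n N b : ℕ} (hb : 1 ≤ b) (hN : N ≤ n) (hL : ∀ j ≤ n, |L j| ≤ Λ)
    (hL' : ∀ j ≤ n, |L' j| ≤ Λ)
    (hM : ∀ m ≤ n, |∑ i ∈ Finset.range (m + 1), L i - ∑ i ∈ Finset.range (m + 1), L' i| ≤ M) :
    |smoothPart k c X L N z - smoothPart k c X L' N z|
      ≤ 2 * Λ * (maxVisits X n * ∑ i ∈ Finset.range (n + 1), A (X (b * (i / b)) - X i))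
        + (n / b + 1 : ℕ) * (2 * M * (maxVisits X n * K)) + |c| * M := by
  have hΛ : 0 ≤ Λ := (abs_nonneg _).trans (hL 0 (Nat.zero_le n))
  have hM0 : 0 ≤ M := (abs_nonneg _).trans (hM 0 (Nat.zero_le n))
  have hV := maxVisits_nonneg X n
  set D : ℕ → ℝ := fun i => L i - L' i with hDdef
  have hDb : ∀ j ≤ n, |D j| ≤ 2 * Λ := fun j hj =>
    (abs_sub _ _).trans (by linarith [hL j hj, hL' j hj])
  have hDs : ∀ m ≤ n + 1, |∑ i ∈ Finset.range m, D i| ≤ M := by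
    intro m hm
    rcases Nat.eq_zero_or_pos m with rfl | hm0
    · simpa using hM0
    · obtain ⟨m', rfl⟩ : ∃ m', m = m' + 1 := ⟨m - 1, by omega⟩
      have := hM m' (by omega)
      rwa [← Finset.sum_sub_distrib] at this
  -- `X_i` is replaced by the position at the start of its block. The replacement error sees only
  -- displacements inside blocks. In the second sum the kernel is constant on blocks, so only block
  -- sums of `D` enter, at most `2M` for each of the `n/b + 1` blocks.
  have e : smoothPart k c X L N z - smoothPart k c X L' N z
      = (∑ j ∈ Finset.range (N + 1), ∑ i ∈ Finset.range j,
          D i * (k (X j - X i - z) - k (X j - X (b * (i / b)) - z)))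
        + (∑ j ∈ Finset.range (N + 1), ∑ i ∈ Finset.range j, D i * k (X j - X (b * (i / b)) - z))
        + c * ∑ j ∈ Finset.range (N + 1), D j := by
    unfold smoothPart
    simp only [hDdef, mul_sub, sub_mul, Finset.sum_sub_distrib]
    ring
  have h1 : |∑ j ∈ Finset.range (N + 1), ∑ i ∈ Finset.range j,
      D i * (k (X j - X i - z) - k (X j - X (b * (i / b)) - z))|
      ≤ 2 * Λ * (maxVisits X n * ∑ i ∈ Finset.range (n + 1), A (X (b * (i / b)) - X i)) := by
    calc _ ≤ ∑ j ∈ Finset.range (n + 1), ∑ i ∈ Finset.range (n + 1),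
          2 * Λ * |k (X j - X i - z) - k (X j - X (b * (i / b)) - z)| := by
          refine (Finset.abs_sum_le_sum_abs _ _).trans ?_
          refine (Finset.sum_le_sum fun j hj => ?_).trans
            (Finset.sum_le_sum_of_subset_of_nonneg (Finset.range_subset_range.2 (by omega))
              fun j _ _ => Finset.sum_nonneg fun i _ => by positivity)
          rw [Finset.mem_range] at hj
          refine (Finset.abs_sum_le_sum_abs _ _).trans ?_
          refine (Finset.sum_le_sum fun i hi => ?_).trans
            (Finset.sum_le_sum_of_subset_of_nonneg (Finset.range_subset_range.2 (by omega))
              fun i _ _ => by positivity)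
          rw [Finset.mem_range] at hi
          rw [abs_mul]
          exact mul_le_mul_of_nonneg_right (hDb i (by omega)) (abs_nonneg _)
      _ = ∑ i ∈ Finset.range (n + 1), 2 * Λ * ∑ j ∈ Finset.range (n + 1),
          |k (X j - X i - z) - k (X j - X (b * (i / b)) - z)| := by
          rw [Finset.sum_comm]
          simp only [Finset.mul_sum]
      _ ≤ ∑ i ∈ Finset.range (n + 1), 2 * Λ * (maxVisits X n * A (X (b * (i / b)) - X i)) := by
          refine Finset.sum_le_sum fun i _ => mul_le_mul_of_nonneg_left ?_ (by positivity)
          have := sum_path_subset_le X (n := n) (S := Finset.range (n + 1)) (hA (X (b * (i / b)) - X i)) (Finset.Subset.refl _)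
            ((Equiv.subRight (X (b * (i / b)))).trans (Equiv.subRight z))
          refine le_trans (le_of_eq (Finset.sum_congr rfl fun j _ => ?_)) this
          simp only [Equiv.trans_apply, Equiv.subRight_apply]
          rw [show X j - X (b * (i / b)) - z + (X (b * (i / b)) - X i) = X j - X i - z by abel]
      _ = _ := by simp only [Finset.mul_sum]
  have h2 : |∑ j ∈ Finset.range (N + 1), ∑ i ∈ Finset.range j, D i * k (X j - X (b * (i / b)) - z)|
      ≤ (n / b + 1 : ℕ) * (2 * M * (maxVisits X n * K)) := by
    have hfib : ∀ j ∈ Finset.range (N + 1),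
        ∑ i ∈ Finset.range j, D i * k (X j - X (b * (i / b)) - z)
        = ∑ t ∈ Finset.range (n / b + 1), (∑ i ∈ (Finset.range j).filter (fun i => i / b = t), D i)
          * k (X j - X (b * t) - z) := by
      intro j hj
      rw [Finset.mem_range] at hj
      rw [← Finset.sum_fiberwise_of_maps_to (s := Finset.range j) (t := Finset.range (n / b + 1))
        (g := fun i => i / b)]
      · refine Finset.sum_congr rfl fun t _ => ?_
        rw [Finset.sum_mul]
        refine Finset.sum_congr rfl fun i hi => ?_
        rw [(Finset.mem_filter.1 hi).2]
      · intro i hi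
        rw [Finset.mem_range] at hi
        exact Finset.mem_range.2 (Nat.lt_succ_of_le (Nat.div_le_div_right (by omega)))
    rw [Finset.sum_congr rfl hfib]
    calc _ ≤ ∑ j ∈ Finset.range (N + 1), ∑ t ∈ Finset.range (n / b + 1),
          2 * M * |k (X j - X (b * t) - z)| := by
          refine (Finset.abs_sum_le_sum_abs _ _).trans (Finset.sum_le_sum fun j hj => ?_)
          refine (Finset.abs_sum_le_sum_abs _ _).trans (Finset.sum_le_sum fun t _ => ?_)
          rw [Finset.mem_range] at hj
          rw [abs_mul]
          exact mul_le_mul_of_nonneg_right (sum_filter_div_le hb hDs (by omega) t) (abs_nonneg _)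
      _ = ∑ t ∈ Finset.range (n / b + 1), 2 * M * ∑ j ∈ Finset.range (N + 1),
          |k (X j - X (b * t) - z)| := by
          rw [Finset.sum_comm]
          simp only [Finset.mul_sum]
      _ ≤ ∑ t ∈ Finset.range (n / b + 1), 2 * M * (maxVisits X n * K) := by
          refine Finset.sum_le_sum fun t _ => mul_le_mul_of_nonneg_left ?_ (by positivity)
          exact sum_path_subset_le X hk (Finset.range_subset_range.2 (by omega))
            ((Equiv.subRight (X (b * t))).trans (Equiv.subRight z))
      _ = _ := by rw [Finset.sum_const, Finset.card_range, nsmul_eq_mul]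
  rw [e]
  refine (abs_add_le _ _).trans (add_le_add ((abs_add_le _ _).trans (add_le_add h1 h2)) ?_)
  rw [abs_mul]
  exact mul_le_mul_of_nonneg_left (hDs (N + 1) (by omega)) (abs_nonneg _)

/-! ### Even moments of martingales -/

lemma abs_add_pow_sub_le (A D : ℝ) (k : ℕ) :
    |(A + D) ^ (k + 2) - A ^ (k + 2) - (k + 2) * A ^ (k + 1) * D|
      ≤ (k + 2) ^ 2 * (D ^ 2 * (|A| + |D|) ^ k) := by
  induction k with
  | zero =>
    simp only [Nat.cast_zero, zero_add, pow_zero, mul_one, pow_one]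
    rw [show (A + D) ^ 2 - A ^ 2 - 2 * A * D = D ^ 2 by ring, abs_of_nonneg (sq_nonneg D)]
    nlinarith [sq_nonneg D]
  | succ k ih =>
    have e : (A + D) ^ (k + 1 + 2) - A ^ (k + 1 + 2) - ((k + 1 : ℕ) + 2) * A ^ (k + 1 + 1) * D
        = (A + D) * ((A + D) ^ (k + 2) - A ^ (k + 2) - (k + 2) * A ^ (k + 1) * D)
          + (k + 2) * D ^ 2 * A ^ (k + 1) := by
      push_cast; ring
    rw [e]
    have hs : |A + D| ≤ |A| + |D| := abs_add_le _ _
    have h0 : 0 ≤ |A| + |D| := by positivity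
    have hA : |A| ≤ |A| + |D| := by linarith [abs_nonneg D]
    have h1 : |(A + D) * ((A + D) ^ (k + 2) - A ^ (k + 2) - (k + 2) * A ^ (k + 1) * D)|
        ≤ (|A| + |D|) * ((k + 2) ^ 2 * (D ^ 2 * (|A| + |D|) ^ k)) := by
      rw [abs_mul]
      exact mul_le_mul hs ih (abs_nonneg _) h0
    have h2 : |((k : ℝ) + 2) * D ^ 2 * A ^ (k + 1)| ≤ (k + 2) * D ^ 2 * (|A| + |D|) ^ (k + 1) := by
      rw [abs_mul, abs_of_nonneg (show 0 ≤ ((k : ℝ) + 2) * D ^ 2 by positivity), abs_pow]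
      gcongr
    refine (abs_add_le _ _).trans ((add_le_add h1 h2).trans ?_)
    have h3 : 0 ≤ D ^ 2 * (|A| + |D|) ^ (k + 1) := by positivity
    have e2 : (|A| + |D|) * (((k : ℝ) + 2) ^ 2 * (D ^ 2 * (|A| + |D|) ^ k))
        + (k + 2) * D ^ 2 * (|A| + |D|) ^ (k + 1)
        = ((k + 2) ^ 2 + (k + 2)) * (D ^ 2 * (|A| + |D|) ^ (k + 1)) := by ring
    rw [e2]
    refine mul_le_mul_of_nonneg_right ?_ h3
    push_cast
    have : (0 : ℝ) ≤ k := Nat.cast_nonneg k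
    nlinarith

/-- The linear Taylor term is kept exact, because it integrates to zero for a centered increment
`D`. -/
lemma add_pow_even_le (A D : ℝ) (k : ℕ) :
    (A + D) ^ (2 * (k + 1)) ≤ A ^ (2 * (k + 1)) + (2 * k + 2) * A ^ (2 * k + 1) * D
      + (2 * k + 2) ^ 2 * 2 ^ (2 * k) * (D ^ 2 * A ^ (2 * k) + D ^ 2 * D ^ (2 * k)) := by
  have h := (abs_le.1 (abs_add_pow_sub_le A D (2 * k))).2
  have h1 : (|A| + |D|) ^ (2 * k) ≤ 2 ^ (2 * k) * (A ^ (2 * k) + D ^ (2 * k)) := by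
    refine (add_pow_le (abs_nonneg A) (abs_nonneg D) (2 * k)).trans ?_
    rw [(even_two_mul k).pow_abs, (even_two_mul k).pow_abs]
    have : 0 ≤ A ^ (2 * k) + D ^ (2 * k) :=
      add_nonneg ((even_two_mul k).pow_nonneg A) ((even_two_mul k).pow_nonneg D)
    refine mul_le_mul_of_nonneg_right ?_ this
    exact pow_le_pow_right₀ (by norm_num) (Nat.sub_le _ _)
  have h2 : ((2 * k : ℕ) + 2 : ℝ) ^ 2 * (D ^ 2 * (|A| + |D|) ^ (2 * k))
      ≤ ((2 * k : ℕ) + 2 : ℝ) ^ 2 * (D ^ 2 * (2 ^ (2 * k) * (A ^ (2 * k) + D ^ (2 * k)))) := by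
    gcongr
  push_cast at h h2
  rw [show 2 * (k + 1) = 2 * k + 2 by ring]
  linarith

/-- Either `A² ≥ nB` and the first term dominates, or `A² ≤ nB` and the second does. The factor
`1/n` makes the first term harmless over `n` steps of a Gronwall recursion. -/
lemma pow_mul_le_dichotomy {n B : ℝ} (hn : 0 < n) (hB : 0 ≤ B) (A : ℝ) (k : ℕ) :
    B * A ^ (2 * k) ≤ A ^ (2 * (k + 1)) / n + n ^ k * B ^ (k + 1) := by
  have hA2 : 0 ≤ A ^ 2 := sq_nonneg A
  rw [pow_mul, pow_mul]
  generalize A ^ 2 = a at hA2 ⊢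
  rcases le_total (B * n) a with h | h
  · have h1 : B * a ^ k ≤ a ^ (k + 1) / n := by
      rw [le_div_iff₀ hn, pow_succ]
      nlinarith [pow_nonneg hA2 k]
    have : 0 ≤ n ^ k * B ^ (k + 1) := by positivity
    linarith
  · have h1 : B * a ^ k ≤ n ^ k * B ^ (k + 1) := by
      calc B * a ^ k ≤ B * (B * n) ^ k := by gcongr
        _ = _ := by rw [mul_pow]; ring
    have : 0 ≤ a ^ (k + 1) / n := by positivity
    linarith

lemma gronwall_le {a : ℕ → ℝ} {c β : ℝ} {n : ℕ} (hn : 1 ≤ n) (hc : 0 ≤ c) (hβ : 0 ≤ β)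
    (h0 : a 0 = 0) (h : ∀ j < n, a (j + 1) ≤ (1 + c / n) * a j + β) {N : ℕ} (hN : N ≤ n) :
    a N ≤ n * Real.exp c * β := by
  have hn0 : (0 : ℝ) < n := by exact_mod_cast hn
  have h1 : (1 : ℝ) ≤ 1 + c / n := by linarith [div_nonneg hc hn0.le]
  have key : ∀ N ≤ n, a N ≤ N * (1 + c / n) ^ N * β := by
    intro N
    induction N with
    | zero => intro _; simp [h0]
    | succ N ih =>
      intro hN
      have e1 := mul_le_mul_of_nonneg_left (ih (by omega)) (by linarith : (0 : ℝ) ≤ 1 + c / n)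
      have e2 : β ≤ (1 + c / n) ^ (N + 1) * β := le_mul_of_one_le_left hβ (one_le_pow₀ h1)
      refine (h N (by omega)).trans ?_
      push_cast
      calc _ ≤ (1 + c / n) * (N * (1 + c / n) ^ N * β) + (1 + c / n) ^ (N + 1) * β := by linarith
        _ = _ := by ring
  refine (key N hN).trans ?_
  have h2 : (1 + c / n) ^ N ≤ Real.exp c := by
    calc (1 + c / n) ^ N ≤ (1 + c / n) ^ n := pow_le_pow_right₀ h1 hN
      _ ≤ Real.exp (c / n) ^ n := by
        gcongr
        rw [add_comm]; exact Real.add_one_le_exp _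
      _ = Real.exp c := by rw [← Real.exp_nat_mul]; congr 1; field_simp
  have h3 : (N : ℝ) ≤ n := by exact_mod_cast hN
  gcongr

namespace IsPlanarStep

variable {P : Measure Ω} [IsProbabilityMeasure P] {ξ : ℕ → Ω → Lattice}

lemma integrable_comp_step (hS : IsPlanarStep P ξ) (f : Lattice → ℝ) {K : ℝ} (hK : ∀ s, |f s| ≤ K) :
    Integrable (fun ω => f (ξ 0 ω)) P :=
  integrable_of_bdd ((measurable_of_countable f).comp (hS.meas 0)) fun ω => hK _

lemma integral_add_pow_even_le (hS : IsPlanarStep P ξ) {F : Lattice → ℝ} {T lm : ℝ} (hT : 0 ≤ T)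
    {n : ℕ} (hTn : T ≤ n) (hn : 1 ≤ n) (hlm : 0 ≤ lm) (hF : ∀ s, |F s| ≤ T * lm)
    (hF0 : ∫ ω, F (ξ 0 ω) ∂P = 0) (hF2 : ∫ ω, F (ξ 0 ω) ^ 2 ∂P ≤ T * lm ^ 2) (A : ℝ) (k : ℕ) :
    ∫ ω, (A + F (ξ 0 ω)) ^ (2 * (k + 1)) ∂P
      ≤ (1 + ((2 * k + 2) ^ 2 * 2 ^ (2 * k) : ℝ) / n) * A ^ (2 * (k + 1))
        + 2 * ((2 * k + 2) ^ 2 * 2 ^ (2 * k)) * n ^ k * T ^ (k + 1) * lm ^ (2 * (k + 1)) := by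
  have hn0 : (0 : ℝ) < n := by exact_mod_cast hn
  set c : ℝ := (2 * k + 2) ^ 2 * 2 ^ (2 * k) with hc
  have hc0 : 0 ≤ c := by positivity
  have hTl : 0 ≤ T * lm := by positivity
  have hev : ∀ s, F s ^ (2 * k) ≤ (T * lm) ^ (2 * k) := fun s => by
    rw [← (even_two_mul k).pow_abs]
    exact pow_le_pow_left₀ (abs_nonneg _) (hF s) _
  have hi1 : Integrable (fun ω => F (ξ 0 ω)) P := hS.integrable_comp_step F hF
  have hi2 : Integrable (fun ω => F (ξ 0 ω) ^ 2) P :=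
    hS.integrable_comp_step (fun s => F s ^ 2) (K := (T * lm) ^ 2) fun s => by
      rw [abs_pow]; exact pow_le_pow_left₀ (abs_nonneg _) (hF s) _
  have hi3 : Integrable (fun ω => (A + F (ξ 0 ω)) ^ (2 * (k + 1))) P :=
    hS.integrable_comp_step (fun s => (A + F s) ^ (2 * (k + 1)))
      (K := (|A| + T * lm) ^ (2 * (k + 1))) fun s => by
      rw [abs_pow]
      exact pow_le_pow_left₀ (abs_nonneg _) ((abs_add_le _ _).trans (by linarith [hF s])) _
  have hR : 0 ≤ (T * lm) ^ (2 * k) := by positivity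
  have hA : 0 ≤ A ^ (2 * k) := (even_two_mul k).pow_nonneg A
  have h1 : ∫ ω, (A + F (ξ 0 ω)) ^ (2 * (k + 1)) ∂P
      ≤ ∫ ω, (A ^ (2 * (k + 1)) + (2 * k + 2) * A ^ (2 * k + 1) * F (ξ 0 ω)
        + c * (A ^ (2 * k) + (T * lm) ^ (2 * k)) * F (ξ 0 ω) ^ 2) ∂P := by
    refine integral_mono hi3 (((integrable_const _).add (hi1.const_mul _)).add
      (hi2.const_mul _)) fun ω => ?_
    refine (add_pow_even_le A (F (ξ 0 ω)) k).trans ?_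
    rw [← hc]
    have h2 : F (ξ 0 ω) ^ 2 * F (ξ 0 ω) ^ (2 * k) ≤ F (ξ 0 ω) ^ 2 * (T * lm) ^ (2 * k) :=
      mul_le_mul_of_nonneg_left (hev _) (sq_nonneg _)
    have h3 := mul_le_mul_of_nonneg_left h2 hc0
    nlinarith
  have hi4 : Integrable (fun ω => A ^ (2 * (k + 1)) + (2 * k + 2) * A ^ (2 * k + 1) * F (ξ 0 ω)) P :=
    (integrable_const _).add (hi1.const_mul _)
  rw [integral_add hi4 (hi2.const_mul _), integral_add (integrable_const _) (hi1.const_mul _), integral_const, integral_const_mul,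
    integral_const_mul, hF0] at h1
  simp only [probReal_univ, smul_eq_mul, one_mul, mul_zero, add_zero] at h1
  refine h1.trans ?_
  have h4 : c * (A ^ (2 * k) + (T * lm) ^ (2 * k)) * ∫ ω, F (ξ 0 ω) ^ 2 ∂P
      ≤ c * (A ^ (2 * k) + (T * lm) ^ (2 * k)) * (T * lm ^ 2) := by gcongr
  have h5 := pow_mul_le_dichotomy hn0 (show 0 ≤ T * lm ^ 2 by positivity) A k
  -- Here `T ≤ n` is used: the contribution of the largest possible jumps is no worse than that of
  -- the variance.
  have h6 : (T * lm) ^ (2 * k) * (T * lm ^ 2) ≤ n ^ k * T ^ (k + 1) * lm ^ (2 * (k + 1)) := by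
    have : T ^ k ≤ (n : ℝ) ^ k := pow_le_pow_left₀ hT hTn k
    calc (T * lm) ^ (2 * k) * (T * lm ^ 2) = T ^ k * (T ^ (k + 1) * lm ^ (2 * (k + 1))) := by ring
      _ ≤ n ^ k * (T ^ (k + 1) * lm ^ (2 * (k + 1))) := by gcongr
      _ = _ := by ring
  have h7 : (n : ℝ) ^ k * (T * lm ^ 2) ^ (k + 1) = n ^ k * T ^ (k + 1) * lm ^ (2 * (k + 1)) := by
    rw [mul_pow, ← pow_mul]; ring
  rw [h7] at h5
  have h8 := mul_le_mul_of_nonneg_left (add_le_add h5 h6) hc0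
  calc _ ≤ A ^ (2 * (k + 1)) + c * (A ^ (2 * k) + (T * lm) ^ (2 * k)) * (T * lm ^ 2) := by linarith
    _ = A ^ (2 * (k + 1)) + c * (T * lm ^ 2 * A ^ (2 * k) + (T * lm) ^ (2 * k) * (T * lm ^ 2)) := by
      ring
    _ ≤ _ := by
      refine (add_le_add_right h8 _).trans (le_of_eq ?_)
      ring

/-- Even moments of a martingale adapted to the walk whose increments have conditional variance at
most `T lm²` and are at most `T lm`. -/
lemma integral_martingale_pow_le (hS : IsPlanarStep P ξ) {F : ℕ → Ω → Lattice → ℝ} {T : ℝ}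
    (hT : 0 ≤ T) {n : ℕ} (hTn : T ≤ n) (hn : 1 ≤ n) {lm : Ω → ℝ} (hlm : ∀ ω, 0 ≤ lm ω)
    (hlmm : Measurable lm) {K : ℝ} (hK : ∀ ω, lm ω ≤ K)
    (hdep : ∀ j < n, DepOn ξ (Finset.range j) (F j)) (hF : ∀ j < n, ∀ ω s, |F j ω s| ≤ T * lm ω)
    (hF0 : ∀ j < n, ∀ ω, ∫ ω', F j ω (ξ 0 ω') ∂P = 0)
    (hF2 : ∀ j < n, ∀ ω, ∫ ω', F j ω (ξ 0 ω') ^ 2 ∂P ≤ T * lm ω ^ 2) (k : ℕ) {N : ℕ} (hN : N ≤ n) :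
    ∫ ω, (∑ j ∈ Finset.range N, F j ω (ξ j ω)) ^ (2 * (k + 1)) ∂P
      ≤ 2 * ((2 * k + 2) ^ 2 * 2 ^ (2 * k)) * Real.exp ((2 * k + 2) ^ 2 * 2 ^ (2 * k))
        * (n * T) ^ (k + 1) * ∫ ω, lm ω ^ (2 * (k + 1)) ∂P := by
  set c : ℝ := (2 * k + 2) ^ 2 * 2 ^ (2 * k) with hc
  have hc0 : 0 ≤ c := by positivity
  have hn0 : (0 : ℝ) < n := by exact_mod_cast hn
  set M : ℕ → Ω → ℝ := fun N ω => ∑ j ∈ Finset.range N, F j ω (ξ j ω) with hM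
  have hMdep : ∀ N ≤ n, DepOn ξ (Finset.range N) (M N) := by
    intro N hN
    refine DepOn.sum _ fun j hj => ?_
    rw [Finset.mem_range] at hj
    intro ω ω' e
    beta_reduce
    rw [hdep j (by omega) ω ω' fun i hi => e i (Finset.mem_range.2
      ((Finset.mem_range.1 hi).trans hj)), e j (Finset.mem_range.2 hj)]
  have hK0 : 0 ≤ K := by
    obtain ⟨ω⟩ := nonempty_of_isProbabilityMeasure P
    exact (hlm ω).trans (hK ω)
  have hFK : ∀ j < n, ∀ ω s, |F j ω s| ≤ T * K := fun j hj ω s =>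
    (hF j hj ω s).trans (mul_le_mul_of_nonneg_left (hK ω) hT)
  have hMb : ∀ N ≤ n, ∀ ω, |M N ω| ≤ N * (T * K) := by
    intro N hN ω
    refine (Finset.abs_sum_le_sum_abs _ _).trans ?_
    refine (Finset.sum_le_sum fun j hj => hFK j (by rw [Finset.mem_range] at hj; omega) ω _).trans
      (le_of_eq ?_)
    simp
  have hlmi : Integrable (fun ω => lm ω ^ (2 * (k + 1))) P :=
    integrable_of_bdd (hlmm.pow_const _) (K := K ^ (2 * (k + 1))) fun ω => by
      rw [abs_pow, abs_of_nonneg (hlm ω)]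
      exact pow_le_pow_left₀ (hlm ω) (hK ω) _
  set I : ℝ := ∫ ω, lm ω ^ (2 * (k + 1)) ∂P with hI
  have hI0 : 0 ≤ I := integral_nonneg fun ω => pow_nonneg (hlm ω) _
  have hMint : ∀ N ≤ n, Integrable (fun ω => M N ω ^ (2 * (k + 1))) P := fun N hN =>
    integrable_of_bdd ((hS.measurable_depOn (hMdep N hN)).pow_const _)
      (K := (N * (T * K)) ^ (2 * (k + 1))) fun ω => by
      rw [abs_pow]
      exact pow_le_pow_left₀ (abs_nonneg _) (hMb N hN ω) _
  -- The bound `lm` may depend on the whole path. The one-step inequality holds for each fixed `ω`,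
  -- where only the fresh step `ω'` is averaged, and is then integrated over `ω`.
  have hstep : ∀ j < n, ∫ ω, M (j + 1) ω ^ (2 * (k + 1)) ∂P
      ≤ (1 + c / n) * ∫ ω, M j ω ^ (2 * (k + 1)) ∂P + 2 * c * n ^ k * T ^ (k + 1) * I := by
    intro j hj
    have e : ∀ ω, M (j + 1) ω = M j ω + F j ω (ξ j ω) := fun ω => Finset.sum_range_succ _ _
    simp only [e]
    rw [hS.integral_step (j := j) (F := fun ω s => (M j ω + F j ω s) ^ (2 * (k + 1)))
      (K := (n * (T * K) + T * K) ^ (2 * (k + 1)))]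
    · rw [← integral_const_mul, ← integral_const_mul, ← integral_add ((hMint j hj.le).const_mul _)
        (hlmi.const_mul _)]
      refine integral_mono_of_nonneg (Filter.Eventually.of_forall fun ω =>
        integral_nonneg fun ω' => (even_two_mul _).pow_nonneg _)
        (((hMint j hj.le).const_mul _).add (hlmi.const_mul _))
        (Filter.Eventually.of_forall fun ω => ?_)
      exact hS.integral_add_pow_even_le hT hTn hn (hlm ω) (hF j hj ω) (hF0 j hj ω) (hF2 j hj ω) _ k
    · intro ω ω' e'
      simp only [hMdep j hj.le ω ω' e', hdep j hj ω ω' e']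
    · intro ω s
      rw [abs_pow]
      refine pow_le_pow_left₀ (abs_nonneg _) ((abs_add_le _ _).trans ?_) _
      refine add_le_add ((hMb j hj.le ω).trans ?_) (hFK j hj ω s)
      have : (j : ℝ) ≤ n := by exact_mod_cast hj.le
      gcongr
  have h0 : ∫ ω, M 0 ω ^ (2 * (k + 1)) ∂P = 0 := by simp [hM]
  have := gronwall_le (a := fun j => ∫ ω, M j ω ^ (2 * (k + 1)) ∂P) hn hc0 (by positivity) h0
    hstep hN
  refine this.trans (le_of_eq ?_)
  rw [mul_pow, pow_succ (n : ℝ) k]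
  ring

end IsPlanarStep

/-! ### The martingale of the Tanaka formula -/

lemma depOn_chainW (ξ : ℕ → Ω → Lattice) (g : Lattice → ℝ) (l : List Lattice) : ∀ j : ℕ,
    DepOn ξ (Finset.range j) (fun ω => chainW g (fun i => walk ξ i ω) l j) := by
  induction l with
  | nil => intro j; exact depOn_const ξ _ 1
  | cons z l ih =>
    intro j ω ω' e
    have h : ∀ i ≤ j, chainW g (fun i => walk ξ i ω) l i = chainW g (fun i => walk ξ i ω') l i ∧
        walk ξ i ω = walk ξ i ω' := fun i hi =>
      ⟨((ih i).mono (Finset.range_subset_range.2 hi)) ω ω' e, depOn_walk_of_le ξ hi ω ω' e⟩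
    simp only [chainW]
    rw [(h j le_rfl).1]
    congr 1
    refine Finset.sum_congr rfl fun i hi => ?_
    rw [Finset.mem_range] at hi
    simp only [(h i hi.le).1, (h i hi.le).2, (h j le_rfl).2]

lemma depOn_martDiff (ξ : ℕ → Ω → Lattice) (g u v : Lattice → ℝ) (l : List Lattice) (z : Lattice)
    (j : ℕ) : DepOn ξ (Finset.range (j + 1)) (fun ω =>
      martDiff u v (fun i => walk ξ i ω) (chainW g (fun i => walk ξ i ω) l) z j) := by
  intro ω ω' e
  have h : ∀ i ≤ j + 1, chainW g (fun i => walk ξ i ω) l i = chainW g (fun i => walk ξ i ω') l i ∧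
      walk ξ i ω = walk ξ i ω' := fun i hi =>
    ⟨((depOn_chainW ξ g l i).mono (Finset.range_subset_range.2 hi)) ω ω' e,
      depOn_walk_of_le ξ hi ω ω' e⟩
  simp only [martDiff]
  refine Finset.sum_congr rfl fun i hi => ?_
  rw [Finset.mem_range] at hi
  rw [(h i hi.le).1, (h i hi.le).2, (h j (by omega)).2, (h (j + 1) le_rfl).2]

lemma depOn_chainS (ξ : ℕ → Ω → Lattice) (g : Lattice → ℝ) (l : List Lattice) (N : ℕ) :
    DepOn ξ (Finset.range N) (fun ω => chainS g (fun i => walk ξ i ω) l N) := by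
  unfold chainS
  refine DepOn.sum _ fun j hj => (depOn_chainW ξ g l j).mono ?_
  rw [Finset.mem_range] at hj
  exact Finset.range_subset_range.2 (by omega)

lemma abs_chainW_le_lam {ξ : ℕ → Ω → Lattice} {C : ℝ} (hC : 1 ≤ C) {g : Lattice → ℝ}
    {l : List Lattice} {n : ℕ} (hl : ∀ z ∈ l, |g z| ≤ C * (1 + Real.log n)) (ω : Ω) :
    ∀ j ≤ n, |chainW g (fun i => walk ξ i ω) l j| ≤ lam ξ C n ω ^ l.length :=
  abs_chainW_le g _ (mul_nonneg (zero_le_one.trans hC)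
    (by linarith [Real.log_natCast_nonneg n])) l hl

lemma maxVisits_le_lam {ξ : ℕ → Ω → Lattice} {C : ℝ} (hC : 1 ≤ C) (n : ℕ) (ω : Ω) :
    maxVisits (fun i => walk ξ i ω) n ≤ lam ξ C n ω := by
  have := Real.log_natCast_nonneg n
  unfold lam
  nlinarith

lemma log_le_lam {ξ : ℕ → Ω → Lattice} {C : ℝ} (n : ℕ) (ω : Ω) :
    C * (1 + Real.log n) ≤ lam ξ C n ω := by
  unfold lam
  linarith [maxVisits_nonneg (fun i => walk ξ i ω) n]

namespace IsPlanarStep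

variable {P : Measure Ω} [IsProbabilityMeasure P] {ξ : ℕ → Ω → Lattice}

lemma integrable_sz_sq (hS : IsPlanarStep P ξ) : Integrable (fun ω => sz (ξ 0 ω) ^ 2) P := by
  refine (hS.integrable_nsq.const_mul 2).mono'
    (hS.measurable_step (fun y => sz y ^ 2) 0).aestronglyMeasurable
    (Filter.Eventually.of_forall fun ω => ?_)
  rw [Real.norm_of_nonneg (sq_nonneg _)]
  unfold sz nsq
  nlinarith [sq_nonneg (|(ξ 0 ω 0 : ℝ)| - |(ξ 0 ω 1 : ℝ)|), sq_abs (ξ 0 ω 0 : ℝ), sq_abs (ξ 0 ω 1 : ℝ)]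

lemma integral_sz_sq_le (hS : IsPlanarStep P ξ) : ∫ ω, sz (ξ 0 ω) ^ 2 ∂P ≤ 4 := by
  have h : ∫ ω, nsq (ξ 0 ω) ∂P = 2 := by
    unfold nsq
    rw [integral_add (hS.integrable_sq 0) (hS.integrable_sq 1), hS.integral_sq, hS.integral_sq]
    norm_num
  calc ∫ ω, sz (ξ 0 ω) ^ 2 ∂P ≤ ∫ ω, 2 * nsq (ξ 0 ω) ∂P := by
        refine integral_mono hS.integrable_sz_sq (hS.integrable_nsq.const_mul 2) fun ω => ?_
        unfold sz nsq
        nlinarith [sq_nonneg (|(ξ 0 ω 0 : ℝ)| - |(ξ 0 ω 1 : ℝ)|), sq_abs (ξ 0 ω 0 : ℝ),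
          sq_abs (ξ 0 ω 1 : ℝ)]
    _ = 4 := by rw [integral_const_mul, h]; norm_num

/-- A centered function of a step with Lipschitz constant `B` has variance at most `4 B²`. -/
lemma integral_sq_le_of_lipschitz (hS : IsPlanarStep P ξ) {F : Lattice → ℝ} {K B : ℝ}
    (hK : ∀ s, |F s| ≤ K) (h0 : ∫ ω, F (ξ 0 ω) ∂P = 0) (hB : ∀ s, |F s - F 0| ≤ B * sz s) :
    ∫ ω, F (ξ 0 ω) ^ 2 ∂P ≤ 4 * B ^ 2 := by
  have hi1 : Integrable (fun ω => F (ξ 0 ω)) P := hS.integrable_comp_step F hK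
  have hi2 : Integrable (fun ω => F (ξ 0 ω) ^ 2) P :=
    hS.integrable_comp_step (fun s => F s ^ 2) (K := K ^ 2) fun s => by
      rw [abs_pow]; exact pow_le_pow_left₀ (abs_nonneg _) (hK s) _
  have hi3 : Integrable (fun ω => 2 * F 0 * F (ξ 0 ω) + B ^ 2 * sz (ξ 0 ω) ^ 2) P :=
    (hi1.const_mul _).add (hS.integrable_sz_sq.const_mul _)
  calc ∫ ω, F (ξ 0 ω) ^ 2 ∂P ≤ ∫ ω, (2 * F 0 * F (ξ 0 ω) + B ^ 2 * sz (ξ 0 ω) ^ 2) ∂P := by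
        -- Pointwise, `F² ≤ 2 F(0) F + (F - F(0))²`, and the first term has mean zero.
        refine integral_mono hi2 hi3 fun ω => ?_
        have := sq_le_sq' (abs_le.1 (hB (ξ 0 ω))).1 (abs_le.1 (hB (ξ 0 ω))).2
        nlinarith [sq_nonneg (F 0)]
    _ = B ^ 2 * ∫ ω, sz (ξ 0 ω) ^ 2 ∂P := by
        rw [integral_add (hi1.const_mul _) (hS.integrable_sz_sq.const_mul _), integral_const_mul,
          integral_const_mul, h0]
        ring
    _ ≤ B ^ 2 * 4 := mul_le_mul_of_nonneg_left hS.integral_sz_sq_le (sq_nonneg _)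
    _ = _ := by ring

/-- Changing the last step by `s` moves the increment by at most `Λ^{m+2} |s| √T`: `Λ^m` bounds the
weights, and one factor each bounds the visits and `C(1 + log n)`. So the conditional variance is at
most `T (2Λ^{m+2})²`, while the increment is at most `2TΛ^{m+2}`. The general martingale bound then
gives the scale `√(nT)`. -/
lemma exists_integral_mart_pow_le (hS : IsPlanarStep P ξ) {C : ℝ} (hC : KernelBounds P ξ C)
    (m k : ℕ) : ∃ K : ℝ, ∀ (n T N : ℕ) (g : Lattice → ℝ) (l : List Lattice) (z : Lattice), 1 ≤ n →
      1 ≤ T → T ≤ n → N ≤ n → l.length = m → (∀ z ∈ l, |g z| ≤ C * (1 + Real.log n)) →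
      ∫ ω, (∑ j ∈ Finset.range N, martDiff (usum P ξ T) (vsum P ξ T) (fun i => walk ξ i ω)
        (chainW g (fun i => walk ξ i ω) l) z j) ^ (2 * (k + 1)) ∂P
        ≤ K * (n : ℝ) ^ 2 * ((n : ℝ) * T) ^ (k + 1) := by
  obtain ⟨K, hK⟩ := hS.exists_integral_lam_pow_le hC ((m + 2) * (2 * (k + 1)))
  have hC1 := hC.one_le
  refine ⟨2 * ((2 * k + 2) ^ 2 * 2 ^ (2 * k)) * Real.exp ((2 * k + 2) ^ 2 * 2 ^ (2 * k))
    * (2 ^ (2 * (k + 1)) * K), fun n T N g l z hn hT hTn hN hlm hl => ?_⟩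
  set X : Ω → ℕ → Lattice := fun ω i => walk ξ i ω with hX
  set L : Ω → ℕ → ℝ := fun ω => chainW g (X ω) l with hL
  set u := usum P ξ T with hu
  set v := vsum P ξ T with hv
  set Λ : Ω → ℝ := lam ξ C n with hΛ
  have hΛ1 : ∀ ω, 1 ≤ Λ ω := one_le_lam hC1 n
  have hΛ0 : ∀ ω, 0 ≤ Λ ω := fun ω => zero_le_one.trans (hΛ1 ω)
  have hLb : ∀ ω, ∀ j ≤ n, |L ω j| ≤ Λ ω ^ m := fun ω => hlm ▸ abs_chainW_le_lam hC1 hl ω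
  have hVΛ : ∀ ω, maxVisits (X ω) n ≤ Λ ω := maxVisits_le_lam hC1 n
  have hV0 : ∀ ω, 0 ≤ maxVisits (X ω) n := fun ω => maxVisits_nonneg _ _
  have hT1 : (1 : ℝ) ≤ T := by exact_mod_cast hT
  set F : ℕ → Ω → Lattice → ℝ := fun j ω s =>
    ∑ i ∈ Finset.range (j + 1), L ω i * (u (X ω j + s - X ω i - z) - v (X ω j - X ω i - z)) with hF
  have hFD : ∀ j ω, martDiff u v (X ω) (L ω) z j = F j ω (ξ j ω) := fun j ω => by
    simp only [martDiff, hF, hX, walk_succ]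
  have hpow : ∀ ω, Λ ω ^ m * (Λ ω * (T + T)) ≤ T * (2 * Λ ω ^ (m + 2)) := fun ω => by
    have : Λ ω ^ (m + 1) ≤ Λ ω ^ (m + 2) := pow_le_pow_right₀ (hΛ1 ω) (by omega)
    calc Λ ω ^ m * (Λ ω * (T + T)) = 2 * T * Λ ω ^ (m + 1) := by ring
      _ ≤ 2 * T * Λ ω ^ (m + 2) := by gcongr
      _ = _ := by ring
  have hFb : ∀ j < n, ∀ ω s, |F j ω s| ≤ T * (2 * Λ ω ^ (m + 2)) := by
    intro j hj ω s
    have := martStep_abs_le (hS.usum_l1 T) (hS.vsum_l1 T) (X ω) (L ω) hj.le (hLb ω) (X ω j + s) z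
    refine this.trans (le_trans ?_ (hpow ω))
    have := hVΛ ω
    have := hΛ0 ω
    gcongr
  have hF0 : ∀ j < n, ∀ ω, ∫ ω', F j ω (ξ 0 ω') ∂P = 0 := by
    intro j hj ω
    have hi : ∀ y, Integrable (fun ω' => u (y + ξ 0 ω')) P := fun y =>
      hS.integrable_comp_step (fun s => u (y + s)) (K := T) fun s => by
        rw [abs_of_nonneg (usum_nonneg _ _)]; exact usum_le _ _
    simp only [hF]
    have e : ∀ i s, X ω j + s - X ω i - z = X ω j - X ω i - z + s := fun i s => by abel
    simp only [e]
    have hi' : ∀ c y w, Integrable (fun ω' => c * (u (y + ξ 0 ω') - w)) P := fun c y w =>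
      ((hi y).sub (integrable_const w)).const_mul c
    rw [integral_finsetSum _ fun i _ => hi' _ _ _]
    refine Finset.sum_eq_zero fun i _ => ?_
    rw [integral_const_mul, integral_sub (hi _) (integrable_const _), hS.integral_usum_add_step,
      integral_const]
    simp [hv]
  have hF2 : ∀ j < n, ∀ ω, ∫ ω', F j ω (ξ 0 ω') ^ 2 ∂P ≤ T * (2 * Λ ω ^ (m + 2)) ^ 2 := by
    intro j hj ω
    have h := hS.integral_sq_le_of_lipschitz (F := F j ω) (K := T * (2 * Λ ω ^ (m + 2)))
      (B := Λ ω ^ (m + 2) * Real.sqrt T) (hFb j hj ω) (hF0 j hj ω) fun s => ?_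
    · refine h.trans (le_of_eq ?_)
      rw [mul_pow, Real.sq_sqrt (by positivity)]
      ring
    · have h1 := martStep_le (hC.diff_usum n T s hT hTn) (X ω) (L ω) hj.le (hLb ω) z
      have e : F j ω s - F j ω 0 = ∑ i ∈ Finset.range (j + 1), L ω i * u (X ω j + s - X ω i - z)
          - ∑ i ∈ Finset.range (j + 1), L ω i * u (X ω j - X ω i - z) := by
        simp only [hF, mul_sub, Finset.sum_sub_distrib, add_zero]
        ring
      rw [e]
      refine h1.trans ?_
      have h2 : C * (1 + Real.log n) ≤ Λ ω := log_le_lam n ω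
      have h3 := hVΛ ω
      have h4 := hΛ0 ω
      have h5 := hV0 ω
      have h6 : 0 ≤ 1 + Real.log n := by linarith [Real.log_natCast_nonneg n]
      have h7 := sz_nonneg s
      calc Λ ω ^ m * (maxVisits (X ω) n * (C * sz s * (1 + Real.log n) * Real.sqrt T))
          = Λ ω ^ m * (maxVisits (X ω) n * (C * (1 + Real.log n) * (sz s * Real.sqrt T))) := by ring
        _ ≤ Λ ω ^ m * (Λ ω * (Λ ω * (sz s * Real.sqrt T))) := by gcongr
        _ = _ := by ring
  have hdep : ∀ j < n, DepOn ξ (Finset.range j) (F j) := by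
    intro j hj ω ω' e
    have h : ∀ i ≤ j, L ω i = L ω' i ∧ X ω i = X ω' i := fun i hi =>
      ⟨((depOn_chainW ξ g l i).mono (Finset.range_subset_range.2 hi)) ω ω' e,
        depOn_walk_of_le ξ hi ω ω' e⟩
    funext s
    simp only [hF]
    refine Finset.sum_congr rfl fun i hi => ?_
    rw [Finset.mem_range] at hi
    rw [(h i (by omega)).1, (h i (by omega)).2, (h j le_rfl).2]
  have hΛm : Measurable Λ := hS.measurable_depOn (depOn_lam ξ C n)
  have main := hS.integral_martingale_pow_le (F := F) (T := T) (by positivity) (n := n)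
    (by exact_mod_cast hTn) hn (lm := fun ω => 2 * Λ ω ^ (m + 2))
    (fun ω => by have := hΛ0 ω; positivity) ((hΛm.pow_const _).const_mul _)
    (K := 2 * (n + 1 + C * (1 + Real.log n)) ^ (m + 2)) (fun ω => by
      have h0 := hΛ0 ω
      have := lam_le (ξ := ξ) hC1 n ω
      gcongr) hdep hFb hF0 hF2 k hN
  change ∫ ω, (∑ j ∈ Finset.range N, martDiff u v (X ω) (L ω) z j) ^ (2 * (k + 1)) ∂P ≤ _
  simp only [hFD]
  refine main.trans ?_
  have e : ∫ ω, (2 * Λ ω ^ (m + 2)) ^ (2 * (k + 1)) ∂P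
      = 2 ^ (2 * (k + 1)) * ∫ ω, Λ ω ^ ((m + 2) * (2 * (k + 1))) ∂P := by
    rw [← integral_const_mul]
    refine integral_congr_ae (Filter.Eventually.of_forall fun ω => ?_)
    simp only [mul_pow, ← pow_mul]
  rw [e]
  have hk := hK n hn
  calc _ ≤ 2 * ((2 * k + 2) ^ 2 * 2 ^ (2 * k)) * Real.exp ((2 * k + 2) ^ 2 * 2 ^ (2 * k))
        * ((n : ℝ) * T) ^ (k + 1) * (2 ^ (2 * (k + 1)) * (K * (n : ℝ) ^ 2)) := by gcongr
    _ = _ := by ring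

end IsPlanarStep

/-! ### Uniform moment calculus -/

/-- All moments of `f i / b i` are `O(n i)`, uniformly in the parameter `i`. -/
structure MomO (P : Measure Ω) {ι : Type*} (n : ι → ℕ) (f : ι → Ω → ℝ) (b : ι → ℝ) : Prop where
  meas : ∀ i, Measurable (f i)
  pos : ∀ i, 0 < b i
  bound : ∀ p : ℕ, ∃ K : ℝ, 0 ≤ K ∧ ∀ i,
    ∫⁻ ω, ENNReal.ofReal ((|f i ω| / b i) ^ p) ∂P ≤ ENNReal.ofReal (K * n i)

namespace MomO

variable {P : Measure Ω} [IsProbabilityMeasure P] {ι κ : Type*} {n : ι → ℕ} {f g : ι → Ω → ℝ}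
  {b b' : ι → ℝ}

lemma dom (h : MomO P n f b) (hg : ∀ i, Measurable (g i)) (hgf : ∀ i ω, |g i ω| ≤ |f i ω|) :
    MomO P n g b := by
  refine ⟨hg, h.pos, fun p => ?_⟩
  obtain ⟨K, hK, hb⟩ := h.bound p
  refine ⟨K, hK, fun i => le_trans (lintegral_mono fun ω => ?_) (hb i)⟩
  have := (h.pos i).le
  have := hgf i ω
  gcongr

lemma smul (h : MomO P n f b) (s : ι → ℝ) (hb' : ∀ i, 0 < b' i) (D : ℝ)
    (hs : ∀ i, |s i| * b i ≤ D * b' i) : MomO P n (fun i ω => s i * f i ω) b' := by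
  refine ⟨fun i => (h.meas i).const_mul _, hb', fun p => ?_⟩
  obtain ⟨K, hK, hb⟩ := h.bound p
  refine ⟨|D| ^ p * K, by positivity, fun i => ?_⟩
  have hbi := h.pos i
  have hbi' := hb' i
  calc ∫⁻ ω, ENNReal.ofReal ((|s i * f i ω| / b' i) ^ p) ∂P
      ≤ ∫⁻ ω, ENNReal.ofReal (|D| ^ p) * ENNReal.ofReal ((|f i ω| / b i) ^ p) ∂P := by
        refine lintegral_mono fun ω => ?_
        rw [← ENNReal.ofReal_mul (by positivity), ← mul_pow]
        refine ENNReal.ofReal_le_ofReal (pow_le_pow_left₀ (by positivity) ?_ p)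
        rw [abs_mul, mul_div_assoc', div_le_div_iff₀ hbi' hbi]
        have h1 := (hs i).trans (mul_le_mul_of_nonneg_right (le_abs_self D) hbi'.le)
        nlinarith [mul_le_mul_of_nonneg_left h1 (abs_nonneg (f i ω))]
    _ = ENNReal.ofReal (|D| ^ p) * ∫⁻ ω, ENNReal.ofReal ((|f i ω| / b i) ^ p) ∂P :=
        lintegral_const_mul' _ _ ENNReal.ofReal_ne_top
    _ ≤ ENNReal.ofReal (|D| ^ p) * ENNReal.ofReal (K * n i) := by gcongr; exact hb i
    _ = _ := by rw [← ENNReal.ofReal_mul (by positivity), mul_assoc]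

lemma mono (h : MomO P n f b) (hb' : ∀ i, 0 < b' i) (D : ℝ) (hs : ∀ i, b i ≤ D * b' i) :
    MomO P n f b' := by
  have := h.smul (fun _ => 1) hb' D (by simpa using hs)
  simpa using this

lemma add (h : MomO P n f b) (h' : MomO P n g b) : MomO P n (fun i ω => f i ω + g i ω) b := by
  refine ⟨fun i => (h.meas i).add (h'.meas i), h.pos, fun p => ?_⟩
  obtain ⟨K, hK, hb⟩ := h.bound p
  obtain ⟨K', hK', hb'⟩ := h'.bound p
  refine ⟨2 ^ p * (K + K'), by positivity, fun i => ?_⟩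
  have hbi := h.pos i
  have hm : Measurable fun ω => ENNReal.ofReal ((|f i ω| / b i) ^ p) :=
    ((((h.meas i).abs).div_const _).pow_const p).ennreal_ofReal
  calc ∫⁻ ω, ENNReal.ofReal ((|f i ω + g i ω| / b i) ^ p) ∂P
      ≤ ∫⁻ ω, ENNReal.ofReal (2 ^ p) * (ENNReal.ofReal ((|f i ω| / b i) ^ p)
        + ENNReal.ofReal ((|g i ω| / b i) ^ p)) ∂P := by
        refine lintegral_mono fun ω => ?_
        rw [← ENNReal.ofReal_add (by positivity) (by positivity),
          ← ENNReal.ofReal_mul (by positivity)]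
        refine ENNReal.ofReal_le_ofReal ?_
        have h1 : |f i ω + g i ω| / b i ≤ |f i ω| / b i + |g i ω| / b i := by
          rw [← add_div]
          gcongr
          exact abs_add_le _ _
        refine (pow_le_pow_left₀ (by positivity) h1 p).trans
          ((add_pow_le (by positivity) (by positivity) p).trans ?_)
        refine mul_le_mul_of_nonneg_right ?_ (by positivity)
        exact pow_le_pow_right₀ (by norm_num) (Nat.sub_le _ _)
    _ = ENNReal.ofReal (2 ^ p) * (∫⁻ ω, ENNReal.ofReal ((|f i ω| / b i) ^ p) ∂P
        + ∫⁻ ω, ENNReal.ofReal ((|g i ω| / b i) ^ p) ∂P) := by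
        rw [lintegral_const_mul' _ _ ENNReal.ofReal_ne_top, lintegral_add_left hm]
    _ ≤ ENNReal.ofReal (2 ^ p) * (ENNReal.ofReal (K * n i) + ENNReal.ofReal (K' * n i)) := by
        gcongr
        · exact hb i
        · exact hb' i
    _ = _ := by
        rw [← ENNReal.ofReal_add (by positivity) (by positivity),
          ← ENNReal.ofReal_mul (by positivity)]
        congr 1
        ring

lemma neg (h : MomO P n f b) : MomO P n (fun i ω => -f i ω) b :=
  h.dom (fun i => (h.meas i).neg) fun i ω => by rw [abs_neg]

lemma sub (h : MomO P n f b) (h' : MomO P n g b) : MomO P n (fun i ω => f i ω - g i ω) b := by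
  simpa only [sub_eq_add_neg] using h.add h'.neg

lemma pow (h : MomO P n f b) (k : ℕ) : MomO P n (fun i ω => f i ω ^ k) (fun i => b i ^ k) := by
  refine ⟨fun i => (h.meas i).pow_const k, fun i => pow_pos (h.pos i) k, fun p => ?_⟩
  obtain ⟨K, hK, hb⟩ := h.bound (k * p)
  refine ⟨K, hK, fun i => ?_⟩
  simpa only [abs_pow, ← div_pow, ← pow_mul] using hb i

lemma mul (h : MomO P n f b) (h' : MomO P n g b') :
    MomO P n (fun i ω => f i ω * g i ω) (fun i => b i * b' i) := by
  refine ⟨fun i => (h.meas i).mul (h'.meas i), fun i => mul_pos (h.pos i) (h'.pos i), fun p => ?_⟩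
  obtain ⟨K, hK, hb⟩ := h.bound (2 * p)
  obtain ⟨K', hK', hb'⟩ := h'.bound (2 * p)
  refine ⟨K + K', by positivity, fun i => ?_⟩
  have hbi := h.pos i
  have hbi' := h'.pos i
  have hm : Measurable fun ω => ENNReal.ofReal ((|f i ω| / b i) ^ (2 * p)) :=
    ((((h.meas i).abs).div_const _).pow_const _).ennreal_ofReal
  calc ∫⁻ ω, ENNReal.ofReal ((|f i ω * g i ω| / (b i * b' i)) ^ p) ∂P
      ≤ ∫⁻ ω, (ENNReal.ofReal ((|f i ω| / b i) ^ (2 * p))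
        + ENNReal.ofReal ((|g i ω| / b' i) ^ (2 * p))) ∂P := by
        refine lintegral_mono fun ω => ?_
        rw [← ENNReal.ofReal_add (by positivity) (by positivity)]
        refine ENNReal.ofReal_le_ofReal ?_
        rw [abs_mul, mul_div_mul_comm, mul_pow, mul_comm 2 p, pow_mul, pow_mul]
        nlinarith [sq_nonneg ((|f i ω| / b i) ^ p - (|g i ω| / b' i) ^ p),
          sq_nonneg ((|f i ω| / b i) ^ p), sq_nonneg ((|g i ω| / b' i) ^ p)]
    _ = ∫⁻ ω, ENNReal.ofReal ((|f i ω| / b i) ^ (2 * p)) ∂P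
        + ∫⁻ ω, ENNReal.ofReal ((|g i ω| / b' i) ^ (2 * p)) ∂P := lintegral_add_left hm _
    _ ≤ ENNReal.ofReal (K * n i) + ENNReal.ofReal (K' * n i) := add_le_add (hb i) (hb' i)
    _ = _ := by
        rw [← ENNReal.ofReal_add (by positivity) (by positivity)]
        congr 1
        ring

lemma comp (h : MomO P n f b) (φ : κ → ι) :
    MomO P (fun i => n (φ i)) (fun i => f (φ i)) (fun i => b (φ i)) :=
  ⟨fun i => h.meas _, fun i => h.pos _, fun p => by
    obtain ⟨K, hK, hb⟩ := h.bound p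
    exact ⟨K, hK, fun i => hb _⟩⟩

lemma zero (hb : ∀ i, 0 < b i) (hn : ∀ i, 1 ≤ n i) : MomO P n (fun _ _ => 0) b :=
  ⟨fun _ => measurable_const, hb, fun p => ⟨1, zero_le_one, fun i => by
    have h1 : (1 : ℝ) ≤ n i := by exact_mod_cast hn i
    simp only [abs_zero, zero_div, lintegral_const, measure_univ, mul_one, one_mul]
    refine ENNReal.ofReal_le_ofReal (le_trans ?_ h1)
    exact pow_le_one₀ le_rfl zero_le_one⟩⟩

/-- A polynomial loss in `n` is reduced to a linear one by raising the exponent. -/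
lemma of_sq (hn : ∀ i, 1 ≤ n i) (hf : ∀ i, Measurable (f i)) (hb : ∀ i, 0 < b i)
    (h : ∀ p : ℕ, ∃ K : ℝ, 0 ≤ K ∧ ∀ i,
      ∫⁻ ω, ENNReal.ofReal ((|f i ω| / b i) ^ (2 * p)) ∂P ≤ ENNReal.ofReal (K * (n i : ℝ) ^ 2)) :
    MomO P n f b := by
  refine ⟨hf, hb, fun p => ?_⟩
  obtain ⟨K, hK, hKb⟩ := h p
  refine ⟨1 + K, by positivity, fun i => ?_⟩
  have hn0 : (0 : ℝ) < n i := by exact_mod_cast hn i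
  have hbi := hb i
  calc ∫⁻ ω, ENNReal.ofReal ((|f i ω| / b i) ^ p) ∂P
      ≤ ∫⁻ ω, (ENNReal.ofReal (n i)
        + ENNReal.ofReal ((n i : ℝ)⁻¹) * ENNReal.ofReal ((|f i ω| / b i) ^ (2 * p))) ∂P := by
        refine lintegral_mono fun ω => ?_
        rw [← ENNReal.ofReal_mul (by positivity),
          ← ENNReal.ofReal_add (by positivity) (by positivity)]
        refine ENNReal.ofReal_le_ofReal ?_
        rw [mul_comm 2 p, pow_mul]
        have h0 : 0 ≤ (|f i ω| / b i) ^ p := by positivity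
        generalize (|f i ω| / b i) ^ p = x at h0
        -- The inequality is `x ≤ n + x² / n`.
        rcases le_total x (n i) with h1 | h1
        · have : 0 ≤ (n i : ℝ)⁻¹ * x ^ 2 := by positivity
          linarith
        · have : x ≤ (n i : ℝ)⁻¹ * x ^ 2 := by
            rw [inv_mul_eq_div, le_div_iff₀ hn0]
            nlinarith
          linarith
    _ = ENNReal.ofReal (n i)
        + ENNReal.ofReal ((n i : ℝ)⁻¹) * ∫⁻ ω, ENNReal.ofReal ((|f i ω| / b i) ^ (2 * p)) ∂P := by
        rw [lintegral_add_left measurable_const, lintegral_const_mul' _ _ ENNReal.ofReal_ne_top]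
        simp
    _ ≤ ENNReal.ofReal (n i) + ENNReal.ofReal ((n i : ℝ)⁻¹) * ENNReal.ofReal (K * (n i : ℝ) ^ 2) := by
        gcongr
        exact hKb i
    _ = _ := by
        rw [← ENNReal.ofReal_mul (by positivity),
          ← ENNReal.ofReal_add (by positivity) (by positivity)]
        congr 1
        field_simp

/-- The maximum over at most `n + 1` indices. -/
lemma sup (hn : ∀ i, 1 ≤ n i) {F : (Σ i, Fin (n i + 1)) → Ω → ℝ}
    (h : MomO P (fun x : Σ i, Fin (n i + 1) => n x.1) F (fun x => b x.1)) (hb : ∀ i, 0 < b i) :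
    MomO P n (fun i ω => Finset.univ.sup' Finset.univ_nonempty fun N => |F ⟨i, N⟩ ω|) b := by
  refine of_sq hn (fun i => ?_) hb fun p => ?_
  · have := Finset.measurable_sup' (s := (Finset.univ : Finset (Fin (n i + 1))))
      Finset.univ_nonempty (f := fun N ω => |F ⟨i, N⟩ ω|) fun N _ => (h.meas ⟨i, N⟩).abs
    convert! this using 1
    ext ω
    simp only [Finset.sup'_apply]
  -- The sum over `n + 1` indices turns the loss `n` into `n²`; exponent `2p` is used so that
  -- `of_sq` restores a linear loss at exponent `p`.
  obtain ⟨K, hK, hKb⟩ := h.bound (2 * p)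
  refine ⟨2 * K, by positivity, fun i => ?_⟩
  have hn1 : (1 : ℝ) ≤ n i := by exact_mod_cast hn i
  have hbi := hb i
  calc ∫⁻ ω, ENNReal.ofReal
        ((|(Finset.univ.sup' Finset.univ_nonempty fun N => |F ⟨i, N⟩ ω|)| / b i) ^ (2 * p)) ∂P
      ≤ ∫⁻ ω, ∑ N : Fin (n i + 1), ENNReal.ofReal ((|F ⟨i, N⟩ ω| / b i) ^ (2 * p)) ∂P := by
        refine lintegral_mono fun ω => ?_
        obtain ⟨N, hN, he⟩ := Finset.exists_mem_eq_sup' (s := (Finset.univ : Finset (Fin (n i + 1))))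
          Finset.univ_nonempty (fun N => |F ⟨i, N⟩ ω|)
        rw [he, abs_abs]
        exact Finset.single_le_sum
          (f := fun N => ENNReal.ofReal ((|F ⟨i, N⟩ ω| / b i) ^ (2 * p)))
          (fun _ _ => zero_le) hN
    _ = ∑ N : Fin (n i + 1), ∫⁻ ω, ENNReal.ofReal ((|F ⟨i, N⟩ ω| / b i) ^ (2 * p)) ∂P :=
        lintegral_finsetSum _ fun N _ =>
          ((((h.meas ⟨i, N⟩).abs).div_const _).pow_const _).ennreal_ofReal
    _ ≤ ∑ N : Fin (n i + 1), ENNReal.ofReal (K * n i) := Finset.sum_le_sum fun N _ => hKb ⟨i, N⟩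
    _ = ENNReal.ofReal ((n i + 1) * (K * n i)) := by
        rw [Finset.sum_const, Finset.card_univ, Fintype.card_fin, nsmul_eq_mul, ← Nat.cast_add_one,
          ENNReal.ofReal_mul (Nat.cast_nonneg (n i + 1)), ENNReal.ofReal_natCast]
    _ ≤ _ := by
        refine ENNReal.ofReal_le_ofReal ?_
        have : 0 ≤ K * n i := by positivity
        nlinarith

/-- The bound `M` may depend on `i`: it only ensures that the Bochner integrals are genuine, and
does not enter the estimate. -/
lemma of_integral (hn : ∀ i, 1 ≤ n i) (hf : ∀ i, Measurable (f i)) (hb : ∀ i, 0 < b i)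
    (hint : ∀ i, ∃ M, ∀ ω, |f i ω| ≤ M)
    (h : ∀ p : ℕ, ∃ K : ℝ, ∀ i, ∫ ω, |f i ω| ^ (2 * p) ∂P ≤ K * (n i : ℝ) ^ 2 * b i ^ (2 * p)) :
    MomO P n f b := by
  refine of_sq hn hf hb fun p => ?_
  obtain ⟨K, hK⟩ := h p
  refine ⟨|K|, abs_nonneg K, fun i => ?_⟩
  have hbi := hb i
  obtain ⟨M, hM⟩ := hint i
  have hi : Integrable (fun ω => |f i ω| ^ (2 * p)) P :=
    Integrable.of_bound ((hf i).abs.pow_const _).aestronglyMeasurable (M ^ (2 * p))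
      (Filter.Eventually.of_forall fun ω => by
        rw [Real.norm_of_nonneg (by positivity)]
        exact pow_le_pow_left₀ (abs_nonneg _) (hM ω) _)
  simp only [div_pow]
  rw [← ofReal_integral_eq_lintegral_ofReal (hi.div_const _)
    (Filter.Eventually.of_forall fun ω => by positivity)]
  refine ENNReal.ofReal_le_ofReal ?_
  rw [integral_div, div_le_iff₀ (by positivity)]
  refine (hK i).trans ?_
  gcongr
  exact le_abs_self K

/-- Back to Bochner integrals. -/
lemma exists_integral_le (h : MomO P n f b) (p : ℕ) : ∃ K : ℝ, 0 ≤ K ∧ ∀ i,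
    Integrable (fun ω => |f i ω| ^ p) P ∧ ∫ ω, |f i ω| ^ p ∂P ≤ K * n i * b i ^ p := by
  obtain ⟨K, hK, hKb⟩ := h.bound p
  refine ⟨K, hK, fun i => ?_⟩
  have hbi := h.pos i
  have hm : Measurable fun ω => (|f i ω| / b i) ^ p := (((h.meas i).abs).div_const _).pow_const p
  have hi : Integrable (fun ω => (|f i ω| / b i) ^ p) P := by
    refine ⟨hm.aestronglyMeasurable, ?_⟩
    rw [hasFiniteIntegral_iff_ofReal (Filter.Eventually.of_forall fun ω => by positivity)]
    exact (hKb i).trans_lt ENNReal.ofReal_lt_top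
  have e : (fun ω => |f i ω| ^ p) = fun ω => b i ^ p * (|f i ω| / b i) ^ p := by
    funext ω
    rw [div_pow]
    field_simp
  rw [e]
  refine ⟨hi.const_mul _, ?_⟩
  rw [integral_const_mul, mul_comm]
  refine mul_le_mul_of_nonneg_right ?_ (by positivity)
  have := hKb i
  rwa [← ofReal_integral_eq_lintegral_ofReal hi (Filter.Eventually.of_forall fun ω => by positivity),
    ENNReal.ofReal_le_ofReal_iff (by positivity)] at this

end MomO

/-! ### Displacements inside blocks -/

/-- The truncated displacement `min 1 (|s| / √T)`. -/
noncomputable def cutoff (T : ℕ) (s : Lattice) : ℝ := min 1 (sz s / Real.sqrt T)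

lemma cutoff_nonneg (T : ℕ) (s : Lattice) : 0 ≤ cutoff T s :=
  le_min zero_le_one (div_nonneg (sz_nonneg s) (Real.sqrt_nonneg _))

lemma cutoff_le_one (T : ℕ) (s : Lattice) : cutoff T s ≤ 1 := min_le_left _ _

lemma abs_cutoff_le (T : ℕ) (s : Lattice) : |cutoff T s| ≤ 1 := by
  rw [abs_of_nonneg (cutoff_nonneg T s)]; exact cutoff_le_one T s

/-- The truncated displacement since the beginning of the block of length `b` that contains `i`. -/
noncomputable def blockDisp (b T : ℕ) (X : ℕ → Lattice) (i : ℕ) : ℝ :=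
  cutoff T (X i - X (b * (i / b)))

namespace IsPlanarStep

variable {P : Measure Ω} [IsProbabilityMeasure P] {ξ : ℕ → Ω → Lattice}

lemma integral_cutoff_walk_le (hS : IsPlanarStep P ξ) {m b : ℕ} (T : ℕ) (hm : m ≤ b) :
    ∫ ω, cutoff T (walk ξ m ω) ∂P ≤ 2 * Real.sqrt b / Real.sqrt T := by
  have hi : Integrable (fun ω => (|(walk ξ m ω 0 : ℝ)| + |(walk ξ m ω 1 : ℝ)|) / Real.sqrt T) P :=
    ((hS.integrable_walk_abs 0 m).add (hS.integrable_walk_abs 1 m)).div_const _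
  calc ∫ ω, cutoff T (walk ξ m ω) ∂P
      ≤ ∫ ω, (|(walk ξ m ω 0 : ℝ)| + |(walk ξ m ω 1 : ℝ)|) / Real.sqrt T ∂P :=
        integral_mono_of_nonneg (Filter.Eventually.of_forall fun ω => cutoff_nonneg _ _) hi
          (Filter.Eventually.of_forall fun ω => min_le_right _ _)
    _ = (∫ ω, |(walk ξ m ω 0 : ℝ)| ∂P + ∫ ω, |(walk ξ m ω 1 : ℝ)| ∂P) / Real.sqrt T := by
        rw [integral_div, integral_add (hS.integrable_walk_abs 0 m) (hS.integrable_walk_abs 1 m)]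
    _ ≤ (Real.sqrt m + Real.sqrt m) / Real.sqrt T := by
        gcongr <;> exact hS.integral_walk_abs_le _ m
    _ ≤ _ := by
        rw [← two_mul]
        have : (m : ℝ) ≤ b := by exact_mod_cast hm
        gcongr

lemma depOn_blockDisp (ξ : ℕ → Ω → Lattice) (b T i : ℕ) :
    DepOn ξ (Finset.Ico (b * (i / b)) i) (fun ω => blockDisp b T (fun i => walk ξ i ω) i) :=
  (depOn_walk_sub ξ _ i (Nat.mul_div_le i b)).comp (cutoff T)

lemma integral_blockDisp_le (hS : IsPlanarStep P ξ) {b : ℕ} (hb : 1 ≤ b) (T i : ℕ) :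
    ∫ ω, blockDisp b T (fun i => walk ξ i ω) i ∂P ≤ 2 * Real.sqrt b / Real.sqrt T := by
  have h := hS.integral_walk_sub (b * (i / b)) (i - b * (i / b)) (cutoff T) 1 (abs_cutoff_le T)
  rw [show b * (i / b) + (i - b * (i / b)) = i by have := Nat.mul_div_le i b; omega] at h
  unfold blockDisp
  rw [h]
  refine hS.integral_cutoff_walk_le T ?_
  have := Nat.div_add_mod i b
  have := Nat.mod_lt i hb
  omega

/-- Induction on `p` through tail sums. The displacement at `i` depends only on steps of the block
of `i` before `i`, hence is independent of everything after that block; the rest of the block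
contributes at most `b`, since each term is at most `1`. The mean of one term is at most `2√b / √T`.
-/
lemma exists_integral_sum_blockDisp_pow_le (hS : IsPlanarStep P ξ) (p : ℕ) :
    ∃ K : ℝ, 0 ≤ K ∧ ∀ (n b T : ℕ) (W : ℝ), 1 ≤ b → (b : ℝ) ≤ W →
      (n + 1) * (2 * Real.sqrt b / Real.sqrt T) ≤ W → ∀ j,
      ∫ ω, (∑ i ∈ Finset.Ico j (n + 1), blockDisp b T (fun i => walk ξ i ω) i) ^ p ∂P
        ≤ K * W ^ p := by
  induction p with
  | zero => exact ⟨1, zero_le_one, fun n b T W _ _ _ j => by simp⟩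
  | succ p ih =>
    obtain ⟨K, hK, ih⟩ := ih
    refine ⟨(p + 1) * (2 ^ p * (1 + K)), by positivity, fun n b T W hb hbW hW j => ?_⟩
    have hb0 : (0 : ℝ) ≤ b := Nat.cast_nonneg b
    have hW0 : 0 ≤ W := hb0.trans hbW
    set q : ℕ → Ω → ℝ := fun i ω => blockDisp b T (fun i => walk ξ i ω) i with hq
    set S : ℕ → Ω → ℝ := fun j ω => ∑ i ∈ Finset.Ico j (n + 1), q i ω with hSd
    have hq0 : ∀ i ω, 0 ≤ q i ω := fun i ω => cutoff_nonneg _ _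
    have hq1 : ∀ i ω, q i ω ≤ 1 := fun i ω => cutoff_le_one _ _
    have hqm : ∀ i, Measurable (q i) := fun i => hS.measurable_depOn (depOn_blockDisp ξ b T i)
    have hS0 : ∀ j ω, 0 ≤ S j ω := fun j ω => Finset.sum_nonneg fun i _ => hq0 i ω
    have hSm : ∀ j, Measurable (S j) := fun j => Finset.measurable_fun_sum _ fun i _ => hqm i
    have hSb : ∀ j ω, S j ω ≤ n + 1 := fun j ω => by
      calc S j ω ≤ ∑ i ∈ Finset.Ico j (n + 1), (1 : ℝ) := Finset.sum_le_sum fun i _ => hq1 i ω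
        _ ≤ n + 1 := by
          simp only [Finset.sum_const, Nat.card_Ico, nsmul_eq_mul, mul_one]
          exact_mod_cast Nat.sub_le _ _
    have hSp : ∀ j k, Integrable (fun ω => S j ω ^ k) P := fun j k =>
      integrable_of_bdd ((hSm j).pow_const k) (K := ((n : ℝ) + 1) ^ k) fun ω => by
        rw [abs_pow, abs_of_nonneg (hS0 j ω)]
        exact pow_le_pow_left₀ (hS0 j ω) (hSb j ω) k
    have hqS : ∀ i j, Integrable (fun ω => q i ω * (2 ^ p * ((b : ℝ) ^ p + S j ω ^ p))) P :=
      fun i j => integrable_of_bdd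
        (K := 1 * (2 ^ p * ((b : ℝ) ^ p + ((n : ℝ) + 1) ^ p)))
        ((hqm i).mul ((((hSm j).pow_const p).const_add _).const_mul _)) fun ω => by
        have h1 : 0 ≤ S j ω ^ p := pow_nonneg (hS0 j ω) p
        have h3 : S j ω ^ p ≤ ((n : ℝ) + 1) ^ p := pow_le_pow_left₀ (hS0 j ω) (hSb j ω) p
        generalize S j ω ^ p = x at h1 h3
        have h2 : 0 ≤ 2 ^ p * ((b : ℝ) ^ p + x) := by positivity
        rw [abs_mul, abs_of_nonneg (hq0 i ω), abs_of_nonneg h2]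
        exact mul_le_mul (hq1 i ω) (by gcongr) h2 zero_le_one
    -- The first time of the block following that of `i`.
    set nx : ℕ → ℕ := fun i => b * (i / b) + b with hnx
    have hnxi : ∀ i, i < nx i := fun i => by
      have := Nat.div_add_mod i b
      have := Nat.mod_lt i hb
      simp only [hnx]; omega
    have hSdep : ∀ i, DepOn ξ (Finset.Ico (nx i) n) (S (nx i)) := by
      intro i
      refine DepOn.sum _ fun i' hi' => (depOn_blockDisp ξ b T i').mono ?_
      rw [Finset.mem_Ico] at hi'
      refine Finset.Ico_subset_Ico ?_ (by omega)
      have h1 : nx i = b * (i / b + 1) := by simp only [hnx]; ring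
      rw [h1] at hi' ⊢
      refine Nat.mul_le_mul_left b ?_
      rw [Nat.le_div_iff_mul_le hb, mul_comm]
      exact hi'.1
    have hSnx : ∀ i ω, S i ω ≤ b + S (nx i) ω := by
      intro i ω
      have hsub : Finset.Ico i (n + 1) ⊆ Finset.Ico i (nx i) ∪ Finset.Ico (nx i) (n + 1) := by
        intro k hk
        rw [Finset.mem_Ico] at hk
        rw [Finset.mem_union, Finset.mem_Ico, Finset.mem_Ico]
        omega
      have h1 : S i ω ≤ ∑ k ∈ Finset.Ico i (nx i), q k ω + S (nx i) ω := by
        rw [hSd]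
        beta_reduce
        rw [← Finset.sum_union (by
          rw [Finset.disjoint_left]
          intro k hk hk'
          rw [Finset.mem_Ico] at hk hk'
          omega)]
        exact Finset.sum_le_sum_of_subset_of_nonneg hsub fun k _ _ => hq0 k ω
      have h2 : ∑ k ∈ Finset.Ico i (nx i), q k ω ≤ b := by
        calc _ ≤ ∑ k ∈ Finset.Ico i (nx i), (1 : ℝ) := Finset.sum_le_sum fun k _ => hq1 k ω
          _ ≤ b := by
            simp only [Finset.sum_const, Nat.card_Ico, nsmul_eq_mul, mul_one]
            have := Nat.mul_div_le i b
            exact_mod_cast (show nx i - i ≤ b by simp only [hnx]; omega)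
      linarith
    have hpt : ∀ ω, S j ω ^ (p + 1) ≤ (p + 1) * ∑ i ∈ Finset.Ico j (n + 1),
        q i ω * (2 ^ p * ((b : ℝ) ^ p + S (nx i) ω ^ p)) := by
      intro ω
      refine (pow_sum_le_sum_tail (a := fun i => q i ω) (fun i => hq0 i ω) p (n + 1) j).trans ?_
      gcongr with i hi
      · exact hq0 i ω
      · refine (pow_le_pow_left₀ (hS0 i ω) (hSnx i ω) p).trans
          ((add_pow_le hb0 (hS0 _ ω) p).trans ?_)
        refine mul_le_mul_of_nonneg_right (pow_le_pow_right₀ (by norm_num) (Nat.sub_le _ _)) ?_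
        have := hS0 (nx i) ω
        positivity
    have hterm : ∀ i, ∫ ω, q i ω * (2 ^ p * ((b : ℝ) ^ p + S (nx i) ω ^ p)) ∂P
        ≤ 2 * Real.sqrt b / Real.sqrt T * (2 ^ p * ((1 + K) * W ^ p)) := by
      intro i
      have hdis : Disjoint (Finset.Ico (b * (i / b)) i) (Finset.Ico (nx i) n) := by
        rw [Finset.disjoint_left]
        intro k hk hk'
        rw [Finset.mem_Ico] at hk hk'
        have := hnxi i
        omega
      rw [hS.integral_mul_depOn hdis (depOn_blockDisp ξ b T i)
        ((hSdep i).comp fun x => 2 ^ p * ((b : ℝ) ^ p + x ^ p)), integral_const_mul,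
        integral_add (integrable_const _) (hSp _ p), integral_const]
      simp only [probReal_univ, smul_eq_mul, one_mul]
      have h1 := ih n b T W hb hbW hW (nx i)
      have h2 : (b : ℝ) ^ p ≤ W ^ p := pow_le_pow_left₀ hb0 hbW p
      have h3 := hS.integral_blockDisp_le hb T i
      have h4 : 0 ≤ ∫ ω, S (nx i) ω ^ p ∂P := integral_nonneg fun ω => pow_nonneg (hS0 _ ω) p
      refine mul_le_mul h3 ?_ (by positivity) (by positivity)
      refine mul_le_mul_of_nonneg_left ?_ (by positivity)
      rw [add_mul, one_mul]
      exact add_le_add h2 h1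
    calc ∫ ω, S j ω ^ (p + 1) ∂P
        ≤ ∫ ω, (p + 1) * ∑ i ∈ Finset.Ico j (n + 1),
          q i ω * (2 ^ p * ((b : ℝ) ^ p + S (nx i) ω ^ p)) ∂P :=
          integral_mono (hSp j _) ((integrable_finsetSum _ fun i _ => hqS i _).const_mul _) hpt
      _ = (p + 1) * ∑ i ∈ Finset.Ico j (n + 1),
          ∫ ω, q i ω * (2 ^ p * ((b : ℝ) ^ p + S (nx i) ω ^ p)) ∂P := by
          rw [integral_const_mul, integral_finsetSum _ fun i _ => hqS i _]
      _ ≤ (p + 1) * ∑ i ∈ Finset.range (n + 1),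
          2 * Real.sqrt b / Real.sqrt T * (2 ^ p * ((1 + K) * W ^ p)) := by
          refine mul_le_mul_of_nonneg_left ?_ (by positivity)
          refine (Finset.sum_le_sum fun i _ => hterm i).trans
            (Finset.sum_le_sum_of_subset_of_nonneg (fun k hk => ?_) fun _ _ _ => by positivity)
          rw [Finset.mem_Ico] at hk
          exact Finset.mem_range.2 hk.2
      _ = (p + 1) * (2 ^ p * (1 + K)) * (W ^ p * ((n + 1) * (2 * Real.sqrt b / Real.sqrt T))) := by
          rw [Finset.sum_const, Finset.card_range, nsmul_eq_mul]
          push_cast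
          ring
      _ ≤ (p + 1) * (2 ^ p * (1 + K)) * (W ^ p * W) := by gcongr
      _ = _ := by ring

lemma momO_blockDisp (hS : IsPlanarStep P ξ) {ι : Type*} {n b T : ι → ℕ} {W : ι → ℝ}
    (hn : ∀ i, 1 ≤ n i) (hb : ∀ i, 1 ≤ b i) (hbW : ∀ i, (b i : ℝ) ≤ W i)
    (hW : ∀ i, n i * (Real.sqrt (b i) / Real.sqrt (T i)) ≤ W i) :
    MomO P n (fun i ω => ∑ k ∈ Finset.range (n i + 1),
      blockDisp (b i) (T i) (fun i => walk ξ i ω) k) W := by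
  have hW0 : ∀ i, 0 < W i := fun i => lt_of_lt_of_le (by exact_mod_cast hb i) (hbW i)
  have hd : ∀ i k ω, |blockDisp (b i) (T i) (fun i => walk ξ i ω) k| ≤ 1 :=
    fun i k ω => abs_cutoff_le _ _
  refine MomO.of_integral hn (fun i => ?_) hW0 (fun i => ⟨n i + 1, fun ω => ?_⟩) fun p => ?_
  · exact Finset.measurable_fun_sum _ fun k _ =>
      hS.measurable_depOn (depOn_blockDisp ξ (b i) (T i) k)
  · refine (Finset.abs_sum_le_sum_abs _ _).trans ((Finset.sum_le_sum fun k _ => hd i k ω).trans ?_)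
    simp
  · obtain ⟨K, hK, h⟩ := hS.exists_integral_sum_blockDisp_pow_le (2 * p)
    refine ⟨K * 4 ^ (2 * p), fun i => ?_⟩
    have hn1 : (1 : ℝ) ≤ n i := by exact_mod_cast hn i
    -- The factor `4` comes from `n + 1 ≤ 2n` and from the `2` in the mean displacement.
    have h1 := h (n i) (b i) (T i) (4 * W i) (hb i) (by linarith [hbW i, hW0 i]) (by
      have h0 : 0 ≤ Real.sqrt (b i) / Real.sqrt (T i) := by positivity
      have := hW i
      rw [mul_div_assoc]
      nlinarith) 0
    rw [Finset.range_eq_Ico]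
    simp only [(even_two_mul p).pow_abs]
    refine h1.trans ?_
    rw [mul_pow, ← mul_assoc]
    have h2 : 0 ≤ W i ^ (2 * p) := pow_nonneg (hW0 i).le _
    have h3 : (1 : ℝ) ≤ (n i : ℝ) ^ 2 := one_le_pow₀ hn1
    have h4 : 0 ≤ K * 4 ^ (2 * p) := by positivity
    refine mul_le_mul_of_nonneg_right ?_ h2
    exact le_mul_of_one_le_right h4 h3

lemma momO_lam (hS : IsPlanarStep P ξ) {C : ℝ} (hC : KernelBounds P ξ C) {ι : Type*} {n : ι → ℕ}
    (hn : ∀ i, 1 ≤ n i) : MomO P n (fun i => lam ξ C (n i)) (fun _ => 1) := by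
  refine MomO.of_integral hn (fun i => hS.measurable_depOn (depOn_lam ξ C (n i)))
    (fun _ => zero_lt_one) (fun i => ⟨n i + 1 + C * (1 + Real.log (n i)), fun ω => ?_⟩) fun p => ?_
  · rw [abs_of_nonneg (zero_le_one.trans (one_le_lam hC.one_le _ ω))]
    exact lam_le hC.one_le _ ω
  · obtain ⟨K, hK⟩ := hS.exists_integral_lam_pow_le hC (2 * p)
    refine ⟨K, fun i => ?_⟩
    simp only [(even_two_mul p).pow_abs, one_pow, mul_one]
    exact hK _ (hn i)

lemma momO_lam_pow (hS : IsPlanarStep P ξ) {C : ℝ} (hC : KernelBounds P ξ C) {ι : Type*}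
    {n : ι → ℕ} (hn : ∀ i, 1 ≤ n i) (m : ℕ) :
    MomO P n (fun i ω => lam ξ C (n i) ω ^ m) (fun _ => 1) := by
  simpa only [one_pow] using (hS.momO_lam hC hn).pow m

lemma momO_mart (hS : IsPlanarStep P ξ) {C : ℝ} (hC : KernelBounds P ξ C) {ι : Type*} (m : ℕ)
    {n N T : ι → ℕ} {g : ι → Lattice → ℝ} {l : ι → List Lattice} {z : ι → Lattice}
    (hn : ∀ i, 1 ≤ n i) (hT : ∀ i, 1 ≤ T i) (hTn : ∀ i, T i ≤ n i) (hN : ∀ i, N i ≤ n i)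
    (hm : ∀ i, (l i).length = m) (hl : ∀ i, ∀ z ∈ l i, |g i z| ≤ C * (1 + Real.log (n i))) :
    MomO P n (fun i ω => ∑ j ∈ Finset.range (N i), martDiff (usum P ξ (T i)) (vsum P ξ (T i))
      (fun i => walk ξ i ω) (chainW (g i) (fun i => walk ξ i ω) (l i)) (z i) j)
      (fun i => Real.sqrt (n i * T i)) := by
  have h0 : ∀ i, (0 : ℝ) < n i * T i := fun i => by
    have h1 : (0 : ℝ) < n i := by exact_mod_cast hn i
    have h2 : (0 : ℝ) < T i := by exact_mod_cast hT i
    positivity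
  refine MomO.of_integral hn (fun i => ?_) (fun i => Real.sqrt_pos.2 (h0 i)) (fun i => ?_)
    fun p => ?_
  · exact Finset.measurable_fun_sum _ fun k _ => hS.measurable_depOn (depOn_martDiff ξ _ _ _ _ _ _)
  · refine ⟨∑ j ∈ Finset.range (N i), (n i + 1 + C * (1 + Real.log (n i))) ^ m *
      ((n i + 1) * (T i + T i)), fun ω => ?_⟩
    refine (Finset.abs_sum_le_sum_abs _ _).trans (Finset.sum_le_sum fun j hj => ?_)
    rw [Finset.mem_range] at hj
    have hjn : j ≤ n i := hj.le.trans (hN i)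
    have h1 := martStep_abs_le (hS.usum_l1 (T i)) (hS.vsum_l1 (T i)) (fun i => walk ξ i ω)
      (chainW (g i) (fun i => walk ξ i ω) (l i)) hjn
      (abs_chainW_le_lam hC.one_le (hl i) ω) (walk ξ (j + 1) ω) (z i)
    refine h1.trans ?_
    rw [hm i]
    have h2 := lam_le (ξ := ξ) hC.one_le (n i) ω
    have h3 := zero_le_one.trans (one_le_lam (ξ := ξ) hC.one_le (n i) ω)
    have h4 := maxVisits_le (fun i => walk ξ i ω) (n i)
    have h5 := maxVisits_nonneg (fun i => walk ξ i ω) (n i)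
    have h6 := h3.trans h2
    gcongr
  · rcases p with _ | k
    · exact ⟨1, fun i => by
        have : (1 : ℝ) ≤ (n i : ℝ) ^ 2 := one_le_pow₀ (by exact_mod_cast hn i)
        simpa using this⟩
    · obtain ⟨K, hK⟩ := hS.exists_integral_mart_pow_le hC m k
      refine ⟨K, fun i => ?_⟩
      simp only [(even_two_mul (k + 1)).pow_abs]
      rw [pow_mul (Real.sqrt _), Real.sq_sqrt (h0 i).le]
      exact hK _ _ _ _ _ _ (hn i) (hT i) (hTn i) (hN i) (hm i) (hl i)

end IsPlanarStep

/-! ### Comparison of two chains -/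

lemma ceil_le_two_mul {x : ℝ} (hx : 1 ≤ x) : (⌈x⌉₊ : ℝ) ≤ 2 * x := by
  have := Nat.ceil_lt_add_one (zero_le_one.trans hx)
  linarith

lemma cutoff_neg (T : ℕ) (s : Lattice) : cutoff T (-s) = cutoff T s := by
  unfold cutoff; rw [sz_neg]

namespace IsPlanarStep

variable {P : Measure Ω} [IsProbabilityMeasure P] {ξ : ℕ → Ω → Lattice}

lemma usum_sub_vsum_eq (T : ℕ) (y : Lattice) :
    usum P ξ T y - vsum P ξ T y = (if y = 0 then 1 else 0) - kern P ξ T y := by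
  rw [usum_sub_vsum, kern_zero]

lemma chainS_cons_kern (hS : IsPlanarStep P ξ) (g : Lattice → ℝ) (T : ℕ) (X : ℕ → Lattice)
    (z : Lattice) (l : List Lattice) (N : ℕ) :
    chainS g X (z :: l) N = smoothPart (kern P ξ T) (vsum P ξ T z - g z) X (chainW g X l) N z
      + ∑ j ∈ Finset.range N, martDiff (usum P ξ T) (vsum P ξ T) X (chainW g X l) z j
      - finalPart (vsum P ξ T) X (chainW g X l) N z :=
  chainS_cons (usum_sub_vsum_eq T) (hS.vsum_neg T) X z l N

/-- The smaller of the trivial bound `2` and the total variation estimate. The truncation keeps each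
term of the block sums bounded by `1`. -/
lemma l1_diff_kern_cutoff (hS : IsPlanarStep P ξ) {C : ℝ} (hC : KernelBounds P ξ C) {n T : ℕ}
    (hT : 1 ≤ T) (hTn : T ≤ n) (s : Lattice) :
    L1Le (fun y => kern P ξ T (y + s) - kern P ξ T y)
      (2 * (C * (1 + Real.log n)) * cutoff T s) := by
  have hl : 0 ≤ Real.log n := Real.log_natCast_nonneg n
  have hC1 := hC.one_le
  have hB : 1 ≤ C * (1 + Real.log n) := by nlinarith
  unfold cutoff
  rcases min_choice 1 (sz s / Real.sqrt T) with h | h <;> rw [h]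
  · have h1 := ((hS.kern_l1 T).comp_equiv (Equiv.addRight s)).add
      ((hS.kern_l1 T).mono (g := fun y => -kern P ξ T y) (fun y => by rw [abs_neg]) le_rfl)
    refine h1.mono (fun y => ?_) (by linarith)
    simp [sub_eq_add_neg]
  · refine (hC.diff_kern n T s hT hTn).mono (fun _ => le_rfl) ?_
    have h0 : 0 ≤ sz s / Real.sqrt T := div_nonneg (sz_nonneg s) (Real.sqrt_nonneg _)
    have : C * sz s * (1 + Real.log n) / Real.sqrt T
        = C * (1 + Real.log n) * (sz s / Real.sqrt T) := by ring
    rw [this]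
    nlinarith

/-- Changing the last shift of a chain. -/
lemma momO_chainS_head (hS : IsPlanarStep P ξ) {C : ℝ} (hC : KernelBounds P ξ C) {ι : Type*} (m : ℕ)
    {n N : ι → ℕ} {r : ι → ℤ} {l : ι → List Lattice} {z z' : ι → Lattice} {u : ι → ℝ}
    (hn : ∀ i, 1 ≤ n i) (hN : ∀ i, N i ≤ n i) (hr : ∀ i, |(r i : ℝ) - Real.sqrt (n i)| < 1)
    (hm : ∀ i, (l i).length = m) (hl : ∀ i, ∀ y ∈ l i, sz y ≤ 2 * Real.sqrt (n i))
    (hzz : ∀ i, sz (z i - z' i) ≤ 4 * u i * Real.sqrt (n i))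
    (hu : ∀ i, (Real.sqrt (n i))⁻¹ ≤ u i) (hu1 : ∀ i, u i ≤ 1) :
    MomO P n (fun i ω => chainS (potentialDiff P ξ (r i)) (fun j => walk ξ j ω) (z i :: l i) (N i)
      - chainS (potentialDiff P ξ (r i)) (fun j => walk ξ j ω) (z' i :: l i) (N i))
      (fun i => n i * Real.sqrt (u i)) := by
  have hC1 := hC.one_le
  have hn1 : ∀ i, (1 : ℝ) ≤ n i := fun i => by exact_mod_cast hn i
  have hn0 : ∀ i, (0 : ℝ) < n i := fun i => zero_lt_one.trans_le (hn1 i)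
  have hsn : ∀ i, 1 ≤ Real.sqrt (n i) := fun i => Real.one_le_sqrt.2 (hn1 i)
  have hu0 : ∀ i, 0 < u i := fun i =>
    (inv_pos.2 (zero_lt_one.trans_le (hsn i))).trans_le (hu i)
  have hnu : ∀ i, 1 ≤ n i * u i := fun i => by
    have h1 : Real.sqrt (n i) * Real.sqrt (n i) = n i := Real.mul_self_sqrt (hn0 i).le
    have h2 : (n i : ℝ) * (Real.sqrt (n i))⁻¹ = Real.sqrt (n i) := by
      nth_rewrite 1 [← h1]
      field_simp
    have h3 := mul_le_mul_of_nonneg_left (hu i) (hn0 i).le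
    linarith [hsn i]
  -- Balance of the errors: martingale `√(nT)` and smoothed part `n · u√n / √T` are both of order
  -- `n√u`, and the final part `T` is smaller. Since `n u ≥ 1`, rounding up at most doubles `T`.
  set T : ι → ℕ := fun i => ⌈n i * u i⌉₊ with hTdef
  have hT : ∀ i, 1 ≤ T i := fun i => Nat.one_le_iff_ne_zero.2 (by
    have := Nat.ceil_pos.2 (zero_lt_one.trans_le (hnu i))
    simp only [hTdef]; omega)
  have hTn : ∀ i, T i ≤ n i := fun i => Nat.ceil_le.2 (by nlinarith [hu1 i, hn0 i])
  have hT2 : ∀ i, (T i : ℝ) ≤ 2 * (n i * u i) := fun i => ceil_le_two_mul (hnu i)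
  have hT1 : ∀ i, n i * u i ≤ (T i : ℝ) := fun i => Nat.le_ceil _
  have hg : ∀ i, ∀ y ∈ l i, |potentialDiff P ξ (r i) y| ≤ C * (1 + Real.log (n i)) :=
    fun i y hy => hC.potentialDiff_le _ _ _ (hn i) (hr i) (hl i y hy)
  have hbpos : ∀ i, 0 < n i * Real.sqrt (u i) := fun i =>
    mul_pos (hn0 i) (Real.sqrt_pos.2 (hu0 i))
  have hmart : ∀ y : ι → Lattice, MomO P n (fun i ω => ∑ j ∈ Finset.range (N i),
      martDiff (usum P ξ (T i)) (vsum P ξ (T i)) (fun i => walk ξ i ω)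
      (chainW (potentialDiff P ξ (r i)) (fun i => walk ξ i ω) (l i)) (y i) j)
      (fun i => n i * Real.sqrt (u i)) := fun y => by
    refine (hS.momO_mart hC m hn hT hTn hN hm hg).mono hbpos 2 fun i => ?_
    rw [Real.sqrt_le_left (by have := hbpos i; positivity)]
    have : (2 * (n i * Real.sqrt (u i))) ^ 2 = 4 * (n i * (n i * u i)) := by
      rw [mul_pow, mul_pow, Real.sq_sqrt (hu0 i).le]; ring
    rw [this]
    nlinarith [mul_le_mul_of_nonneg_left (hT2 i) (hn0 i).le, hn0 i, hnu i]
  have hM := (hmart z).sub (hmart z')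
  have hmS : ∀ (y : ι → Lattice) i, Measurable fun ω =>
      chainS (potentialDiff P ξ (r i)) (fun j => walk ξ j ω) (y i :: l i) (N i) :=
    fun y i => hS.measurable_depOn (depOn_chainS ξ _ _ _)
  -- Without the martingales the difference is bounded pointwise: `20 = 16 + 2 + 2`, from the
  -- smoothed part and the two final parts.
  have hlam := ((hS.momO_lam_pow hC hn (m + 2)).smul (fun i => 20 * (n i * Real.sqrt (u i)))
    (b' := fun i => n i * Real.sqrt (u i)) hbpos 20 fun i => by
      rw [abs_of_nonneg (by have := hbpos i; positivity), mul_one])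
  have hE := hlam.dom (g := fun i ω =>
      (chainS (potentialDiff P ξ (r i)) (fun j => walk ξ j ω) (z i :: l i) (N i)
      - chainS (potentialDiff P ξ (r i)) (fun j => walk ξ j ω) (z' i :: l i) (N i))
      - (∑ j ∈ Finset.range (N i), martDiff (usum P ξ (T i)) (vsum P ξ (T i))
        (fun i => walk ξ i ω) (chainW (potentialDiff P ξ (r i)) (fun i => walk ξ i ω) (l i)) (z i) j
      - ∑ j ∈ Finset.range (N i), martDiff (usum P ξ (T i)) (vsum P ξ (T i))
        (fun i => walk ξ i ω) (chainW (potentialDiff P ξ (r i)) (fun i => walk ξ i ω) (l i))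
        (z' i) j)) (fun i => ((hmS z i).sub (hmS z' i)).sub (hM.meas i)) fun i ω => ?_
  · refine (hE.add hM).dom (fun i => (hmS z i).sub (hmS z' i)) fun i ω => ?_
    rw [sub_add_cancel]
  set X : ℕ → Lattice := fun j => walk ξ j ω with hX
  set g := potentialDiff P ξ (r i) with hgdef
  have hLb : ∀ j ≤ n i, |chainW g X (l i) j| ≤ lam ξ C (n i) ω ^ m :=
    hm i ▸ abs_chainW_le_lam hC1 (hg i) ω
  have hlam1 : 1 ≤ lam ξ C (n i) ω := one_le_lam hC1 _ _
  have hV : maxVisits X (n i) ≤ lam ξ C (n i) ω := maxVisits_le_lam hC1 _ _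
  have hV0 := maxVisits_nonneg X (n i)
  have hB : C * (1 + Real.log (n i)) ≤ lam ξ C (n i) ω := log_le_lam _ _
  generalize lam ξ C (n i) ω = lm at hLb hlam1 hV hB
  have hlm0 : 0 ≤ lm := zero_le_one.trans hlam1
  have hlog := Real.log_natCast_nonneg (n i)
  have hCl : C ≤ lm := le_trans (by nlinarith) hB
  have hsz : sz (z' i - z i) ≤ 4 * u i * Real.sqrt (n i) := by
    rw [← sz_neg, neg_sub]; exact hzz i
  have hTpos : 0 < Real.sqrt (T i) := Real.sqrt_pos.2 (by exact_mod_cast hT i)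
  have hratio : 4 * u i * Real.sqrt (n i) / Real.sqrt (T i) ≤ 4 * Real.sqrt (u i) := by
    rw [div_le_iff₀ hTpos]
    have h1 : Real.sqrt (n i) * Real.sqrt (u i) ≤ Real.sqrt (T i) := by
      rw [← Real.sqrt_mul (hn0 i).le]
      exact Real.sqrt_le_sqrt (hT1 i)
    have h2 : Real.sqrt (u i) * Real.sqrt (u i) = u i := Real.mul_self_sqrt (hu0 i).le
    have h3 := Real.sqrt_nonneg (u i)
    calc 4 * u i * Real.sqrt (n i) = 4 * Real.sqrt (u i) * (Real.sqrt (n i) * Real.sqrt (u i)) := by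
          nth_rewrite 1 [← h2]; ring
      _ ≤ _ := by gcongr
  have hs1 := smoothPart_sub_le (c := vsum P ξ (T i) (z i) - g (z i))
    (c' := vsum P ξ (T i) (z' i) - g (z' i)) (hC.diff_kern (n i) (T i) (z' i - z i) (hT i) (hTn i))
    X (chainW g X (l i)) (hN i) hLb
  have hA : C * sz (z' i - z i) * (1 + Real.log (n i)) / Real.sqrt (T i)
      ≤ lm * (4 * Real.sqrt (u i)) := by
    calc _ = C * (1 + Real.log (n i)) * (sz (z' i - z i) / Real.sqrt (T i)) := by ring
      _ ≤ lm * (4 * u i * Real.sqrt (n i) / Real.sqrt (T i)) := by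
        have := sz_nonneg (z' i - z i)
        gcongr
      _ ≤ _ := by gcongr
  have hc := hC.comp_diff (T i) (r i) (z i) (z' i) (hT i)
  have hc2 : C * sz (z i - z' i) / Real.sqrt (T i) ≤ lm * (4 * Real.sqrt (u i)) := by
    calc _ = C * (sz (z i - z' i) / Real.sqrt (T i)) := by ring
      _ ≤ lm * (4 * u i * Real.sqrt (n i) / Real.sqrt (T i)) := by
        have := sz_nonneg (z i - z' i)
        have := hzz i
        gcongr
      _ ≤ _ := by gcongr
  have hf1 := finalPart_le (hS.vsum_l1 (T i)) X (chainW g X (l i)) (hN i) hLb (z i)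
  have hf2 := finalPart_le (hS.vsum_l1 (T i)) X (chainW g X (l i)) (hN i) hLb (z' i)
  have husq : u i ≤ Real.sqrt (u i) := by
    have h2 : Real.sqrt (u i) * Real.sqrt (u i) = u i := Real.mul_self_sqrt (hu0 i).le
    have h3 : Real.sqrt (u i) ≤ 1 := Real.sqrt_le_one.2 (hu1 i)
    nlinarith [Real.sqrt_nonneg (u i)]
  have hsu := Real.sqrt_nonneg (u i)
  have hf : lm ^ m * (maxVisits X (n i) * (T i)) ≤ 2 * (n i * Real.sqrt (u i)) * lm ^ (m + 2) := by
    calc _ ≤ lm ^ m * (lm * (2 * (n i * Real.sqrt (u i)))) := by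
          have : (T i : ℝ) ≤ 2 * (n i * Real.sqrt (u i)) :=
            (hT2 i).trans (by have := hn0 i; gcongr)
          gcongr
      _ = 2 * (n i * Real.sqrt (u i)) * lm ^ (m + 1) := by ring
      _ ≤ _ := by
          have := hbpos i
          gcongr
          norm_num
  have hs2 : (n i + 1) * (lm ^ m * (maxVisits X (n i) * (C * sz (z' i - z i) * (1 + Real.log (n i)) / Real.sqrt (T i))))
      + |(vsum P ξ (T i) (z i) - g (z i)) - (vsum P ξ (T i) (z' i) - g (z' i))| * ((n i + 1) * lm ^ m)
      ≤ 16 * (n i * Real.sqrt (u i)) * lm ^ (m + 2) := by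
    have hA0 : 0 ≤ C * sz (z' i - z i) * (1 + Real.log (n i)) / Real.sqrt (T i) := by
      have := sz_nonneg (z' i - z i)
      positivity
    have h1 : (n i + 1) * (lm ^ m * (maxVisits X (n i) * (C * sz (z' i - z i) * (1 + Real.log (n i)) / Real.sqrt (T i))))
        ≤ 2 * n i * (lm ^ m * (lm * (lm * (4 * Real.sqrt (u i))))) := by
      have := hn1 i
      have h2n : (n i : ℝ) + 1 ≤ 2 * n i := by linarith
      gcongr
    have h2 : |(vsum P ξ (T i) (z i) - g (z i)) - (vsum P ξ (T i) (z' i) - g (z' i))| * ((n i + 1) * lm ^ m)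
        ≤ lm * (4 * Real.sqrt (u i)) * (2 * n i * lm ^ (m + 1)) := by
      have := hn1 i
      have h2n : (n i : ℝ) + 1 ≤ 2 * n i := by linarith
      have h3 : lm ^ m ≤ lm ^ (m + 1) := pow_le_pow_right₀ hlam1 (by omega)
      have h4 := hc.trans hc2
      gcongr
    refine (add_le_add h1 h2).trans (le_of_eq ?_)
    ring
  have hfin : |20 * (n i * Real.sqrt (u i)) * lm ^ (m + 2)| = 20 * (n i * Real.sqrt (u i)) * lm ^ (m + 2) :=
    abs_of_nonneg (by have := hbpos i; positivity)
  rw [hfin, hS.chainS_cons_kern g (T i), hS.chainS_cons_kern g (T i)]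
  have e : ∀ a b c a' b' c' : ℝ, (a + b - c - (a' + b' - c')) - (b - b') = (a - a') - (c - c') :=
    fun a b c a' b' c' => by ring
  rw [e]
  refine (abs_sub _ _).trans ((add_le_add (hs1.trans hs2)
    ((abs_sub _ _).trans (add_le_add (hf1.trans hf) (hf2.trans hf)))).trans (le_of_eq ?_))
  ring

/-- Changing all shifts of a chain but the last one. -/
lemma momO_chainS_tail (hS : IsPlanarStep P ξ) {C : ℝ} (hC : KernelBounds P ξ C) {ι : Type*} (m : ℕ)
    {n N : ι → ℕ} {r : ι → ℤ} {l l' : ι → List Lattice} {z : ι → Lattice} {w : ι → ℝ}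
    {M : ι → Ω → ℝ}
    (hn : ∀ i, 1 ≤ n i) (hN : ∀ i, N i ≤ n i) (hr : ∀ i, |(r i : ℝ) - Real.sqrt (n i)| < 1)
    (hm : ∀ i, (l i).length = m) (hm' : ∀ i, (l' i).length = m)
    (hl : ∀ i, ∀ y ∈ l i, sz y ≤ 2 * Real.sqrt (n i))
    (hl' : ∀ i, ∀ y ∈ l' i, sz y ≤ 2 * Real.sqrt (n i))
    (hz : ∀ i, sz (z i) ≤ 2 * Real.sqrt (n i))
    (hw : ∀ i, 0 < w i) (hw1 : ∀ i, w i ≤ 1) (hnw : ∀ i, 1 ≤ n i * w i ^ 4)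
    (hM : MomO P n M (fun i => n i * w i ^ 8))
    (hMb : ∀ i ω, ∀ k ≤ n i,
      |chainS (potentialDiff P ξ (r i)) (fun j => walk ξ j ω) (l i) k
        - chainS (potentialDiff P ξ (r i)) (fun j => walk ξ j ω) (l' i) k| ≤ M i ω) :
    MomO P n (fun i ω => chainS (potentialDiff P ξ (r i)) (fun j => walk ξ j ω) (z i :: l i) (N i)
      - chainS (potentialDiff P ξ (r i)) (fun j => walk ξ j ω) (z i :: l' i) (N i))
      (fun i => n i * w i) := by
  have hC1 := hC.one_le
  have hn1 : ∀ i, (1 : ℝ) ≤ n i := fun i => by exact_mod_cast hn i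
  have hn0 : ∀ i, (0 : ℝ) < n i := fun i => zero_lt_one.trans_le (hn1 i)
  have hbpos : ∀ i, 0 < n i * w i := fun i => mul_pos (hn0 i) (hw i)
  have hpw : ∀ i (a b : ℕ), a ≤ b → (n i : ℝ) * w i ^ b ≤ n i * w i ^ a := fun i a b hab =>
    mul_le_mul_of_nonneg_left (pow_le_pow_of_le_one (hw i).le (hw1 i) hab) (hn0 i).le
  have hnw2 : ∀ i, 1 ≤ n i * w i ^ 2 := fun i => (hnw i).trans (hpw i 2 4 (by norm_num))
  -- Balance of the errors, with inner error `M` of order `n w^8`: the martingale is `√(nT) = n w`;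
  -- a block moves the path by `√b = w √T`, so freezing costs `n w`; about `n/b = w^{-4}` blocks,
  -- each costing `M`, give `n w^4`; the final part is `T = n w²`.
  set T : ι → ℕ := fun i => ⌈n i * w i ^ 2⌉₊ with hTdef
  set b : ι → ℕ := fun i => ⌈n i * w i ^ 4⌉₊ with hbdef
  have hT : ∀ i, 1 ≤ T i := fun i => Nat.one_le_iff_ne_zero.2 (by
    have := Nat.ceil_pos.2 (zero_lt_one.trans_le (hnw2 i))
    simp only [hTdef]; omega)
  have hb : ∀ i, 1 ≤ b i := fun i => Nat.one_le_iff_ne_zero.2 (by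
    have := Nat.ceil_pos.2 (zero_lt_one.trans_le (hnw i))
    simp only [hbdef]; omega)
  have hTn : ∀ i, T i ≤ n i := fun i => Nat.ceil_le.2 (by
    simpa using hpw i 0 2 (by norm_num))
  have hT2 : ∀ i, (T i : ℝ) ≤ 2 * (n i * w i ^ 2) := fun i => ceil_le_two_mul (hnw2 i)
  have hT1 : ∀ i, n i * w i ^ 2 ≤ (T i : ℝ) := fun i => Nat.le_ceil _
  have hb2 : ∀ i, (b i : ℝ) ≤ 2 * (n i * w i ^ 4) := fun i => ceil_le_two_mul (hnw i)
  have hb1 : ∀ i, n i * w i ^ 4 ≤ (b i : ℝ) := fun i => Nat.le_ceil _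
  have hg : ∀ i, ∀ y ∈ l i, |potentialDiff P ξ (r i) y| ≤ C * (1 + Real.log (n i)) :=
    fun i y hy => hC.potentialDiff_le _ _ _ (hn i) (hr i) (hl i y hy)
  have hg' : ∀ i, ∀ y ∈ l' i, |potentialDiff P ξ (r i) y| ≤ C * (1 + Real.log (n i)) :=
    fun i y hy => hC.potentialDiff_le _ _ _ (hn i) (hr i) (hl' i y hy)
  have hmart : ∀ L : ι → List Lattice, (∀ i, (L i).length = m) →
      (∀ i, ∀ y ∈ L i, |potentialDiff P ξ (r i) y| ≤ C * (1 + Real.log (n i))) →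
      MomO P n (fun i ω => ∑ j ∈ Finset.range (N i),
      martDiff (usum P ξ (T i)) (vsum P ξ (T i)) (fun i => walk ξ i ω)
      (chainW (potentialDiff P ξ (r i)) (fun i => walk ξ i ω) (L i)) (z i) j)
      (fun i => n i * w i) := fun L hLm hLg => by
    refine (hS.momO_mart hC m hn hT hTn hN hLm hLg).mono hbpos 2 fun i => ?_
    rw [Real.sqrt_le_left (by have := hbpos i; positivity)]
    have h1 := mul_le_mul_of_nonneg_left (hT2 i) (hn0 i).le
    have h2 := sq_nonneg (n i * w i)
    nlinarith
  have hMM := (hmart l hm hg).sub (hmart l' hm' hg')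
  have hmS : ∀ (L : ι → List Lattice) i, Measurable fun ω =>
      chainS (potentialDiff P ξ (r i)) (fun j => walk ξ j ω) (z i :: L i) (N i) :=
    fun L i => hS.measurable_depOn (depOn_chainS ξ _ _ _)
  -- the three error terms
  have hQ : MomO P n (fun i ω => ∑ k ∈ Finset.range (n i + 1),
      blockDisp (b i) (T i) (fun i => walk ξ i ω) k) (fun i => 2 * (n i * w i)) := by
    refine hS.momO_blockDisp hn hb (fun i => ?_) fun i => ?_
    · have := hpw i 1 4 (by norm_num)
      rw [pow_one] at this
      linarith [hb2 i]
    · have hTp : 0 < Real.sqrt (T i) := Real.sqrt_pos.2 (by exact_mod_cast hT i)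
      have h1 : Real.sqrt (b i) ≤ 2 * w i * Real.sqrt (T i) := by
        rw [Real.sqrt_le_left (by have := hw i; positivity), mul_pow, mul_pow, Real.sq_sqrt (by positivity)]
        have h2 := mul_le_mul_of_nonneg_left (hT1 i) (sq_nonneg (w i))
        have h3 := hb2 i
        have h4 : w i ^ 2 * (n i * w i ^ 2) = n i * w i ^ 4 := by ring
        have h5 := hnw i
        nlinarith
      have h6 : Real.sqrt (b i) / Real.sqrt (T i) ≤ 2 * w i := (div_le_iff₀ hTp).2 h1
      calc _ ≤ (n i : ℝ) * (2 * w i) := by gcongr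
        _ = _ := by ring
  have h1 := ((hS.momO_lam_pow hC hn (m + 2)).mul hQ).smul (fun _ => 4) hbpos 8 fun i => by
    rw [abs_of_nonneg (by norm_num)]; linarith
  -- The `5` is `2 · 2` for the number of blocks times the factor in a block sum, plus `1` for the
  -- term with `vsum` minus the renormalization.
  have h2 := ((hS.momO_lam_pow hC hn 1).mul hM).smul (fun i => 5 * (w i ^ 4)⁻¹) hbpos 5 fun i => by
    have := hw i
    rw [abs_of_nonneg (by positivity)]
    have e : 5 * (w i ^ 4)⁻¹ * (1 * (n i * w i ^ 8)) = 5 * (n i * w i ^ 4) := by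
      field_simp
    rw [e]
    have := hpw i 1 4 (by norm_num)
    rw [pow_one] at this
    linarith
  have h3 := (hS.momO_lam_pow hC hn (m + 1)).smul (fun i => 2 * T i) hbpos 4 fun i => by
    rw [abs_of_nonneg (by positivity)]
    have := hpw i 1 2 (by norm_num)
    rw [pow_one] at this
    linarith [hT2 i]
  have hE := ((h1.add h2).add h3).dom (g := fun i ω =>
      (chainS (potentialDiff P ξ (r i)) (fun j => walk ξ j ω) (z i :: l i) (N i)
      - chainS (potentialDiff P ξ (r i)) (fun j => walk ξ j ω) (z i :: l' i) (N i))
      - (∑ j ∈ Finset.range (N i), martDiff (usum P ξ (T i)) (vsum P ξ (T i))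
        (fun i => walk ξ i ω) (chainW (potentialDiff P ξ (r i)) (fun i => walk ξ i ω) (l i)) (z i) j
      - ∑ j ∈ Finset.range (N i), martDiff (usum P ξ (T i)) (vsum P ξ (T i))
        (fun i => walk ξ i ω) (chainW (potentialDiff P ξ (r i)) (fun i => walk ξ i ω) (l' i))
        (z i) j)) (fun i => ((hmS l i).sub (hmS l' i)).sub (hMM.meas i)) fun i ω => ?_
  · refine (hE.add hMM).dom (fun i => (hmS l i).sub (hmS l' i)) fun i ω => ?_
    rw [sub_add_cancel]
  have hMb := hMb i ω
  set X : ℕ → Lattice := fun j => walk ξ j ω with hX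
  set g := potentialDiff P ξ (r i) with hgdef
  have hLb : ∀ j ≤ n i, |chainW g X (l i) j| ≤ lam ξ C (n i) ω ^ m :=
    hm i ▸ abs_chainW_le_lam hC1 (hg i) ω
  have hLb' : ∀ j ≤ n i, |chainW g X (l' i) j| ≤ lam ξ C (n i) ω ^ m :=
    hm' i ▸ abs_chainW_le_lam hC1 (hg' i) ω
  have hlam1 : 1 ≤ lam ξ C (n i) ω := one_le_lam hC1 _ _
  have hV : maxVisits X (n i) ≤ lam ξ C (n i) ω := maxVisits_le_lam hC1 _ _
  have hV0 := maxVisits_nonneg X (n i)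
  have hB : C * (1 + Real.log (n i)) ≤ lam ξ C (n i) ω := log_le_lam _ _
  generalize lam ξ C (n i) ω = lm at hLb hLb' hlam1 hV hB
  have hlm0 : 0 ≤ lm := zero_le_one.trans hlam1
  have hlog := Real.log_natCast_nonneg (n i)
  have hM0 : 0 ≤ M i ω := (abs_nonneg _).trans (hMb 0 (Nat.zero_le _))
  generalize M i ω = Mi at hMb hM0
  have hs1 := smoothPart_weights_le (c := vsum P ξ (T i) (z i) - g (z i)) (z := z i)
    (hS.kern_l1 (T i)) (fun s => hS.l1_diff_kern_cutoff hC (hT i) (hTn i) s) X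
    (chainW g X (l i)) (chainW g X (l' i)) (hb i) (hN i) hLb hLb' hMb
  have hc := hC.comp_le (n i) (T i) (r i) (z i) (hT i) (hTn i) (hr i) (hz i)
  have hf1 := finalPart_le (hS.vsum_l1 (T i)) X (chainW g X (l i)) (hN i) hLb (z i)
  have hf2 := finalPart_le (hS.vsum_l1 (T i)) X (chainW g X (l' i)) (hN i) hLb' (z i)
  set Q : ℝ := ∑ k ∈ Finset.range (n i + 1), blockDisp (b i) (T i) X k with hQdef
  have hQ0 : 0 ≤ Q := Finset.sum_nonneg fun k _ => cutoff_nonneg _ _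
  have hQe : ∑ k ∈ Finset.range (n i + 1),
      2 * (C * (1 + Real.log (n i))) * cutoff (T i) (X (b i * (k / b i)) - X k)
      = 2 * (C * (1 + Real.log (n i))) * Q := by
    rw [hQdef, Finset.mul_sum]
    refine Finset.sum_congr rfl fun k _ => ?_
    rw [blockDisp, ← cutoff_neg, neg_sub]
  rw [hQe] at hs1
  have hk1 : 2 * lm ^ m * (maxVisits X (n i) * (2 * (C * (1 + Real.log (n i))) * Q))
      ≤ 4 * (lm ^ (m + 2) * Q) := by
    calc _ ≤ 2 * lm ^ m * (lm * (2 * lm * Q)) := by gcongr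
      _ = _ := by ring
  have hw4 : 0 < w i ^ 4 := pow_pos (hw i) 4
  have hw4i : 1 ≤ (w i ^ 4)⁻¹ := (one_le_inv₀ hw4).2 (pow_le_one₀ (hw i).le (hw1 i))
  have hnb : ((n i / b i + 1 : ℕ) : ℝ) ≤ 2 * (w i ^ 4)⁻¹ := by
    have h4 : ((n i / b i : ℕ) : ℝ) ≤ (w i ^ 4)⁻¹ := by
      refine Nat.cast_div_le.trans ?_
      rw [div_le_iff₀ (by exact_mod_cast hb i)]
      have h5 := mul_le_mul_of_nonneg_left (hb1 i) (inv_pos.2 hw4).le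
      have h6 : (w i ^ 4)⁻¹ * (n i * w i ^ 4) = n i := by
        rw [mul_comm, mul_assoc, mul_inv_cancel₀ hw4.ne', mul_one]
      linarith
    push_cast
    linarith
  have hk2 : ((n i / b i + 1 : ℕ) : ℝ) * (2 * Mi * (maxVisits X (n i) * 1))
      + |vsum P ξ (T i) (z i) - g (z i)| * Mi ≤ 5 * (w i ^ 4)⁻¹ * (lm ^ 1 * Mi) := by
    calc _ ≤ 2 * (w i ^ 4)⁻¹ * (2 * Mi * (lm * 1)) + (w i ^ 4)⁻¹ * lm * Mi := by
          have h7 : |vsum P ξ (T i) (z i) - g (z i)| ≤ (w i ^ 4)⁻¹ * lm :=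
            (hc.trans hB).trans (le_mul_of_one_le_left hlm0 hw4i)
          gcongr
      _ = _ := by ring
  have hk3 : lm ^ m * (maxVisits X (n i) * (T i)) ≤ T i * lm ^ (m + 1) := by
    calc _ ≤ lm ^ m * (lm * T i) := by gcongr
      _ = _ := by ring
  have hfin : |4 * (lm ^ (m + 2) * Q) + 5 * (w i ^ 4)⁻¹ * (lm ^ 1 * Mi) + 2 * T i * lm ^ (m + 1)|
      = 4 * (lm ^ (m + 2) * Q) + 5 * (w i ^ 4)⁻¹ * (lm ^ 1 * Mi) + 2 * T i * lm ^ (m + 1) :=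
    abs_of_nonneg (by positivity)
  rw [hfin, hS.chainS_cons_kern g (T i), hS.chainS_cons_kern g (T i)]
  have e : ∀ a b c a' b' c' : ℝ, (a + b - c - (a' + b' - c')) - (b - b') = (a - a') - (c - c') :=
    fun a b c a' b' c' => by ring
  rw [e]
  refine (abs_sub _ _).trans ((add_le_add hs1
    ((abs_sub _ _).trans (add_le_add (hf1.trans hk3) (hf2.trans hk3)))).trans ?_)
  linarith

end IsPlanarStep

/-! ### Induction on the number of shifts -/

/-- The data of two chains that are to be compared. -/
structure ChainPair where
  n : ℕ
  N : ℕ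
  r : ℤ
  l : List Lattice
  l' : List Lattice
  u : ℝ

/-- Two chains of `m` shifts of size at most `2 √n` whose shifts differ by at most `4 u √n`. -/
structure ChainPair.Good (m : ℕ) (d : ChainPair) : Prop where
  one_le : 1 ≤ d.n
  le : d.N ≤ d.n
  round : |(d.r : ℝ) - Real.sqrt d.n| < 1
  length_eq : d.l.length = m
  length_eq' : d.l'.length = m
  sz_le : ∀ y ∈ d.l, sz y ≤ 2 * Real.sqrt d.n
  sz_le' : ∀ y ∈ d.l', sz y ≤ 2 * Real.sqrt d.n
  close : List.Forall₂ (fun z z' => sz (z - z') ≤ 4 * d.u * Real.sqrt d.n) d.l d.l'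
  inv_le : (Real.sqrt d.n)⁻¹ ≤ d.u
  le_one : d.u ≤ 1

lemma ChainPair.Good.cons {m : ℕ} {d : ChainPair} (h : d.Good (m + 1)) :
    ∃ z z' l l', d.l = z :: l ∧ d.l' = z' :: l' ∧ l.length = m ∧ l'.length = m ∧
      sz (z - z') ≤ 4 * d.u * Real.sqrt d.n ∧
      List.Forall₂ (fun z z' => sz (z - z') ≤ 4 * d.u * Real.sqrt d.n) l l' := by
  have h1 := h.length_eq
  have h2 := h.length_eq'
  have h3 := h.close
  revert h1 h2 h3
  rcases d.l with _ | ⟨z, l⟩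
  · intro h1; simp at h1
  rcases d.l' with _ | ⟨z', l'⟩
  · intro _ h2; simp at h2
  intro h1 h2 h3
  rw [List.forall₂_cons] at h3
  exact ⟨z, z', l, l', rfl, rfl, by simpa using h1, by simpa using h2, h3.1, h3.2⟩

lemma ChainPair.Good.u_pos {m : ℕ} {d : ChainPair} (h : d.Good m) : 0 < d.u :=
  (inv_pos.2 (Real.sqrt_pos.2 (by exact_mod_cast h.one_le))).trans_le h.inv_le

lemma ChainPair.Good.one_le_mul {m : ℕ} {d : ChainPair} (h : d.Good m) : 1 ≤ d.n * d.u := by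
  have hn : (1 : ℝ) ≤ d.n := by exact_mod_cast h.one_le
  have hs : 1 ≤ Real.sqrt d.n := Real.one_le_sqrt.2 hn
  have h1 : Real.sqrt d.n * Real.sqrt d.n = d.n := Real.mul_self_sqrt (by linarith)
  have h2 : (d.n : ℝ) * (Real.sqrt d.n)⁻¹ = Real.sqrt d.n := by
    nth_rewrite 1 [← h1]
    field_simp
  have h3 := mul_le_mul_of_nonneg_left h.inv_le (by linarith : (0 : ℝ) ≤ d.n)
  linarith

/-- The difference of the renormalized weights of two chains. -/
noncomputable def chainDiff (P : Measure Ω) (ξ : ℕ → Ω → Lattice) (d : ChainPair) (ω : Ω) : ℝ :=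
  chainS (potentialDiff P ξ d.r) (fun j => walk ξ j ω) d.l d.N
    - chainS (potentialDiff P ξ d.r) (fun j => walk ξ j ω) d.l' d.N

namespace IsPlanarStep

variable {P : Measure Ω} [IsProbabilityMeasure P] {ξ : ℕ → Ω → Lattice}

/-- With a single shift there is no inner chain, so no exponent is lost to the block argument: the
exponent is `1/2`. -/
lemma momO_chainDiff_one (hS : IsPlanarStep P ξ) {C : ℝ} (hC : KernelBounds P ξ C) :
    MomO P (fun d : {d : ChainPair // d.Good 1} => d.1.n) (fun d => chainDiff P ξ d.1)
      (fun d => d.1.n * Real.sqrt d.1.u) := by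
  choose z z' l l' hl hl' hlen hlen' hzz hcl using fun d : {d : ChainPair // d.Good 1} => d.2.cons
  have hnil : ∀ d, l d = [] := fun d => List.length_eq_zero_iff.1 (hlen d)
  have hnil' : ∀ d, l' d = [] := fun d => List.length_eq_zero_iff.1 (hlen' d)
  have h := hS.momO_chainS_head hC (ι := {d : ChainPair // d.Good 1}) 0 (n := fun d => d.1.n)
    (N := fun d => d.1.N) (r := fun d => d.1.r) (l := l) (z := z) (z' := z') (u := fun d => d.1.u)
    (fun d => d.2.one_le) (fun d => d.2.le) (fun d => d.2.round) hlen
    (fun d y hy => by rw [hnil] at hy; simp at hy) hzz (fun d => d.2.inv_le) fun d => d.2.le_one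
  have e : (fun d : {d : ChainPair // d.Good 1} => chainDiff P ξ d.1) = fun d ω =>
      chainS (potentialDiff P ξ d.1.r) (fun j => walk ξ j ω) (z d :: l d) d.1.N
      - chainS (potentialDiff P ξ d.1.r) (fun j => walk ξ j ω) (z' d :: l d) d.1.N := by
    funext d ω
    rw [chainDiff, hl, hl', hnil, hnil']
  rw [e]
  exact h

/-- The last shift is changed first, at cost `n √u`, then the others with the last one fixed. The
second step needs the inner difference for all end times at once, hence the maximum over `N ≤ n`.
With `w^8` equal to the inductive power of `u`, the exponent is divided by `8`. -/
lemma momO_chainDiff (hS : IsPlanarStep P ξ) {C : ℝ} (hC : KernelBounds P ξ C) (m : ℕ) :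
    MomO P (fun d : {d : ChainPair // d.Good m} => d.1.n) (fun d => chainDiff P ξ d.1)
      (fun d => d.1.n * d.1.u ^ ((8 : ℝ) ^ (m + 1))⁻¹) := by
  induction m with
  | zero =>
    have e : (fun d : {d : ChainPair // d.Good 0} => chainDiff P ξ d.1) = fun _ _ => 0 := by
      funext d ω
      rw [chainDiff, List.length_eq_zero_iff.1 d.2.length_eq, List.length_eq_zero_iff.1 d.2.length_eq',
        sub_self]
    rw [e]
    refine MomO.zero (fun d => ?_) fun d => d.2.one_le
    have : (0 : ℝ) < d.1.n := by exact_mod_cast d.2.one_le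
    have := d.2.u_pos
    positivity
  | succ m ih =>
    let ι := {d : ChainPair // d.Good (m + 1)}
    choose z z' l l' hl hl' hlen hlen' hzz hcl using fun d : ι => d.2.cons
    have hpos : ∀ d : ι, 0 < d.1.u := fun d => d.2.u_pos
    have hn0 : ∀ d : ι, (0 : ℝ) < d.1.n := fun d => by exact_mod_cast d.2.one_le
    have hbd : ∀ d : ι, ∀ y ∈ l d, sz y ≤ 2 * Real.sqrt d.1.n := fun d y hy =>
      d.2.sz_le y (by rw [hl]; exact List.mem_cons_of_mem _ hy)
    have hbd' : ∀ d : ι, ∀ y ∈ l' d, sz y ≤ 2 * Real.sqrt d.1.n := fun d y hy =>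
      d.2.sz_le' y (by rw [hl']; exact List.mem_cons_of_mem _ hy)
    set w : ι → ℝ := fun d => d.1.u ^ ((8 : ℝ) ^ (m + 1 + 1))⁻¹ with hwdef
    have hw : ∀ d, 0 < w d := fun d => Real.rpow_pos_of_pos (hpos d) _
    have hw1 : ∀ d, w d ≤ 1 := fun d => Real.rpow_le_one (hpos d).le d.2.le_one (by positivity)
    have hw8 : ∀ d, w d ^ 8 = d.1.u ^ ((8 : ℝ) ^ (m + 1))⁻¹ := fun d => by
      rw [hwdef, ← Real.rpow_natCast, ← Real.rpow_mul (hpos d).le]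
      congr 1
      rw [pow_succ (8 : ℝ) (m + 1)]
      push_cast
      field_simp
    have h8 : (8 : ℝ) ≤ 8 ^ (m + 1 + 1) := by
      calc (8 : ℝ) = 8 ^ 1 := by norm_num
        _ ≤ 8 ^ (m + 1 + 1) := pow_le_pow_right₀ (by norm_num) (by omega)
    have h8i : ((8 : ℝ) ^ (m + 1 + 1))⁻¹ ≤ 1 / 8 := by
      rw [one_div]; exact inv_anti₀ (by norm_num) h8
    -- `w^4` is a power of `u ≤ 1` with exponent at most `1/2`, so it is at least `u`, and `n u ≥
    -- 1`.
    have hnw : ∀ d : ι, 1 ≤ d.1.n * w d ^ 4 := fun d => by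
      refine d.2.one_le_mul.trans ?_
      refine mul_le_mul_of_nonneg_left ?_ (hn0 d).le
      rw [hwdef, ← Real.rpow_natCast, ← Real.rpow_mul (hpos d).le]
      nth_rewrite 1 [← Real.rpow_one d.1.u]
      refine Real.rpow_le_rpow_of_exponent_ge (hpos d) d.2.le_one ?_
      push_cast
      linarith
    have hgood : ∀ x : Σ d : ι, Fin (d.1.n + 1),
        (ChainPair.mk x.1.1.n x.2 x.1.1.r (l x.1) (l' x.1) x.1.1.u).Good m := fun x =>
      ⟨x.1.2.one_le, Nat.lt_succ_iff.1 x.2.2, x.1.2.round, hlen x.1, hlen' x.1, hbd x.1, hbd' x.1,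
        hcl x.1, x.1.2.inv_le, x.1.2.le_one⟩
    have hsup := MomO.sup (n := fun d : ι => d.1.n)
      (b := fun d : ι => d.1.n * d.1.u ^ ((8 : ℝ) ^ (m + 1))⁻¹) (fun d => d.2.one_le)
      (ih.comp (fun x : Σ d : ι, Fin (d.1.n + 1) =>
        (⟨ChainPair.mk x.1.1.n x.2 x.1.1.r (l x.1) (l' x.1) x.1.1.u, hgood x⟩ :
          {d : ChainPair // d.Good m})))
      (fun d => mul_pos (hn0 d) (Real.rpow_pos_of_pos (hpos d) _))
    simp only [← hw8] at hsup
    have htail := hS.momO_chainS_tail hC m (n := fun d : ι => d.1.n) (N := fun d => d.1.N)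
      (r := fun d => d.1.r) (l := l) (l' := l') (z := z') (w := w)
      (fun d => d.2.one_le) (fun d => d.2.le) (fun d => d.2.round) hlen hlen' hbd hbd'
      (fun d => d.2.sz_le' _ (by rw [hl']; exact List.mem_cons_self)) hw hw1 hnw hsup
      (fun d ω k hk => by
        have := Finset.le_sup' (s := (Finset.univ : Finset (Fin (d.1.n + 1)))) (fun N =>
          |chainDiff P ξ (ChainPair.mk d.1.n N d.1.r (l d) (l' d) d.1.u) ω|)
          (Finset.mem_univ (⟨k, Nat.lt_succ_iff.2 hk⟩ : Fin (d.1.n + 1)))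
        exact this)
    have hhead := (hS.momO_chainS_head hC m (n := fun d : ι => d.1.n) (N := fun d => d.1.N)
      (r := fun d => d.1.r) (l := l) (z := z) (z' := z') (u := fun d => d.1.u)
      (fun d => d.2.one_le) (fun d => d.2.le) (fun d => d.2.round) hlen hbd hzz
      (fun d => d.2.inv_le) (fun d => d.2.le_one)).mono (b' := fun d => d.1.n * w d)
      (fun d => mul_pos (hn0 d) (hw d)) 1 fun d => by
        rw [one_mul]
        refine mul_le_mul_of_nonneg_left ?_ (hn0 d).le
        rw [Real.sqrt_eq_rpow]
        exact Real.rpow_le_rpow_of_exponent_ge (hpos d) d.2.le_one (by linarith)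
    have e : (fun d : ι => chainDiff P ξ d.1) = fun d ω =>
        (chainS (potentialDiff P ξ d.1.r) (fun j => walk ξ j ω) (z d :: l d) d.1.N
          - chainS (potentialDiff P ξ d.1.r) (fun j => walk ξ j ω) (z' d :: l d) d.1.N)
        + (chainS (potentialDiff P ξ d.1.r) (fun j => walk ξ j ω) (z' d :: l d) d.1.N
          - chainS (potentialDiff P ξ d.1.r) (fun j => walk ξ j ω) (z' d :: l' d) d.1.N) := by
      funext d ω
      rw [chainDiff, hl, hl']
      ring
    rw [e]
    exact hhead.add htail

end IsPlanarStep

/-! ### From intersection counts to chain weights -/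

/-- Deleting shifts: the renormalized weight in terms of the plain ones. -/
lemma chainW_eq_sum_powerset {ι : Type*} [DecidableEq ι] (g : Lattice → ℝ) (X : ℕ → Lattice)
    (y : ι → Lattice) (I : List ι) (hI : I.Nodup) : ∀ j : ℕ,
    chainW g X (I.map y) j = ∑ A ∈ I.toFinset.powerset, (-1 : ℝ) ^ A.card * (∏ i ∈ A, g (y i)) *
      chainW (fun _ => 0) X ((I.filter (fun i => i ∉ A)).map y) j := by
  induction I with
  | nil => intro j; simp [chainW]
  | cons a I ih =>
    intro j
    rw [List.nodup_cons] at hI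
    have ih' := ih hI.2
    have ha : a ∉ I.toFinset := by simpa using hI.1
    -- Subsets without `a` keep the link `y a` and give the sum over `i`; subsets containing `a`
    -- delete it and give the term with `-g (y a)`.
    rw [List.toFinset_cons, Finset.sum_powerset_insert ha, List.map_cons, chainW]
    rw [sub_eq_add_neg]
    congr 1
    · simp only [ih']
      simp only [Finset.sum_mul]
      rw [Finset.sum_comm]
      refine Finset.sum_congr rfl fun A hA => ?_
      have haA : a ∉ A := fun h => ha (Finset.mem_powerset.1 hA h)
      rw [List.filter_cons_of_pos (by simpa using haA), List.map_cons, chainW, zero_mul, sub_zero,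
        Finset.mul_sum]
      exact Finset.sum_congr rfl fun i _ => by ring
    · rw [ih', Finset.mul_sum, ← Finset.sum_neg_distrib]
      refine Finset.sum_congr rfl fun A hA => ?_
      have haA : a ∉ A := fun h => ha (Finset.mem_powerset.1 hA h)
      rw [List.filter_cons_of_neg (by simp), Finset.card_insert_of_notMem haA,
        Finset.prod_insert haA]
      have e : I.filter (fun i => i ∉ insert a A) = I.filter (fun i => i ∉ A) := by
        refine List.filter_congr fun i hi => ?_
        have : i ≠ a := fun h => hI.1 (h ▸ hi)
        simp [this]
      rw [e, pow_succ]
      ring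

lemma ofFn_deleteEntries {m : ℕ} (A : Finset (Fin m)) (y : Fin m → Lattice) :
    List.ofFn (deleteEntries A y) = ((List.finRange m).filter (fun i => i ∉ A)).map y := by
  have h1 : List.ofFn (deleteEntries A y) = (List.ofFn (Aᶜ.orderEmbOfFin rfl)).map y := by
    rw [List.map_ofFn]
    rfl
  rw [h1, List.ofFn_eq_map, Finset.listMap_orderEmbOfFin_finRange]
  congr 1
  refine (Finset.sortedLT_sort _).eq_of_mem_iff ?_ fun i => by simp
  exact (List.Pairwise.filter _ (List.sortedLT_finRange m).pairwise).sortedLT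

lemma sum_fin_lt (n : ℕ) (k : Fin (n + 1)) (f : ℕ → ℝ) :
    ∑ a : Fin (n + 1), (if a < k then f a else 0) = ∑ i ∈ Finset.range k, f i := by
  have h := Fin.sum_univ_eq_sum_range (fun i => if i < (k : ℕ) then f i else 0) (n + 1)
  simp only [Fin.lt_def]
  rw [h, ← Finset.sum_filter]
  congr 1
  ext i
  have := k.2
  simp only [Finset.mem_filter, Finset.mem_range]
  omega

open scoped Classical in
lemma strictMono_snoc {m n : ℕ} (i : Fin (m + 1) → Fin (n + 1)) (k : Fin (n + 1)) :
    StrictMono (Fin.snoc i k : Fin (m + 2) → Fin (n + 1)) ↔ StrictMono i ∧ i (Fin.last m) < k := by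
  rw [Fin.strictMono_iff_lt_succ, Fin.strictMono_iff_lt_succ, Fin.forall_fin_succ']
  simp only [Fin.snoc_castSucc, Fin.succ_last, Fin.snoc_last, Fin.succ_castSucc]

open scoped Classical in
/-- The weighted number of increasing chains, sorted by their last time. -/
lemma sum_strictMono_eq (X : ℕ → Lattice) (n m : ℕ) : ∀ (y : Fin m → Lattice)
    (F : Fin (n + 1) → ℝ),
    ∑ i : Fin (m + 1) → Fin (n + 1), (if StrictMono i then (1 : ℝ) else 0) *
      (∏ j : Fin m, if X (i j.succ) = X (i j.castSucc) + y j then (1 : ℝ) else 0) * F (i (Fin.last m))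
      = ∑ k : Fin (n + 1), chainW (fun _ => 0) X (List.ofFn y).reverse k * F k := by
  induction m with
  | zero =>
    intro y F
    rw [← (Equiv.funUnique (Fin 1) (Fin (n + 1))).symm.sum_comp]
    refine Finset.sum_congr rfl fun k _ => ?_
    have h : StrictMono ((Equiv.funUnique (Fin 1) (Fin (n + 1))).symm k) :=
      Subsingleton.strictMono _
    rw [if_pos h]
    simp [chainW]
  | succ m ih =>
    intro y F
    rw [← (Fin.snocEquiv fun _ : Fin (m + 2) => Fin (n + 1)).sum_comp, Fintype.sum_prod_type]
    refine Finset.sum_congr rfl fun k _ => ?_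
    -- The last link and the condition that the previous time is below `k` become part of the weight
    -- `F`; arbitrary weights in the statement make this possible.
    have h1 := ih (fun j => y j.castSucc) (fun a => (if a < k then
      (if X k = X a + y (Fin.last m) then (1 : ℝ) else 0) else 0) * F k)
    have e : ∀ i : Fin (m + 1) → Fin (n + 1),
        (if StrictMono (Fin.snocEquiv (fun _ : Fin (m + 2) => Fin (n + 1)) (k, i)) then (1 : ℝ) else 0)
        * (∏ j : Fin (m + 1),
          if X (Fin.snocEquiv (fun _ : Fin (m + 2) => Fin (n + 1)) (k, i) j.succ)
            = X (Fin.snocEquiv (fun _ : Fin (m + 2) => Fin (n + 1)) (k, i) j.castSucc) + y j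
          then (1 : ℝ) else 0)
        * F (Fin.snocEquiv (fun _ : Fin (m + 2) => Fin (n + 1)) (k, i) (Fin.last (m + 1)))
        = (if StrictMono i then (1 : ℝ) else 0) *
          (∏ j : Fin m, if X (i j.succ) = X (i j.castSucc) + y j.castSucc then (1 : ℝ) else 0) *
          ((if i (Fin.last m) < k then
            (if X k = X (i (Fin.last m)) + y (Fin.last m) then (1 : ℝ) else 0) else 0) * F k) := by
      intro i
      have h2 : Fin.snocEquiv (fun _ : Fin (m + 2) => Fin (n + 1)) (k, i) = Fin.snoc i k := rfl
      rw [h2, Fin.prod_univ_castSucc]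
      simp only [strictMono_snoc, Fin.succ_castSucc, Fin.snoc_castSucc, Fin.succ_last, Fin.snoc_last]
      by_cases h3 : StrictMono i <;> by_cases h4 : i (Fin.last m) < k <;> simp [h3, h4]
    rw [Finset.sum_congr rfl fun i _ => e i, h1, List.ofFn_succ', List.concat_eq_append,
      List.reverse_append, List.reverse_singleton, List.singleton_append, chainW, zero_mul, sub_zero,
      ← sum_fin_lt n k, Finset.sum_mul]
    refine Finset.sum_congr rfl fun a _ => ?_
    by_cases h4 : a < k
    · simp only [h4, if_true, sub_eq_iff_eq_add']
      split_ifs <;> ring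
    · simp [h4]

/-- For `m = 0` the convention is `B_1 = n`, whereas the times `0, …, n` number `n + 1`; hence the
correction by `1`. -/
lemma intersectionCount_eq {m : ℕ} (ξ : ℕ → Ω → Lattice) (n : ℕ) (y : Fin m → Lattice) (ω : Ω) :
    intersectionCount ξ n y ω
      = chainS (fun _ => 0) (fun i => walk ξ i ω) (List.ofFn y).reverse n - if m = 0 then 1 else 0 := by
  unfold intersectionCount chainS
  split_ifs with hm
  · subst hm
    simp [chainW]
  · have h := sum_strictMono_eq (fun i => walk ξ i ω) n m y (fun _ => 1)
    simp only [mul_one] at h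
    rw [Fin.sum_univ_eq_sum_range
      (fun k => chainW (fun _ => 0) (fun i => walk ξ i ω) (List.ofFn y).reverse k)] at h
    rw [← h, sub_zero, Finset.sum_filter]
    refine Finset.sum_congr rfl fun i _ => ?_
    split_ifs <;> simp

/-- The correction of `intersectionCount_eq` appears only when all indices are deleted, so it
contributes one deterministic product. -/
lemma renormCount_eq {m : ℕ} (P : Measure Ω) (ξ : ℕ → Ω → Lattice) (r : ℤ) (n : ℕ)
    (y : Fin m → Lattice) (ω : Ω) :
    renormCount P ξ r n y ω
      = chainS (potentialDiff P ξ r) (fun i => walk ξ i ω) (List.ofFn y).reverse n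
        - (-1) ^ m * ∏ i, potentialDiff P ξ r (y i) := by
  unfold renormCount
  simp only [intersectionCount_eq, mul_sub, Finset.sum_sub_distrib]
  congr 1
  · have h1 : (List.ofFn y).reverse = ((List.finRange m).reverse).map y := by
      rw [List.ofFn_eq_map, List.map_reverse]
    unfold chainS
    simp only [Finset.mul_sum]
    rw [Finset.sum_comm]
    refine Finset.sum_congr rfl fun j _ => ?_
    rw [h1, chainW_eq_sum_powerset _ _ y _ (List.nodup_reverse.2 (List.nodup_finRange m))]
    have h2 : ((List.finRange m).reverse).toFinset = Finset.univ := by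
      ext i; simp
    rw [h2, Finset.powerset_univ]
    refine Finset.sum_congr rfl fun A _ => ?_
    rw [ofFn_deleteEntries, List.filter_reverse, List.map_reverse]
  · rw [Finset.sum_eq_single Finset.univ]
    · simp
    · intro A _ hA
      have : Aᶜ.card ≠ 0 := by
        rw [Ne, Finset.card_eq_zero]
        intro h
        exact hA (by rw [← compl_compl A, h, Finset.compl_empty])
      simp [this]
    · intro h; exact absurd (Finset.mem_univ _) h

/-! ### Scaled points and the final estimate -/

lemma scaledPoint_sub {m : ℕ} (n : ℕ) (y y' : Fin m → Lattice) :
    scaledPoint n y - scaledPoint n y' = scaledPoint n (fun j => y j - y' j) := by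
  ext j a
  simp [scaledPoint, toPlane, mul_sub]

lemma abs_coord_le_scaledPoint {m n : ℕ} (hn : 1 ≤ n) (y : Fin m → Lattice) (j : Fin m)
    (a : Fin 2) : |(y j a : ℝ)| ≤ Real.sqrt n * ‖scaledPoint n y‖ := by
  have hs : 0 < Real.sqrt n := Real.sqrt_pos.2 (by exact_mod_cast hn)
  have h1 := PiLp.norm_apply_le (scaledPoint n y) j
  have h2 := PiLp.norm_apply_le (scaledPoint n y j) a
  have e : (scaledPoint n y j) a = (Real.sqrt n)⁻¹ * (y j a : ℝ) := by
    simp [scaledPoint, toPlane]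
  rw [e, Real.norm_eq_abs, abs_mul, abs_of_pos (inv_pos.2 hs)] at h2
  have h3 := mul_le_mul_of_nonneg_left (h2.trans h1) hs.le
  rwa [← mul_assoc, mul_inv_cancel₀ hs.ne', one_mul] at h3

lemma sz_le_scaledPoint {m n : ℕ} (hn : 1 ≤ n) (y : Fin m → Lattice) (j : Fin m) :
    sz (y j) ≤ 2 * (Real.sqrt n * ‖scaledPoint n y‖) := by
  unfold sz
  linarith [abs_coord_le_scaledPoint hn y j 0, abs_coord_le_scaledPoint hn y j 1]

lemma inv_sqrt_le_norm_scaledPoint {m n : ℕ} (hn : 1 ≤ n) {y : Fin m → Lattice} (hy : y ≠ 0) :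
    (Real.sqrt n)⁻¹ ≤ ‖scaledPoint n y‖ := by
  obtain ⟨j, hj⟩ := Function.ne_iff.1 hy
  obtain ⟨a, ha⟩ := Function.ne_iff.1 hj
  have hs : 0 < Real.sqrt n := Real.sqrt_pos.2 (by exact_mod_cast hn)
  have h1 : (1 : ℝ) ≤ |(y j a : ℝ)| := by
    exact_mod_cast Int.one_le_abs (show y j a ≠ 0 from ha)
  rw [inv_le_iff_one_le_mul₀ hs, mul_comm]
  exact h1.trans (abs_coord_le_scaledPoint hn y j a)

lemma abs_prod_map_le {g : Lattice → ℝ} {B : ℝ} (l : List Lattice) (hl : ∀ z ∈ l, |g z| ≤ B) :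
    |(l.map g).prod| ≤ B ^ l.length := by
  induction l with
  | nil => simp
  | cons z l ih =>
    rw [List.map_cons, List.prod_cons, abs_mul, List.length_cons, pow_succ']
    have hz := hl z List.mem_cons_self
    exact mul_le_mul hz (ih fun y hy => hl y (List.mem_cons_of_mem _ hy)) (abs_nonneg _)
      ((abs_nonneg _).trans hz)

/-- The difference of two renormalized counts. -/
noncomputable def renormDiff (P : Measure Ω) (ξ : ℕ → Ω → Lattice) (m : ℕ) (d : ChainPair) (ω : Ω) :
    ℝ :=
  chainDiff P ξ d ω + (-(-1) ^ m) *
    ((d.l.map (potentialDiff P ξ d.r)).prod - (d.l'.map (potentialDiff P ξ d.r)).prod)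

namespace IsPlanarStep

variable {P : Measure Ω} [IsProbabilityMeasure P] {ξ : ℕ → Ω → Lattice}

/-- The deterministic products are at most `lam^m` each, and the target scale is at least `1`, since
`n u^α ≥ n u ≥ 1`. -/
lemma momO_renormDiff (hS : IsPlanarStep P ξ) {C : ℝ} (hC : KernelBounds P ξ C) {m : ℕ} {α : ℝ}
    (hα : α ≤ 1) (h : MomO P (fun d : {d : ChainPair // d.Good m} => d.1.n)
      (fun d => chainDiff P ξ d.1) (fun d => d.1.n * d.1.u ^ α)) :
    MomO P (fun d : {d : ChainPair // d.Good m} => d.1.n) (fun d => renormDiff P ξ m d.1)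
      (fun d => d.1.n * d.1.u ^ α) := by
  refine h.add ?_
  refine ((hS.momO_lam_pow hC (fun d : {d : ChainPair // d.Good m} => d.2.one_le) m).smul
    (fun _ => 2) h.pos 2 fun d => ?_).dom (fun d => measurable_const) fun d ω => ?_
  · have h1 : (d.1.n : ℝ) * d.1.u ≤ d.1.n * d.1.u ^ α := by
      refine mul_le_mul_of_nonneg_left ?_ (Nat.cast_nonneg _)
      nth_rewrite 1 [← Real.rpow_one d.1.u]
      exact Real.rpow_le_rpow_of_exponent_ge d.2.u_pos d.2.le_one hα
    rw [abs_of_nonneg (by norm_num)]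
    linarith [d.2.one_le_mul]
  · have hlog := Real.log_natCast_nonneg d.1.n
    have hB : C * (1 + Real.log d.1.n) ≤ lam ξ C d.1.n ω := log_le_lam _ _
    have hlam := zero_le_one.trans (one_le_lam (ξ := ξ) hC.one_le d.1.n ω)
    have h1 := abs_prod_map_le d.1.l fun z hz =>
      (hC.potentialDiff_le _ d.1.r z d.2.one_le d.2.round (d.2.sz_le z hz)).trans hB
    have h2 := abs_prod_map_le d.1.l' fun z hz =>
      (hC.potentialDiff_le _ d.1.r z d.2.one_le d.2.round (d.2.sz_le' z hz)).trans hB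
    rw [d.2.length_eq] at h1
    rw [d.2.length_eq'] at h2
    rw [abs_of_nonneg (a := 2 * _) (by positivity), abs_mul, abs_neg, abs_pow, abs_neg, abs_one,
      one_pow, one_mul, two_mul]
    exact (abs_sub _ _).trans (add_le_add h1 h2)

lemma exists_integral_renormLocalTime_le (hS : IsPlanarStep P ξ) {C : ℝ} (hC : KernelBounds P ξ C)
    {m : ℕ} {α : ℝ} (hα0 : 0 ≤ α) (hα : α ≤ 1)
    (h : MomO P (fun d : {d : ChainPair // d.Good m} => d.1.n)
      (fun d => chainDiff P ξ d.1) (fun d => d.1.n * d.1.u ^ α)) (p : ℕ) (hp : p ≠ 0) :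
    ∃ K : ℝ, 0 ≤ K ∧ ∀ n : ℕ, 1 ≤ n → ∀ r : ℤ, |(r : ℝ) - Real.sqrt n| < 1 →
      ∀ y y' : Fin m → Lattice, ‖scaledPoint n y‖ ≤ 1 → ‖scaledPoint n y'‖ ≤ 1 →
        Integrable
          (fun ω => |renormLocalTime P ξ r n y ω - renormLocalTime P ξ r n y' ω| ^ p) P ∧
        ∫ ω, |renormLocalTime P ξ r n y ω - renormLocalTime P ξ r n y' ω| ^ p ∂P
          ≤ K * n * ‖scaledPoint n y - scaledPoint n y'‖ ^ (α * (p : ℝ)) := by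
  obtain ⟨K, hK, hKb⟩ := (hS.momO_renormDiff hC hα h).exists_integral_le p
  refine ⟨K, hK, fun n hn r hr y y' hy hy' => ?_⟩
  -- For equal points both sides vanish or are nonnegative, as `p ≠ 0`. Distinct lattice points are
  -- at scaled distance at least `1/√n`, as the estimates for chains require.
  by_cases hyy : y = y'
  · subst hyy
    simp only [sub_self, abs_zero, zero_pow hp, integral_zero]
    exact ⟨integrable_zero _ _ _, by positivity⟩
  have hn0 : (0 : ℝ) < n := by exact_mod_cast hn
  have hs1 : 1 ≤ Real.sqrt n := Real.one_le_sqrt.2 (by exact_mod_cast hn)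
  have hs0 := zero_le_one.trans hs1
  set ν : ℝ := ‖scaledPoint n y - scaledPoint n y'‖ with hν
  have hνlow : (Real.sqrt n)⁻¹ ≤ ν := by
    rw [hν, scaledPoint_sub]
    refine inv_sqrt_le_norm_scaledPoint hn fun h0 => hyy ?_
    funext j
    exact sub_eq_zero.1 (congrFun h0 j)
  have hν0 : 0 ≤ ν := norm_nonneg _
  have hsz : ∀ w : Fin m → Lattice, ‖scaledPoint n w‖ ≤ 1 → ∀ j, sz (w j) ≤ 2 * Real.sqrt n :=
    fun w hw j => (sz_le_scaledPoint hn w j).trans (by nlinarith)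
  have hmem : ∀ w : Fin m → Lattice, ‖scaledPoint n w‖ ≤ 1 →
      ∀ z ∈ (List.ofFn w).reverse, sz z ≤ 2 * Real.sqrt n := by
    intro w hw z hz
    rw [List.mem_reverse, List.mem_ofFn] at hz
    obtain ⟨j, rfl⟩ := hz
    exact hsz w hw j
  -- The scaled distance may reach `2`, so it is cut at `1`; beyond `1` the size bounds of the two
  -- points suffice.
  have hclose : ∀ j, sz (y j - y' j) ≤ 4 * min ν 1 * Real.sqrt n := by
    intro j
    rcases le_total ν 1 with h1 | h1
    · rw [min_eq_left h1]
      have := sz_le_scaledPoint hn (fun j => y j - y' j) j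
      rw [← scaledPoint_sub] at this
      have h2 : 0 ≤ Real.sqrt n * ν := mul_nonneg hs0 hν0
      linarith
    · rw [min_eq_right h1]
      have := sz_sub_le (y j) (y' j)
      linarith [hsz y hy j, hsz y' hy' j]
  have hgood : (ChainPair.mk n n r (List.ofFn y).reverse (List.ofFn y').reverse (min ν 1)).Good m :=
    { one_le := hn
      le := le_rfl
      round := hr
      length_eq := by simp
      length_eq' := by simp
      sz_le := hmem y hy
      sz_le' := hmem y' hy'
      close := by
        rw [List.forall₂_reverse_iff]
        rw [List.forall₂_iff_get]
        exact ⟨by simp, fun i h1 h2 => by simpa using hclose _⟩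
      inv_le := le_min hνlow (inv_le_one_of_one_le₀ hs1)
      le_one := min_le_right _ _ }
  obtain ⟨hi, hb⟩ := hKb ⟨_, hgood⟩
  have hprod : ∀ w : Fin m → Lattice, ∏ i, potentialDiff P ξ r (w i)
      = ((List.ofFn w).reverse.map (potentialDiff P ξ r)).prod := fun w => by
    rw [List.map_reverse, List.prod_reverse, List.map_ofFn, List.prod_ofFn]
    rfl
  have e : ∀ ω, |renormLocalTime P ξ r n y ω - renormLocalTime P ξ r n y' ω| ^ p
      = ((n : ℝ) ^ p)⁻¹ * |renormDiff P ξ m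
        (ChainPair.mk n n r (List.ofFn y).reverse (List.ofFn y').reverse (min ν 1)) ω| ^ p := by
    intro ω
    rw [renormLocalTime, renormLocalTime, ← mul_sub, abs_mul, mul_pow, one_div, abs_inv,
      Nat.abs_cast, inv_pow, renormCount_eq, renormCount_eq, renormDiff, chainDiff, hprod, hprod]
    congr 3
    ring
  simp only [e]
  refine ⟨hi.const_mul _, ?_⟩
  rw [integral_const_mul]
  have hu0 : 0 < min ν 1 := hgood.u_pos
  calc _ ≤ ((n : ℝ) ^ p)⁻¹ * (K * n * (n * (min ν 1) ^ α) ^ p) := by gcongr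
    _ = K * n * ((min ν 1) ^ α) ^ p := by
      rw [mul_pow]
      field_simp
    _ = K * n * (min ν 1) ^ (α * (p : ℝ)) := by
      rw [Real.rpow_mul hu0.le, Real.rpow_natCast]
    _ ≤ _ := by
      gcongr
      exact min_le_left _ _

end IsPlanarStep

/-- For `n ≥ 2` the logarithm is at least `log 2`, so logarithmic factors may be inserted into an
upper bound. -/
lemma le_mul_log_pow {K : ℝ} (hK : 0 ≤ K) {n : ℕ} (hn : 2 ≤ n) (q : ℕ) :
    K ≤ K / Real.log 2 ^ q * Real.log n ^ q := by
  have h2 : 0 < Real.log 2 := Real.log_pos (by norm_num)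
  have h3 : Real.log 2 ≤ Real.log n := Real.log_le_log (by norm_num) (by exact_mod_cast hn)
  rw [div_mul_eq_mul_div, le_div_iff₀ (by positivity)]
  gcongr

end RWIntersection

open RWIntersection in
theorem proposition7p1 {Ω : Type*} [MeasurableSpace Ω] (P : Measure Ω) [IsProbabilityMeasure P]
    (ξ : ℕ → Ω → Lattice)
    (hmeas : ∀ i, Measurable (ξ i))
    (hindep : iIndepFun ξ P)
    (hident : ∀ i, IdentDistrib (ξ i) (ξ 0) P P)
    (hsymm : IdentDistrib (ξ 0) (fun ω => -ξ 0 ω) P P)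
    (δ : ℝ) (hδ : 0 < δ)
    (hmoment : Integrable (fun ω => ‖toPlane (ξ 0 ω)‖ ^ (2 + δ)) P)
    (hmean : ∀ a : Fin 2, ∫ ω, (ξ 0 ω a : ℝ) ∂P = 0)
    (hcov : ∀ a b : Fin 2, ∫ ω, (ξ 0 ω a : ℝ) * (ξ 0 ω b : ℝ) ∂P = if a = b then 1 else 0)
    (haper : StronglyAperiodic P (ξ 0)) :
    (∀ z : Lattice, Summable (potentialTerm P ξ z)) ∧
    ∀ k : ℕ, 2 ≤ k → ∀ p : ℕ, 1 < p → ∃ c : ℝ, 0 < c ∧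
      ∀ n : ℕ, 2 ≤ n → ∀ r : ℤ, |(r : ℝ) - Real.sqrt n| < 1 →
      ∀ y y' : Fin (k - 1) → Lattice, ‖scaledPoint n y‖ ≤ 1 → ‖scaledPoint n y'‖ ≤ 1 →
        Integrable
          (fun ω => |renormLocalTime P ξ r n y ω - renormLocalTime P ξ r n y' ω| ^ p) P ∧
        ∫ ω, |renormLocalTime P ξ r n y ω - renormLocalTime P ξ r n y' ω| ^ p ∂P
          ≤ c * Real.log n ^ (p * (k - 1)) * (n : ℝ) ^ k *
            ‖scaledPoint n y - scaledPoint n y'‖ ^ (((8 : ℝ) ^ k)⁻¹ * (p : ℝ)) ∧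
        (k = 2 →
          ∫ ω, |renormLocalTime P ξ r n y ω - renormLocalTime P ξ r n y' ω| ^ p ∂P
            ≤ c * Real.log n ^ p * (n : ℝ) *
              ‖scaledPoint n y - scaledPoint n y'‖ ^ ((p : ℝ) / 3)) := by
  have hS : IsPlanarStep P ξ := ⟨hmeas, hindep, hident, hsymm, hcov, haper⟩
  obtain ⟨C, hC⟩ := hS.exists_kernelBounds
  refine ⟨hC.summable, fun k hk p hp => ?_⟩
  have hk1 : k - 1 + 1 = k := by omega
  have hMom := hS.momO_chainDiff hC (k - 1)
  rw [hk1] at hMom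
  have h8 : ((8 : ℝ) ^ k)⁻¹ ≤ 1 := inv_le_one_of_one_le₀ (one_le_pow₀ (by norm_num))
  obtain ⟨K, hK, hb⟩ := hS.exists_integral_renormLocalTime_le hC (by positivity) h8 hMom p (by omega)
  -- Since `u ≤ 1`, the exponent `1/2` may be weakened to `1/3`.
  have hMom1 : MomO P (fun d : {d : ChainPair // d.Good 1} => d.1.n) (fun d => chainDiff P ξ d.1)
      (fun d => d.1.n * d.1.u ^ (1 / 3 : ℝ)) := by
    refine (hS.momO_chainDiff_one hC).mono (fun d => ?_) 1 fun d => ?_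
    · have : (0 : ℝ) < d.1.n := by exact_mod_cast d.2.one_le
      exact mul_pos this (Real.rpow_pos_of_pos d.2.u_pos _)
    · rw [one_mul, Real.sqrt_eq_rpow]
      exact mul_le_mul_of_nonneg_left
        (Real.rpow_le_rpow_of_exponent_ge d.2.u_pos d.2.le_one (by norm_num)) (Nat.cast_nonneg _)
  obtain ⟨K', hK', hb'⟩ := hS.exists_integral_renormLocalTime_le hC (by norm_num) (by norm_num)
    hMom1 p (by omega)
  have hl2 : 0 < Real.log 2 := Real.log_pos (by norm_num)
  -- One constant serves both bounds; the final `1` makes it positive.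
  refine ⟨K / Real.log 2 ^ (p * (k - 1)) + K' / Real.log 2 ^ p + 1, by positivity,
    fun n hn r hr y y' hy hy' => ?_⟩
  have hn1 : 1 ≤ n := by omega
  have hn1' : (1 : ℝ) ≤ n := by exact_mod_cast hn1
  have hlog : 0 ≤ Real.log n := Real.log_natCast_nonneg n
  obtain ⟨hint, hle⟩ := hb n hn1 r hr y y' hy hy'
  have hA : 0 ≤ K / Real.log 2 ^ (p * (k - 1)) := by positivity
  have hB : 0 ≤ K' / Real.log 2 ^ p := by positivity
  refine ⟨hint, hle.trans ?_, ?_⟩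
  · have h1 : K ≤ (K / Real.log 2 ^ (p * (k - 1)) + K' / Real.log 2 ^ p + 1)
        * Real.log n ^ (p * (k - 1)) :=
      (le_mul_log_pow hK hn (p * (k - 1))).trans
        (mul_le_mul_of_nonneg_right (by linarith) (by positivity))
    have h2 : (n : ℝ) ≤ (n : ℝ) ^ k := le_self_pow₀ hn1' (by omega)
    gcongr
  · intro hk2
    subst hk2
    have h1 : K' ≤ (K / Real.log 2 ^ (p * (2 - 1)) + K' / Real.log 2 ^ p + 1) * Real.log n ^ p :=
      (le_mul_log_pow hK' hn p).trans
        (mul_le_mul_of_nonneg_right (by linarith) (by positivity))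
    refine (hb' n hn1 r hr y y' hy hy').2.trans ?_
    rw [show (1 / 3 : ℝ) * (p : ℝ) = (p : ℝ) / 3 by ring]
    gcongr
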